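/- Let $n\ge 2$ and $\lambda\in(0,1)$. Let $\mathbb E=\mathbb R^n$, $\widetilde M=(\mathbb E\times\mathbb R)\setminus\{(0,0)\}$ with coordinates $(z,t)$, let $\Gamma\cong\mathbb Z$ be the group generated by $\gamma(z,t)=(\lambda z,\lambda t)$, and let $M=\widetilde M/\Gamma$ be the quotient manifold (the real Hopf manifold, diffeomorphic to $\mathbb S^n\times\mathbb S^1$). The affine Reeb flow $\mathcal F$ is the one-dimensional foliation of $M$ induced by the foliation of $\widetilde M$ whose leaves are the integral curves of $\partial/\partial t$. All functions and forms are smooth and complex-valued. For a foliation $\mathcal F$ with tangent bundle $T\mathcal F$, let $\Omega^\ell_{\mathcal F}(M)$ be the space of smooth alternating $\ell$-forms on $T\mathcal F$, with the $C^\infty$ topology, and let $d_{\mathcal F}$ be the exterior derivative along the leaves, given for vector fields $X_0,\dots,X_\ell$ tangent to $\mathcal F$ by $$d_{\mathcal F}\alpha(X_0,\dots,X_\ell)=\sum_{i}(-1)^iX_i\cdot\alpha(X_0,\dots,\widehat{X_i},\dots,X_\ell)+\sum_{i<j}(-1)^{i+j}\alpha([X_i,X_j],X_0,\dots,\widehat{X_i},\dots,\widehat{X_j},\dots,X_\ell).$$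 The foliated cohomology is $H^\ell_{\mathcal F}(M)=Z^\ell_{\mathcal F}(M)/B^\ell_{\mathcal F}(M)$, where $Z^\ell_{\mathcal F}(M)=\ker d_{\mathcal F}$ and $B^\ell_{\mathcal F}(M)=\operatorname{im}d_{\mathcal F}$ in degree $\ell$, with the quotient topology. Then, for the affine Reeb flow: 1. $H^0_{\mathcal F}(M)=\mathbb C$: every function $f$ with $d_{\mathcal F}f=0$ is constant, and $f\mapsto$ (its value) is an isomorphism of topological vector spaces $H^0_{\mathcal F}(M)\to\mathbb C$. 2. $H^1_{\mathcal F}(M)$ is isomorphic, as a topological vector space (hence as a Fréchet space), to the Fréchet space $C^\infty(\mathbb S^{n-1}\times\mathbb S^1,\mathbb C)$. 3. $H^\ell_{\mathcal F}(M)=0$ for all $\ell\ge 2$. 4. $\mathcal F$ is a flow, that is, there is a nowhere vanishing smooth vector field tangent to $\mathcal F$; and for every such vector field $X$, $H^1_{\mathcal F}(M)$ is the space of obstructions to solving $X\cdot f=g$ in $C^\infty(M)$: the map $\alpha\mapsto\alpha(X)$ induces an isomorphism of topological vector spaces $H^1_{\mathcal F}(M)\to C^\infty(M)/\{X\cdot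 f: f\in C^\infty(M)\}$. -/

import Mathlib

open scoped Manifold ContDiff
noncomputable section

namespace Foliated

section SmoothFunctions

variable {E H : Type*} [NormedAddCommGroup E] [NormedSpace ℝ E] [TopologicalSpace H]
  (I : ModelWithCorners ℝ E H) (M : Type*) [TopologicalSpace M] [ChartedSpace H M]

/-- The smooth complex-valued functions on `M`, as a subalgebra of all functions. -/
def smoothSubalgebra : Subalgebra ℂ (M → ℂ) where
  carrier := {f | ContMDiff I 𝓘(ℝ, ℂ) ∞ f}
  mul_mem' hf hg := by
    have h : ContMDiff (𝓘(ℝ, ℂ).prod 𝓘(ℝ, ℂ)) 𝓘(ℝ, ℂ) ∞ (fun z : ℂ × ℂ => z.1 * z.2) := by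
      rw [contMDiff_iff]
      exact ⟨continuous_mul, fun _ _ => contDiff_mul.contDiffOn⟩
    exact h.comp (ContMDiff.prodMk hf hg)
  add_mem' hf hg := ContMDiff.add hf hg
  algebraMap_mem' c := contMDiff_const

/-- `C^∞(M, ℂ)`. This is a type of its own, so that it carries the `C^∞` topology below and not
the topology of pointwise convergence. -/
def SmoothFun : Type _ := smoothSubalgebra I M

instance : CommRing (SmoothFun I M) := inferInstanceAs (CommRing (smoothSubalgebra I M))

instance : Algebra ℂ (SmoothFun I M) := inferInstanceAs (Algebra ℂ (smoothSubalgebra I M))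

variable {I M}

instance : CoeFun (SmoothFun I M) (fun _ => M → ℂ) := ⟨fun f => f.1⟩

/-- The `k`-th derivative of `f` read in the chart at `x`. -/
def chartDeriv (x : M) (k : ℕ) (f : SmoothFun I M) : E → E [×k]→L[ℝ] ℂ :=
  iteratedFDerivWithin ℝ k (f ∘ (extChartAt I x).symm) (extChartAt I x).target

variable (I M)

/-- The usual Fréchet topology of `C^∞(M, ℂ)`: uniform convergence of all derivatives on the
compact subsets of the domains of the charts `extChartAt I x`, `x : M`. -/
instance : TopologicalSpace (SmoothFun I M) :=
  ⨅ (x : M) (k : ℕ), TopologicalSpace.induced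
    (fun f => UniformOnFun.ofFun {K : Set E | IsCompact K ∧ K ⊆ (extChartAt I x).target}
      (chartDeriv x k f)) inferInstance

end SmoothFunctions

section Foliations

variable {E : Type*} [NormedAddCommGroup E] [NormedSpace ℝ E]

/-- A smooth foliation of dimension `d` of a manifold `M` modelled on `E`, given by the tangent
spaces of its leaves: around every point there is a smooth chart `e` in which the leaves are the
parallels to a fixed `d`-dimensional linear subspace `W` of `E`. -/
structure Foliation (E : Type*) [NormedAddCommGroup E] [NormedSpace ℝ E] (M : Type*)
    [TopologicalSpace M] [ChartedSpace E M] (d : ℕ) where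
  tangent : ∀ p : M, Submodule ℝ (TangentSpace 𝓘(ℝ, E) p)
  exists_chart : ∀ p : M, ∃ e ∈ IsManifold.maximalAtlas 𝓘(ℝ, E) ∞ M, p ∈ e.source ∧
    ∃ W : Submodule ℝ E, Module.Finite ℝ W ∧ Module.finrank ℝ W = d ∧
      ∀ q ∈ e.source, ∀ v : TangentSpace 𝓘(ℝ, E) q,
        v ∈ tangent q ↔ (mfderiv 𝓘(ℝ, E) 𝓘(ℝ, E) e q v : E) ∈ W

variable {M : Type*} [TopologicalSpace M] [ChartedSpace E M] [IsManifold 𝓘(ℝ, E) ∞ M] {d : ℕ}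

/-- The smooth vector fields on `M`. -/
abbrev SmoothField (E M : Type*) [NormedAddCommGroup E] [NormedSpace ℝ E]
    [TopologicalSpace M] [ChartedSpace E M] [IsManifold 𝓘(ℝ, E) ∞ M] :=
  Cₛ^∞⟮𝓘(ℝ, E); E, (fun p : M => TangentSpace 𝓘(ℝ, E) p)⟯

/-- The derivative of a function along a vector field. -/
def fieldDeriv (X : SmoothField E M) : SmoothFun 𝓘(ℝ, E) M →ₗ[ℂ] SmoothFun 𝓘(ℝ, E) M where
  toFun f := ⟨fun p => (mfderiv 𝓘(ℝ, E) 𝓘(ℝ, ℂ) f p (X p) : ℂ), by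
    have h1 : ContMDiff 𝓘(ℝ, E).tangent 𝓘(ℝ, ℂ).tangent ∞ (tangentMap 𝓘(ℝ, E) 𝓘(ℝ, ℂ) f) :=
      f.2.contMDiff_tangentMap (by simp)
    exact (contMDiff_snd_tangentBundle_modelSpace ℂ 𝓘(ℝ, ℂ)).comp (h1.comp X.contMDiff)⟩
  map_add' f g := by
    refine Subtype.ext (funext fun p => ?_)
    have hf := f.2.mdifferentiableAt (x := p) (by simp)
    have hg := g.2.mdifferentiableAt (x := p) (by simp)
    have := (hf.hasMFDerivAt.add hg.hasMFDerivAt).mfderiv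
    exact congrArg (fun L : TangentSpace 𝓘(ℝ, E) p →L[ℝ] ℂ => L (X p)) this
  map_smul' c f := by
    refine Subtype.ext (funext fun p => ?_)
    have hf := f.2.mdifferentiableAt (x := p) (by simp)
    have hc : HasMFDerivAt 𝓘(ℝ, ℂ) 𝓘(ℝ, ℂ) (fun z : ℂ => c * z) (f p)
        (ContinuousLinearMap.mul ℝ ℂ c) :=
      (ContinuousLinearMap.mul ℝ ℂ c).hasMFDerivAt
    have := (hc.comp p hf.hasMFDerivAt).mfderiv
    exact congrArg (fun L : TangentSpace 𝓘(ℝ, E) p →L[ℝ] ℂ => L (X p)) this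

namespace Foliation

/-- The smooth vector fields tangent to the foliation. -/
def fields (F : Foliation E M d) : Submodule ℝ (SmoothField E M) where
  carrier := {X | ∀ p, X p ∈ F.tangent p}
  add_mem' hX hY p := (F.tangent p).add_mem (hX p) (hY p)
  zero_mem' p := (F.tangent p).zero_mem
  smul_mem' c _ hX p := (F.tangent p).smul_mem c (hX p)

/-- The value at `p` of a vector field tangent to the foliation. -/
def fieldAt (F : Foliation E M d) (X : F.fields) (p : M) : F.tangent p := ⟨X.1 p, X.2 p⟩

open VectorField Filter Topology in
theorem mlieBracket_mem [FiniteDimensional ℝ E] (F : Foliation E M d) (X Y : F.fields) (p : M) :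
    mlieBracket 𝓘(ℝ, E) X.1 Y.1 p ∈ F.tangent p := by
  have : CompleteSpace E := FiniteDimensional.complete ℝ E
  have : IsManifold 𝓘(ℝ, E) (minSmoothness ℝ 2) M := by
    rw [minSmoothness_of_isRCLikeNormedField]; infer_instance
  obtain ⟨e, he, hp, W, -, -, hW⟩ := F.exists_chart p
  have hsymm : ContMDiffOn 𝓘(ℝ, E) 𝓘(ℝ, E) ∞ e.symm e.target :=
    contMDiffOn_symm_of_mem_maximalAtlas he
  have hd : e.MDifferentiable 𝓘(ℝ, E) 𝓘(ℝ, E) :=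
    ⟨(contMDiffOn_of_mem_maximalAtlas he).mdifferentiableOn (by simp),
      hsymm.mdifferentiableOn (by simp)⟩
  have hy0 : e p ∈ e.target := e.map_source hp
  have hinv : ∀ y ∈ e.target, (mfderiv 𝓘(ℝ, E) 𝓘(ℝ, E) e.symm y).inverse =
      mfderiv 𝓘(ℝ, E) 𝓘(ℝ, E) e (e.symm y) := by
    intro y hy
    have h1 := hd.comp_symm_deriv hy
    have h2 := hd.symm_comp_deriv (e.map_target hy)
    rw [e.right_inv hy] at h2
    exact ContinuousLinearMap.inverse_eq h2 h1
  have hmem : ∀ (Z : F.fields), ∀ y ∈ e.target,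
      (mpullback 𝓘(ℝ, E) 𝓘(ℝ, E) e.symm Z.1 y : E) ∈ W := by
    intro Z y hy
    have := (hW _ (e.map_target hy) _).1 (Z.2 (e.symm y))
    rw [mpullback_apply, hinv y hy]
    exact this
  have hder : ∀ (Z : F.fields) (v : E), fderiv ℝ
      (fun y : E => (mpullback 𝓘(ℝ, E) 𝓘(ℝ, E) e.symm Z.1 y : E)) (e p) v ∈ W := by
    intro Z v
    by_contra hv
    obtain ⟨φ, hφ, hle⟩ := W.exists_le_ker_of_notMem hv
    set g : E → E := fun y => (mpullback 𝓘(ℝ, E) 𝓘(ℝ, E) e.symm Z.1 y : E) with hg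
    by_cases hd : DifferentiableAt ℝ g (e p)
    · have h1 := (LinearMap.toContinuousLinearMap φ).hasFDerivAt.comp (e p) hd.hasFDerivAt
      have h2 : (LinearMap.toContinuousLinearMap φ) ∘ g =ᶠ[𝓝 (e p)] fun _ => 0 := by
        filter_upwards [e.open_target.mem_nhds hy0] with y hy
        exact hle (hmem Z y hy)
      have h3 := h1.unique ((hasFDerivAt_const (0 : ℝ) (e p)).congr_of_eventuallyEq h2)
      exact hφ (congrArg (fun L : E →L[ℝ] ℝ => L v) h3)
    · rw [fderiv_zero_of_not_differentiableAt hd] at hφ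
      simp at hφ
  have hp' : e.symm (e p) = p := e.left_inv hp
  have key := mpullback_mlieBracket (I := 𝓘(ℝ, E)) (I' := 𝓘(ℝ, E)) (n := ∞) (f := e.symm)
    (V := X.1) (W := Y.1) (x₀ := e p)
    (X.1.contMDiff.mdifferentiableAt (by simp)) (Y.1.contMDiff.mdifferentiableAt (by simp))
    (hsymm.contMDiffAt (e.open_target.mem_nhds hy0))
    (by rw [minSmoothness_of_isRCLikeNormedField]; exact ENat.LEInfty.out)
  have hvs : ∀ A B : (∀ x : E, TangentSpace 𝓘(ℝ, E) x),
      mlieBracket 𝓘(ℝ, E) A B = lieBracket ℝ A B := by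
    intro A B
    rw [← mlieBracketWithin_univ, mlieBracketWithin_eq_lieBracketWithin]
    exact lieBracketWithin_univ
  rw [mpullback_apply, hinv _ hy0, hvs] at key
  rw [← hp', hW _ (e.map_target hy0)]
  refine (congrArg (· ∈ W) key).mpr ?_
  exact W.sub_mem (hder Y _) (hder X _)

/-- The Lie bracket of two vector fields tangent to the foliation. -/
def bracket [FiniteDimensional ℝ E] (F : Foliation E M d) (X Y : F.fields) : F.fields :=
  ⟨⟨VectorField.mlieBracket 𝓘(ℝ, E) X.1 Y.1, 
    haveI : CompleteSpace E := FiniteDimensional.complete ℝ E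
    haveI : IsManifold 𝓘(ℝ, E) (minSmoothness ℝ 2) M := by
      rw [minSmoothness_of_isRCLikeNormedField]; infer_instance
    haveI : IsManifold 𝓘(ℝ, E) (((⊤ : ℕ∞) : ℕ∞ω) + 1) M := inferInstanceAs (IsManifold 𝓘(ℝ, E) ∞ M)
    ContDiff.mlieBracket_vectorField (m := ⊤) (n := ⊤) X.1.contMDiff Y.1.contMDiff
      (by rw [minSmoothness_of_isRCLikeNormedField]; rfl)⟩, fun p => F.mlieBracket_mem X Y p⟩


/-- The foliated differential forms of degree `l`: families of alternating forms on the tangent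
spaces of the leaves which are smooth, i.e. take smooth values on smooth tangent fields. -/
def leafForms (F : Foliation E M d) (l : ℕ) :
    Submodule ℂ (∀ p : M, (F.tangent p) [⋀^Fin l]→ₗ[ℝ] ℂ) where
  carrier := {α | ∀ X : Fin l → F.fields,
    ContMDiff 𝓘(ℝ, E) 𝓘(ℝ, ℂ) ∞ fun p => α p (fun i => F.fieldAt (X i) p)}
  add_mem' hα hβ X := (hα X).add (hβ X)
  zero_mem' _ := contMDiff_const
  smul_mem' c _ hα X :=
    ((ContinuousLinearMap.mul ℝ ℂ c).contDiff.contMDiff).comp (hα X)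

/-- `Ω^l_F(M)`. -/
def LeafForm (F : Foliation E M d) (l : ℕ) : Type _ := F.leafForms l

instance (F : Foliation E M d) (l : ℕ) : AddCommGroup (F.LeafForm l) :=
  inferInstanceAs (AddCommGroup (F.leafForms l))

instance (F : Foliation E M d) (l : ℕ) : Module ℂ (F.LeafForm l) :=
  inferInstanceAs (Module ℂ (F.leafForms l))

/-- The smooth function `α(X_0, …, X_{l-1})`. -/
def eval (F : Foliation E M d) {l : ℕ} (X : Fin l → F.fields) :
    F.LeafForm l →ₗ[ℂ] SmoothFun 𝓘(ℝ, E) M where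
  toFun α := ⟨fun p => α.1 p (fun i => F.fieldAt (X i) p), α.2 X⟩
  map_add' _ _ := rfl
  map_smul' _ _ := rfl

/-- The `C^∞` topology on foliated forms: the coarsest one for which `α ↦ α(X_0, …, X_{l-1})` is
continuous into `C^∞(M, ℂ)` for all smooth vector fields tangent to the foliation. -/
instance (F : Foliation E M d) (l : ℕ) : TopologicalSpace (F.LeafForm l) :=
  ⨅ X : Fin l → F.fields, TopologicalSpace.induced (F.eval X) inferInstance

variable [FiniteDimensional ℝ E]

/-- The part of the exterior derivative which involves brackets,
`∑_{i < j} (-1)^(i+j) α([X_i, X_j], X_0, …, X̂_i, …, X̂_j, …, X_l)`; it is absent for `l = 0`. -/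
def bracketTerm (F : Foliation E M d) :
    (l : ℕ) → (Fin (l + 1) → F.fields) → F.LeafForm l →ₗ[ℂ] SmoothFun 𝓘(ℝ, E) M
  | 0, _ => 0
  | l + 1, X => ∑ j : Fin (l + 2), ∑ i : Fin (l + 1),
      if i.castSucc < j then
        (-1 : ℂ) ^ ((i : ℕ) + (j : ℕ)) •
          F.eval (Fin.cons (F.bracket (X i.castSucc) (X j))
            fun k : Fin l => X (j.succAbove (i.succAbove k)))
      else 0

/-- The exterior derivative along the leaves: `α ↦ d_F α (X_0, …, X_l)`. -/
def leafD (F : Foliation E M d) {l : ℕ} (X : Fin (l + 1) → F.fields) :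
    F.LeafForm l →ₗ[ℂ] SmoothFun 𝓘(ℝ, E) M :=
  ∑ i : Fin (l + 1), (-1 : ℂ) ^ (i : ℕ) •
      (fieldDeriv (X i).1 ∘ₗ F.eval fun k : Fin l => X (i.succAbove k))
    + F.bracketTerm l X

/-- `Z^l_F(M)`: the foliated forms `α` with `d_F α = 0`. -/
def cocycles (F : Foliation E M d) (l : ℕ) : Submodule ℂ (F.LeafForm l) :=
  ⨅ X : Fin (l + 1) → F.fields, LinearMap.ker (F.leafD X)

/-- `B^l_F(M)`: the foliated forms `β` with `β = d_F α` for some foliated form `α` (only `β = 0`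
if `l = 0`). -/
def coboundaries (F : Foliation E M d) : (l : ℕ) → Submodule ℂ (F.LeafForm l)
  | 0 => ⊥
  | l + 1 =>
    { carrier := {β | ∃ α : F.LeafForm l, ∀ X : Fin (l + 1) → F.fields, F.eval X β = F.leafD X α}
      add_mem' := by
        rintro β β' ⟨α, h⟩ ⟨α', h'⟩
        exact ⟨α + α', fun X => by rw [map_add, map_add, h, h']⟩
      zero_mem' := ⟨0, fun X => by rw [map_zero, map_zero]⟩
      smul_mem' := by
        rintro c β ⟨α, h⟩
        exact ⟨c • α, fun X => by rw [map_smul, map_smul, h]⟩ }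

/-- The foliated cohomology `H^l_F(M) = Z^l_F(M) / B^l_F(M)`, with the quotient topology. -/
abbrev Cohomology (F : Foliation E M d) (l : ℕ) : Type _ :=
  F.cocycles l ⧸ (F.coboundaries l).submoduleOf (F.cocycles l)

/-- The cohomology class of a cocycle. -/
abbrev cohClass (F : Foliation E M d) {l : ℕ} (α : F.cocycles l) : F.Cohomology l :=
  Submodule.Quotient.mk α

end Foliation
end Foliations
end Foliated

namespace Hopf

set_option linter.unusedSectionVars false

variable (V : Type*) [NormedAddCommGroup V] [NormedSpace ℝ V] (lam : Set.Ioo (0 : ℝ) 1)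

/-- The punctured vector space `V \ {0}`, as an open subset of `V`. -/
def punctured : TopologicalSpace.Opens V := ⟨{0}ᶜ, isOpen_compl_singleton⟩

/-- Two points of `V \ {0}` are equivalent if they lie in the same orbit of the group
`Γ = {γ^k : k ∈ ℤ}` generated by the homothety `γ x = λ x`. -/
def orbitSetoid : Setoid (punctured V) where
  r x y := ∃ k : ℤ, (y : V) = (lam : ℝ) ^ k • (x : V)
  iseqv :=
    { refl := fun x => ⟨0, by simp⟩
      symm := by
        rintro x y ⟨k, h⟩
        exact ⟨-k, by rw [h, smul_smul, ← zpow_add₀ lam.2.1.ne']; simp⟩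
      trans := by
        rintro x y z ⟨k, h⟩ ⟨l, h'⟩
        exact ⟨l + k, by rw [h', h, smul_smul, ← zpow_add₀ lam.2.1.ne']⟩ }

/-- The Hopf manifold `(V \ {0}) / Γ`. -/
def HopfManifold : Type _ := Quotient (orbitSetoid V lam)

/-- The quotient topology. -/
instance : TopologicalSpace (HopfManifold V lam) :=
  inferInstanceAs (TopologicalSpace (Quotient (orbitSetoid V lam)))

variable {V} in
/-- The canonical projection `V \ {0} → (V \ {0}) / Γ`. -/
def proj (x : punctured V) : HopfManifold V lam := Quotient.mk (orbitSetoid V lam) x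

variable {V lam}

theorem proj_eq_iff {x y : punctured V} :
    proj lam x = proj lam y ↔ ∃ k : ℤ, (y : V) = (lam : ℝ) ^ k • (x : V) := Quotient.eq

theorem proj_surjective : Function.Surjective (proj (V := V) lam) := Quotient.mk_surjective

theorem continuous_proj : Continuous (proj (V := V) lam) := continuous_quotient_mk'

/-- The homothety `γ^k` of `V \ {0}`. -/
def dilation (lam : Set.Ioo (0 : ℝ) 1) (k : ℤ) (x : punctured V) : punctured V :=
  ⟨(lam : ℝ) ^ k • (x : V), smul_ne_zero (zpow_ne_zero _ lam.2.1.ne') x.2⟩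

theorem proj_dilation (k : ℤ) (x : punctured V) : proj lam (dilation lam k x) = proj lam x :=
  (proj_eq_iff.2 ⟨k, rfl⟩).symm

theorem continuous_dilation (k : ℤ) : Continuous (dilation (V := V) lam k) :=
  (continuous_subtype_val.const_smul _).subtype_mk _

theorem isOpenMap_proj : IsOpenMap (proj (V := V) lam) := by
  intro U hU
  have : proj lam ⁻¹' (proj lam '' U) = ⋃ k : ℤ, dilation lam k ⁻¹' U := by
    ext y
    simp only [Set.mem_preimage, Set.mem_image, Set.mem_iUnion]
    constructor
    · rintro ⟨x, hx, hxy⟩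
      obtain ⟨k, hk⟩ := proj_eq_iff.1 hxy.symm
      refine ⟨k, ?_⟩
      have : dilation lam k y = x := Subtype.ext hk.symm
      rwa [this]
    · rintro ⟨k, hk⟩
      exact ⟨_, hk, proj_dilation k y⟩
  exact isQuotientMap_quotient_mk'.isOpen_preimage.1
    (this ▸ isOpen_iUnion fun k => hU.preimage (continuous_dilation k))

/-- The open annulus `{y : λ a < ‖y‖ < a}` around `x`, where `a = 2 ‖x‖ / (1 + λ)`; it meets every
orbit of `Γ` at most once. -/
def annulus (lam : Set.Ioo (0 : ℝ) 1) (x : punctured V) : Set (punctured V) :=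
  {y | lam * (2 * ‖(x : V)‖ / (1 + lam)) < ‖(y : V)‖ ∧ ‖(y : V)‖ < 2 * ‖(x : V)‖ / (1 + lam)}

theorem isOpen_annulus (x : punctured V) : IsOpen (annulus lam x) :=
  (isOpen_lt continuous_const continuous_subtype_val.norm).inter
    (isOpen_lt continuous_subtype_val.norm continuous_const)

theorem mem_annulus (x : punctured V) : x ∈ annulus lam x := by
  have hx : 0 < ‖(x : V)‖ := norm_pos_iff.2 x.2
  have h0 := lam.2.1
  have h1 := lam.2.2
  have h2 : (0 : ℝ) < 1 + lam := by linarith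
  constructor
  · rw [← mul_div_assoc, div_lt_iff₀ h2]
    nlinarith
  · rw [lt_div_iff₀ h2]
    nlinarith

theorem injOn_proj (x : punctured V) : Set.InjOn (proj lam) (annulus lam x) := by
  have key : ∀ y ∈ annulus lam x, ∀ z ∈ annulus lam x, ∀ k : ℤ,
      (z : V) = (lam : ℝ) ^ k • (y : V) → k ≤ 0 := by
    intro y hy z hz k h
    by_contra! hk
    have h1 : (lam : ℝ) ^ k ≤ lam := by
      have := zpow_le_zpow_right_of_le_one₀ lam.2.1 lam.2.2.le (show (1 : ℤ) ≤ k by omega)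
      simpa using this
    have h2 : ‖(z : V)‖ ≤ lam * ‖(y : V)‖ := by
      rw [h, norm_smul, Real.norm_of_nonneg (zpow_nonneg lam.2.1.le k)]
      exact mul_le_mul_of_nonneg_right h1 (norm_nonneg _)
    have h3 := mul_lt_mul_of_pos_left hy.2 lam.2.1
    linarith [hz.1]
  intro y hy z hz h
  obtain ⟨k, hk⟩ := proj_eq_iff.1 h
  obtain ⟨l, hl⟩ := proj_eq_iff.1 h.symm
  have hk0 := key y hy z hz k hk
  have hk1 : (y : V) = (lam : ℝ) ^ (-k) • (z : V) := by
    rw [hk, smul_smul, ← zpow_add₀ lam.2.1.ne']; simp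
  have hk2 := key z hz y hy (-k) hk1
  obtain rfl : k = 0 := by omega
  exact Subtype.ext (by simpa using hk.symm)

/-- The projection, as a homeomorphism from the annulus around `x` onto its image. -/
def projHomeo (x : punctured V) : OpenPartialHomeomorph (punctured V) (HopfManifold V lam) :=
  haveI : Nonempty (punctured V) := ⟨x⟩
  OpenPartialHomeomorph.ofContinuousOpen ((injOn_proj (lam := lam) x).toPartialEquiv (proj lam) _)
    continuous_proj.continuousOn isOpenMap_proj (isOpen_annulus x)

/-- The chart of the Hopf manifold around `proj x` which is inverse to the projection of the
annulus around `x`. -/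
def chart (lam : Set.Ioo (0 : ℝ) 1) (x : punctured V) : OpenPartialHomeomorph (HopfManifold V lam) V :=
  haveI : Nonempty (punctured V) := ⟨x⟩
  (projHomeo x).symm.trans
    ((punctured V).isOpen.isOpenEmbedding_subtypeVal.toOpenPartialHomeomorph _)


theorem chart_proj (x : punctured V) {y : punctured V} (hy : y ∈ annulus lam x) :
    proj lam y ∈ (chart lam x).source ∧ chart lam x (proj lam y) = (y : V) := by
  have : Nonempty (punctured V) := ⟨x⟩
  have h1 : (projHomeo (lam := lam) x) y = proj lam y := rfl
  have h2 : y ∈ (projHomeo (lam := lam) x).source := hy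
  constructor
  · rw [chart, OpenPartialHomeomorph.trans_source]
    exact ⟨(projHomeo x).map_source h2, Set.mem_univ _⟩
  · change (((projHomeo (lam := lam) x).symm (projHomeo (lam := lam) x y) : punctured V) : V) = y
    rw [(projHomeo x).left_inv h2]

theorem proj_chart (x : punctured V) {p : HopfManifold V lam} (hp : p ∈ (chart lam x).source) :
    ∃ y ∈ annulus lam x, chart lam x p = (y : V) ∧ proj lam y = p := by
  have : Nonempty (punctured V) := ⟨x⟩
  rw [chart, OpenPartialHomeomorph.trans_source] at hp
  exact ⟨(projHomeo x).symm p, (projHomeo x).map_target hp.1, rfl, (projHomeo x).right_inv hp.1⟩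

theorem chart_symm (x : punctured V) {v : V} (hv : v ∈ (chart lam x).target) :
    ∃ y ∈ annulus lam x, v = (y : V) ∧ (chart lam x).symm v = proj lam y := by
  obtain ⟨y, hy, h, h'⟩ := proj_chart x ((chart lam x).map_target hv)
  rw [(chart lam x).right_inv hv] at h
  exact ⟨y, hy, h, h'.symm⟩

/-- The charts of the Hopf manifold: inverses of the projection on annuli. -/
instance : ChartedSpace V (HopfManifold V lam) where
  atlas := Set.range (chart lam)
  chartAt p := chart lam (Quotient.out p)
  mem_chart_source p := by
    have := (chart_proj (lam := lam) (Quotient.out p) (mem_annulus (Quotient.out p))).1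
    rwa [show proj lam (Quotient.out p) = p from Quotient.out_eq p] at this
  chart_mem_atlas p := ⟨_, rfl⟩

open Filter Topology

theorem chart_proj_eventually (x y : punctured V) (hy : proj lam y ∈ (chart lam x).source) :
    ∃ k : ℤ, ∀ᶠ z in 𝓝 y, proj lam z ∈ (chart lam x).source ∧
      chart lam x (proj lam z) = (lam : ℝ) ^ k • (z : V) := by
  obtain ⟨y', hy', -, h⟩ := proj_chart x hy
  obtain ⟨k, hk⟩ := proj_eq_iff.1 h.symm
  obtain rfl : dilation lam k y = y' := Subtype.ext hk.symm
  refine ⟨k, ?_⟩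
  filter_upwards [((isOpen_annulus x).preimage (continuous_dilation k)).mem_nhds hy'] with z hz
  have := chart_proj (lam := lam) x hz
  rwa [proj_dilation] at this

instance : IsManifold 𝓘(ℝ, V) ∞ (HopfManifold V lam) := by
  refine isManifold_of_contDiffOn _ _ _ ?_
  rintro _ _ ⟨x, rfl⟩ ⟨x', rfl⟩ v ⟨hv, -⟩
  have hv' : v ∈ (chart lam x).target ∧ (chart lam x).symm v ∈ (chart lam x').source := by
    simpa using hv
  obtain ⟨y, hy, rfl, h⟩ := chart_symm x hv'.1
  rw [h] at hv'
  obtain ⟨k, hk⟩ := chart_proj_eventually x' y hv'.2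
  refine ContDiffAt.contDiffWithinAt ?_
  have hs : ContDiffAt ℝ ∞ (fun v : V => (lam : ℝ) ^ k • v) (y : V) :=
    contDiffAt_id.const_smul _
  refine hs.congr_of_eventuallyEq ?_
  have h1 := ((punctured V).isOpen.isOpenEmbedding_subtypeVal.map_nhds_eq y)
  rw [← h1]
  refine eventually_map.2 ?_
  filter_upwards [hk, (isOpen_annulus x).mem_nhds hy] with z hz hz'
  have h2 := chart_proj (lam := lam) x hz'
  have h3 : (chart lam x).symm (z : V) = proj lam z := by
    rw [← h2.2, (chart lam x).left_inv h2.1]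
  simpa [h3] using hz.2

theorem contMDiff_proj : ContMDiff 𝓘(ℝ, V) 𝓘(ℝ, V) ∞ (proj (V := V) lam) := by
  intro y
  have h0 := chart_proj (lam := lam) y (mem_annulus y)
  obtain ⟨k, hk⟩ := chart_proj_eventually y y h0.1
  have h1 : ContMDiffAt 𝓘(ℝ, V) 𝓘(ℝ, V) ∞ (chart lam y).symm (chart lam y (proj lam y)) :=
    (contMDiffOn_symm_of_mem_maximalAtlas
      (IsManifold.subset_maximalAtlas
        (show chart lam y ∈ atlas V (HopfManifold V lam) from ⟨y, rfl⟩))).contMDiffAt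
      ((chart lam y).open_target.mem_nhds ((chart lam y).map_source h0.1))
  have h2 : ContMDiffAt 𝓘(ℝ, V) 𝓘(ℝ, V) ∞ (fun z : punctured V => chart lam y (proj lam z)) y := by
    have : ContMDiffAt 𝓘(ℝ, V) 𝓘(ℝ, V) ∞ (fun z : punctured V => (lam : ℝ) ^ k • (z : V)) y :=
      (contDiff_id.const_smul ((lam : ℝ) ^ k)).contMDiff.contMDiffAt.comp y
        contMDiff_subtype_val.contMDiffAt
    exact this.congr_of_eventuallyEq (hk.mono fun z hz => hz.2)
  refine (h1.comp y h2).congr_of_eventuallyEq ?_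
  filter_upwards [hk] with z hz
  exact ((chart lam y).left_inv hz.1).symm

theorem hasMFDerivAt_val (y : punctured V) :
    HasMFDerivAt 𝓘(ℝ, V) 𝓘(ℝ, V) (Subtype.val : punctured V → V) y
      (ContinuousLinearMap.id ℝ V) := by
  refine ⟨continuous_subtype_val.continuousAt, ?_⟩
  have h := (punctured V).chartAt_subtype_val_symm_eventuallyEq (H := V) (x := y)
  refine HasFDerivAt.hasFDerivWithinAt ?_
  refine (hasFDerivAt_id _).congr_of_eventuallyEq ?_
  exact h.symm

theorem mfderiv_chart_proj (x y : punctured V) (hy : proj lam y ∈ (chart lam x).source) :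
    ∃ k : ℤ, ∀ v : V, (mfderiv 𝓘(ℝ, V) 𝓘(ℝ, V) (chart lam x) (proj lam y)
      (mfderiv 𝓘(ℝ, V) 𝓘(ℝ, V) (proj lam) y v) : V) = (lam : ℝ) ^ k • v := by
  obtain ⟨k, hk⟩ := chart_proj_eventually x y hy
  refine ⟨k, fun v => ?_⟩
  have h1 : MDifferentiableAt 𝓘(ℝ, V) 𝓘(ℝ, V) (chart lam x) (proj lam y) :=
    mdifferentiableAt_atlas (show chart lam x ∈ atlas V (HopfManifold V lam) from ⟨x, rfl⟩) hy
  have h2 : MDifferentiableAt 𝓘(ℝ, V) 𝓘(ℝ, V) (proj lam) y :=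
    contMDiff_proj.mdifferentiableAt (by simp)
  have h3 := h1.hasMFDerivAt.comp y h2.hasMFDerivAt
  have h4 : HasMFDerivAt 𝓘(ℝ, V) 𝓘(ℝ, V) (fun v : V => (lam : ℝ) ^ k • v) (y : V)
      ((lam : ℝ) ^ k • ContinuousLinearMap.id ℝ V) :=
    ((lam : ℝ) ^ k • ContinuousLinearMap.id ℝ V).hasMFDerivAt
  have h5 := (h4.comp y (hasMFDerivAt_val y)).congr_of_eventuallyEq (hk.mono fun z hz => hz.2)
  exact congrArg (fun L : V →L[ℝ] V => L v) (hasMFDerivAt_unique h3 h5)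

end Hopf

namespace Reeb

open Hopf Foliated

/-- The model space `𝔼 × ℝ`, where `𝔼 = ℝⁿ`. -/
abbrev Model (n : ℕ) : Type := EuclideanSpace ℝ (Fin n) × ℝ

/-- The affine Reeb flow on the Hopf manifold `M = ((𝔼 × ℝ) \ {0}) / Γ`, `dim M = n + 1`: the
foliation of dimension 1 induced by the foliation of `(𝔼 × ℝ) \ {0}` by the lines `z = const`, i.e.
its tangent line at `p` is spanned by the images of `∂/∂t` under the differential of the
projection at the points over `p`. -/
def affineFlow (n : ℕ) (lam : Set.Ioo (0 : ℝ) 1) :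
    Foliation (Model n) (HopfManifold (Model n) lam) 1 where
  tangent p := Submodule.span ℝ {v | ∃ x : punctured (Model n), proj lam x = p ∧
    (v : Model n) = mfderiv 𝓘(ℝ, Model n) 𝓘(ℝ, Model n) (proj lam) x ((0, 1) : Model n)}
  exists_chart p := by
    obtain ⟨x, rfl⟩ := proj_surjective p
    have hatlas : chart lam x ∈ atlas (Model n) (HopfManifold (Model n) lam) := ⟨x, rfl⟩
    have hne : ((0, 1) : Model n) ≠ 0 := by simp
    refine ⟨chart lam x, IsManifold.subset_maximalAtlas hatlas,
      (chart_proj x (mem_annulus x)).1, Submodule.span ℝ {((0, 1) : Model n)}, inferInstance,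
      finrank_span_singleton hne, ?_⟩
    intro q hq v
    have hinj := (mdifferentiable_of_mem_atlas (I := 𝓘(ℝ, Model n)) hatlas).mfderiv_injective hq
    let L : Model n →L[ℝ] Model n := mfderiv 𝓘(ℝ, Model n) 𝓘(ℝ, Model n) (chart lam x) q
    constructor
    · intro hv
      induction hv using Submodule.span_induction with
      | mem v hv =>
        obtain ⟨y, rfl, hv⟩ := hv
        obtain ⟨k, hk⟩ := mfderiv_chart_proj x y hq
        have h := hk ((0, 1) : Model n)
        rw [← hv] at h
        exact (congrArg (· ∈ Submodule.span ℝ {((0, 1) : Model n)}) h).mpr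
          (Submodule.smul_mem _ _ (Submodule.mem_span_singleton_self _))
      | zero =>
        exact (congrArg (· ∈ Submodule.span ℝ {((0, 1) : Model n)}) L.map_zero).mpr
          (Submodule.zero_mem _)
      | add v w _ _ hv hw =>
        exact (congrArg (· ∈ Submodule.span ℝ {((0, 1) : Model n)}) (L.map_add v w)).mpr
          (Submodule.add_mem _ hv hw)
      | smul c v _ hv =>
        exact (congrArg (· ∈ Submodule.span ℝ {((0, 1) : Model n)}) (L.map_smul c v)).mpr
          (Submodule.smul_mem _ c hv)
    · intro hv
      obtain ⟨c, hc⟩ := Submodule.mem_span_singleton.1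
        (show L v ∈ Submodule.span ℝ {((0, 1) : Model n)} from hv)
      obtain ⟨y, -, -, rfl⟩ := proj_chart x hq
      obtain ⟨k, hk⟩ := mfderiv_chart_proj x y hq
      have hk0 : (lam : ℝ) ^ k ≠ 0 := zpow_ne_zero _ lam.2.1.ne'
      have h : v = (c * ((lam : ℝ) ^ k)⁻¹) •
          mfderiv 𝓘(ℝ, Model n) 𝓘(ℝ, Model n) (proj lam) y ((0, 1) : Model n) := by
        refine hinj (?_ : L v = L _)
        have h1 : ∀ w : Model n, (c * ((lam : ℝ) ^ k)⁻¹) • ((lam : ℝ) ^ k • w) = c • w :=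
          fun w => by rw [smul_smul, mul_assoc, inv_mul_cancel₀ hk0, mul_one]
        exact hc.symm.trans (((congrArg ((c * ((lam : ℝ) ^ k)⁻¹) • ·) (hk (0, 1))).trans
          (h1 _)).symm.trans (L.map_smul _ _).symm)
      rw [h]
      exact Submodule.smul_mem _ _ (Submodule.subset_span ⟨y, rfl, rfl⟩)

/-- The unit sphere `S^k` of `ℝ^(k+1)`. -/
abbrev Sphere (k : ℕ) : Type := Metric.sphere (0 : EuclideanSpace ℝ (Fin (k + 1))) 1

/-- The Fréchet space `C^∞(S^k × S^1, ℂ)`. -/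
abbrev SphereCircleFun (k : ℕ) : Type :=
  SmoothFun ((𝓡 k).prod (𝓡 1)) (Sphere k × Circle)

end Reeb

end

open Foliated Hopf Reeb

/-! Let r be the Euclidean norm on 𝔼 × ℝ. The field T = r ∂/∂t is γ-invariant, so it descends to M,
where it spans the foliation. The form d(t/r) + (t/r) d log r takes the value 1 on T. Hence a
leafwise 1-form α is determined by the function α(T), which is arbitrary; all 1-forms are closed,
forms of degree at least 2 vanish, and H¹ is C^∞(M) modulo the image of T (`cocycles_one_eq_top`,
`mem_coboundaries_one`). Any nowhere vanishing tangent field is T times an invertible function,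
which gives the statement on obstructions.

In degree 0, a function with Tf = 0 is constant on each line z = const, z ≠ 0. By invariance f(z, t)
= f(λᵏz, λᵏt) = f(λᵏz, 1), and this tends to f(0, 1).

In degree 1, Tf = g means ∂f/∂t = h, where h = g/r is homogeneous of degree -1 under γ. The two
half-axes z = 0 give two closed leaves, and the periods of h on them (`loop` at a = 1 and a = -1)
must vanish. If they do, integrating h from t = a and subtracting a series over z, λz, λ²z, …
(`loopSum`) gives an invariant primitive wherever z ≠ 0 or t has the sign of a. The series converges
smoothly because `loop` is smooth in z and vanishes at z = 0, so Hadamard's lemma gives geometric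
decay. The two primitives differ by an invariant function of z ≠ 0, the `jump`, which lives on the
Hopf manifold N of 𝔼. A global solution exists exactly when the jump is constant
(`exists_fieldDeriv_eq`, `jump_fieldDeriv`). Every jump and every pair of periods occurs, so H¹ is
(C^∞(N)/ℂ) ⊕ ℂ². Using the value at a base point for one period, this is C^∞(N) ⊕ ℂ (`obstruction`).
The last factor ℂ is absorbed by dividing by w - 1, with w a coordinate on the circle factor
(`absorb`), and N is diffeomorphic to S^(n-1) × S¹ (`toSphereCircle`).

For the topologies, continuity of a map into C^∞ is the same as joint continuity, in the parameter
and the point, of all its derivatives in charts (`SmoothFamily`). Each surjection above has a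
continuous right inverse built from such families, hence is a quotient map; no open mapping theorem
is used. -/

section

open Filter Topology Set
noncomputable section

/-! ### Families of differentiable functions depending continuously on a parameter -/

section Families

variable {X X' : Type*} [TopologicalSpace X] [TopologicalSpace X']
  {V V' W W' W'' : Type} [NormedAddCommGroup V] [NormedSpace ℝ V]
  [NormedAddCommGroup V'] [NormedSpace ℝ V'] [NormedAddCommGroup W] [NormedSpace ℝ W]
  [NormedAddCommGroup W'] [NormedSpace ℝ W'] [NormedAddCommGroup W''] [NormedSpace ℝ W'']

/-- `Φ ξ v` is `k` times differentiable in `v`, and its derivatives up to order `k` in `v` are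
jointly continuous in `(ξ, v) ∈ S`. -/
def DiffFamily : ℕ → ∀ {W : Type} [NormedAddCommGroup W] [NormedSpace ℝ W],
    (X → V → W) → Set (X × V) → Prop
  | 0, _, _, _, Φ, S => ContinuousOn (fun p : X × V => Φ p.1 p.2) S
  | k + 1, _, _, _, Φ, S => ContinuousOn (fun p : X × V => Φ p.1 p.2) S ∧
      (∀ p ∈ S, DifferentiableAt ℝ (Φ p.1) p.2) ∧ DiffFamily k (fun ξ v => fderiv ℝ (Φ ξ) v) S

/-- `Φ ξ v` is smooth in `v`, with derivatives jointly continuous in `(ξ, v) ∈ S`. -/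
def SmoothFamily (Φ : X → V → W) (S : Set (X × V)) : Prop := ∀ k, DiffFamily k Φ S

namespace DiffFamily

theorem continuousOn {k : ℕ} {Φ : X → V → W} {S : Set (X × V)} (h : DiffFamily k Φ S) :
    ContinuousOn (fun p : X × V => Φ p.1 p.2) S := by
  cases k with
  | zero => exact h
  | succ k => exact h.1

theorem slice_nhds {Y : Type*} [TopologicalSpace Y] {S : Set (X × Y)} (hS : IsOpen S) {p : X × Y}
    (hp : p ∈ S) :
    ∀ᶠ v in 𝓝 p.2, (p.1, v) ∈ S :=
  (Continuous.prodMk_right p.1).continuousAt (hS.mem_nhds hp)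

/-- Equality on an open set of pairs gives equality of slices near each point, so the derivatives
agree too and the induction closes. This allows a different formula near each point, as needed for
quotients with removable singularities and for products extended by zero. -/
theorem of_locally {k : ℕ} {Φ : X → V → W} {S : Set (X × V)}
    (h : ∀ p ∈ S, ∃ S' : Set (X × V), IsOpen S' ∧ p ∈ S' ∧ ∃ Φ' : X → V → W,
      DiffFamily k Φ' S' ∧ ∀ q ∈ S', Φ q.1 q.2 = Φ' q.1 q.2) : DiffFamily k Φ S := by
  have hc : ∀ {W : Type} [NormedAddCommGroup W] [NormedSpace ℝ W] {k : ℕ} {Φ : X → V → W},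
      (∀ p ∈ S, ∃ S' : Set (X × V), IsOpen S' ∧ p ∈ S' ∧ ∃ Φ' : X → V → W,
        DiffFamily k Φ' S' ∧ ∀ q ∈ S', Φ q.1 q.2 = Φ' q.1 q.2) →
      ContinuousOn (fun p : X × V => Φ p.1 p.2) S := by
    intro W _ _ k Φ h p hp
    obtain ⟨S', hS', hpS', Φ', hΦ', heq⟩ := h p hp
    have h1 := hΦ'.continuousOn.continuousAt (hS'.mem_nhds hpS')
    refine (h1.congr ?_).continuousWithinAt
    filter_upwards [hS'.mem_nhds hpS'] with q hq using (heq q hq).symm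
  induction k generalizing W with
  | zero => exact hc h
  | succ k ih =>
    have heq' : ∀ (S' : Set (X × V)) (Φ' : X → V → W), IsOpen S' →
        (∀ q ∈ S', Φ q.1 q.2 = Φ' q.1 q.2) → ∀ q ∈ S', Φ q.1 =ᶠ[𝓝 q.2] Φ' q.1 := by
      intro S' Φ' hS' heq q hq
      filter_upwards [slice_nhds hS' hq] with v hv using heq _ hv
    refine ⟨hc h, fun p hp => ?_, ih fun p hp => ?_⟩
    · obtain ⟨S', hS', hpS', Φ', hΦ', heq⟩ := h p hp
      exact (hΦ'.2.1 p hpS').congr_of_eventuallyEq (heq' S' Φ' hS' heq p hpS')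
    · obtain ⟨S', hS', hpS', Φ', hΦ', heq⟩ := h p hp
      exact ⟨S', hS', hpS', _, hΦ'.2.2, fun q hq => (heq' S' Φ' hS' heq q hq).fderiv_eq⟩

theorem congr {k : ℕ} {Φ Φ' : X → V → W} {S : Set (X × V)} (h : DiffFamily k Φ S) (hS : IsOpen S)
    (heq : ∀ q ∈ S, Φ' q.1 q.2 = Φ q.1 q.2) : DiffFamily k Φ' S :=
  of_locally fun _ hp => ⟨S, hS, hp, Φ, h, heq⟩

theorem mono {k : ℕ} {Φ : X → V → W} {S S' : Set (X × V)} (h : DiffFamily k Φ S) (hS : S' ⊆ S) :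
    DiffFamily k Φ S' := by
  induction k generalizing W with
  | zero => exact ContinuousOn.mono h hS
  | succ k ih => exact ⟨h.1.mono hS, fun p hp => h.2.1 p (hS hp), ih h.2.2⟩

/-- The inductive step for all closure properties below: it is enough to exhibit the derivative by a
formula that is itself a family of lower order. -/
theorem succ_of_hasFDerivAt {k : ℕ} {Φ : X → V → W} {Φ' : X → V → V →L[ℝ] W} {S : Set (X × V)}
    (hS : IsOpen S) (h0 : ContinuousOn (fun p : X × V => Φ p.1 p.2) S)
    (h1 : ∀ p ∈ S, HasFDerivAt (Φ p.1) (Φ' p.1 p.2) p.2) (h2 : DiffFamily k Φ' S) :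
    DiffFamily (k + 1) Φ S :=
  ⟨h0, fun p hp => (h1 p hp).differentiableAt, h2.congr hS fun p hp => (h1 p hp).fderiv⟩

theorem hasFDerivAt {k : ℕ} {Φ : X → V → W} {S : Set (X × V)} (h : DiffFamily (k + 1) Φ S)
    {p : X × V} (hp : p ∈ S) : HasFDerivAt (Φ p.1) (fderiv ℝ (Φ p.1) p.2) p.2 :=
  (h.2.1 p hp).hasFDerivAt

theorem pred {k : ℕ} {Φ : X → V → W} {S : Set (X × V)} (h : DiffFamily (k + 1) Φ S) :
    DiffFamily k Φ S := by
  induction k generalizing W with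
  | zero => exact h.1
  | succ k ih => exact ⟨h.1, h.2.1, ih h.2.2⟩

theorem clm_apply {k : ℕ} {Φ : X → V → W} {S : Set (X × V)} (hS : IsOpen S)
    (h : DiffFamily k Φ S) (L : W →L[ℝ] W') : DiffFamily k (fun ξ v => L (Φ ξ v)) S := by
  induction k generalizing W W' with
  | zero => exact L.continuous.comp_continuousOn h
  | succ k ih =>
    exact succ_of_hasFDerivAt (Φ' := fun ξ v => L ∘SL fderiv ℝ (Φ ξ) v) hS
      (L.continuous.comp_continuousOn h.1) (fun p hp => L.hasFDerivAt.comp p.2 (h.hasFDerivAt hp))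
      (ih h.2.2 (ContinuousLinearMap.compL ℝ V W W' L))

theorem add {k : ℕ} {Φ Ψ : X → V → W} {S : Set (X × V)} (hS : IsOpen S)
    (h : DiffFamily k Φ S) (h' : DiffFamily k Ψ S) :
    DiffFamily k (fun ξ v => Φ ξ v + Ψ ξ v) S := by
  induction k generalizing W with
  | zero => exact ContinuousOn.add h h'
  | succ k ih =>
    exact succ_of_hasFDerivAt hS (h.1.add h'.1)
      (fun p hp => (h.hasFDerivAt hp).add (h'.hasFDerivAt hp)) (ih h.2.2 h'.2.2)

/-- The product rule writes the derivative as two terms of the same shape, for the bilinear maps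
`precompR` and `precompL`. The induction therefore varies the target spaces and lowers the order of
the undifferentiated factor by `pred`. -/
theorem bilinear {k : ℕ} {Φ : X → V → W} {Ψ : X → V → W'} {S : Set (X × V)} (hS : IsOpen S)
    (h : DiffFamily k Φ S) (h' : DiffFamily k Ψ S) (B : W →L[ℝ] W' →L[ℝ] W'') :
    DiffFamily k (fun ξ v => B (Φ ξ v) (Ψ ξ v)) S := by
  have hc : ContinuousOn (fun p : X × V => B (Φ p.1 p.2) (Ψ p.1 p.2)) S :=
    (B.continuous.comp_continuousOn h.continuousOn).clm_apply h'.continuousOn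
  induction k generalizing W W' W'' with
  | zero => exact hc
  | succ k ih =>
    refine succ_of_hasFDerivAt (Φ' := fun ξ v => B.precompR V (Φ ξ v) (fderiv ℝ (Ψ ξ) v) +
      B.precompL V (fderiv ℝ (Φ ξ) v) (Ψ ξ v)) hS hc
      (fun p hp => B.hasFDerivAt_of_bilinear (h.hasFDerivAt hp) (h'.hasFDerivAt hp)) ?_
    exact (ih h.pred h'.2.2 (B.precompR V)
        (((B.precompR V).continuous.comp_continuousOn h.1).clm_apply h'.2.2.continuousOn)).add hS
      (ih h.2.2 h'.pred (B.precompL V)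
        (((B.precompL V).continuous.comp_continuousOn h.2.2.continuousOn).clm_apply h'.1))

theorem of_param {k : ℕ} {a : X → W} {S : Set (X × V)} (hS : IsOpen S)
    (ha : ContinuousOn (fun p : X × V => a p.1) S) : DiffFamily k (fun ξ (_ : V) => a ξ) S := by
  -- The derivative in v is zero, so the zero family is needed at every order first.
  have h0 : ∀ {W : Type} [NormedAddCommGroup W] [NormedSpace ℝ W] (k : ℕ),
      DiffFamily k (fun (_ : X) (_ : V) => (0 : W)) S := by
    intro W _ _ k
    induction k generalizing W with
    | zero => exact continuousOn_const
    | succ k ih =>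
      exact succ_of_hasFDerivAt hS continuousOn_const (fun p _ => hasFDerivAt_const _ _) ih
  cases k with
  | zero => exact ha
  | succ k => exact succ_of_hasFDerivAt hS ha (fun p _ => hasFDerivAt_const _ _) (h0 k)

theorem of_contDiffOn {k : ℕ} {f : V → W} {U : Set V} (hU : IsOpen U) (hf : ContDiffOn ℝ ∞ f U)
    {S : Set (X × V)} (hSU : ∀ p ∈ S, p.2 ∈ U) :
    DiffFamily k (fun (_ : X) => f) S := by
  induction k generalizing W with
  | zero => exact hf.continuousOn.comp continuousOn_snd hSU
  | succ k ih =>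
    exact ⟨hf.continuousOn.comp continuousOn_snd hSU, fun p hp =>
      (hf.contDiffAt (hU.mem_nhds (hSU p hp))).differentiableAt (by simp),
      ih (hf.fderiv_of_isOpen hU (by simp))⟩

/-- The chain rule in v only; the change of parameter `a` need not be more than continuous. -/
theorem comp {k : ℕ} {Φ : X → V → W} {S : Set (X × V)}
    (h : DiffFamily k Φ S) {a : X' → X} {φ : X' → V' → V} {S' : Set (X' × V')} (hS' : IsOpen S')
    (ha : Continuous a) (hφ : DiffFamily k φ S') (hmem : ∀ p ∈ S', (a p.1, φ p.1 p.2) ∈ S) :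
    DiffFamily k (fun ξ v => Φ (a ξ) (φ ξ v)) S' := by
  have hc : ContinuousOn (fun p : X' × V' => Φ (a p.1) (φ p.1 p.2)) S' :=
    h.continuousOn.comp ((ha.comp continuous_fst).continuousOn.prodMk hφ.continuousOn) hmem
  induction k generalizing W with
  | zero => exact hc
  | succ k ih =>
    have h1 := ih h.2.2 hφ.pred (h.2.2.continuousOn.comp
      ((ha.comp continuous_fst).continuousOn.prodMk hφ.continuousOn) hmem)
    exact succ_of_hasFDerivAt
      (Φ' := fun ξ v => fderiv ℝ (Φ (a ξ)) (φ ξ v) ∘SL fderiv ℝ (φ ξ) v) hS' hc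
      (fun p hp => (h.hasFDerivAt (hmem p hp)).comp p.2 (hφ.hasFDerivAt hp))
      (h1.bilinear hS' hφ.2.2 (ContinuousLinearMap.compL ℝ V' V W))

theorem contDiffAt {k : ℕ} {Φ : X → V → W} {S : Set (X × V)} (hS : IsOpen S)
    (h : DiffFamily k Φ S) {p : X × V} (hp : p ∈ S) : ContDiffAt ℝ k (Φ p.1) p.2 := by
  induction k generalizing W p with
  | zero =>
    refine contDiffAt_zero.2 ⟨_, slice_nhds hS hp, ?_⟩
    exact h.continuousOn.comp (Continuous.prodMk_right p.1).continuousOn fun v hv => hv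
  | succ k ih =>
    refine contDiffAt_succ_iff_hasFDerivAt.2 ⟨fun v => fderiv ℝ (Φ p.1) v,
      ⟨_, slice_nhds hS hp, fun v hv => h.hasFDerivAt hv⟩, ih h.2.2 hp⟩

/-- With `continuousOn_iteratedFDeriv`, this links the recursive definition, suited to inductions,
to the iterated derivatives that define the topology of `SmoothFun`. -/
theorem of_iteratedFDeriv {k : ℕ} {Φ : X → V → W} {S : Set (X × V)}
    (h : ∀ p ∈ S, ContDiffAt ℝ ∞ (Φ p.1) p.2)
    (hc : ∀ j, ContinuousOn (fun p : X × V => iteratedFDeriv ℝ j (Φ p.1) p.2) S) :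
    DiffFamily k Φ S := by
  have h0 : ∀ {W : Type} [NormedAddCommGroup W] [NormedSpace ℝ W] {Φ : X → V → W},
      (∀ j, ContinuousOn (fun p : X × V => iteratedFDeriv ℝ j (Φ p.1) p.2) S) →
      ContinuousOn (fun p : X × V => Φ p.1 p.2) S := by
    intro W _ _ Φ hc
    exact ((continuousMultilinearCurryFin0 ℝ V W).continuous.comp_continuousOn (hc 0)).congr
      fun p _ => by simp [iteratedFDeriv_zero_eq_comp]
  induction k generalizing W with
  | zero => exact h0 hc
  | succ k ih =>
    refine ⟨h0 hc, fun p hp => (h p hp).differentiableAt (by simp),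
      ih (fun p hp => (h p hp).fderiv_right (by simp)) fun j => ?_⟩
    refine ((continuousMultilinearCurryRightEquiv' ℝ j V W).continuous.comp_continuousOn
      (hc (j + 1))).congr fun p _ => ?_
    simp [iteratedFDeriv_succ_eq_comp_right]

theorem continuousOn_iteratedFDeriv {k : ℕ} {Φ : X → V → W} {S : Set (X × V)}
    (h : DiffFamily k Φ S) :
    ContinuousOn (fun p : X × V => iteratedFDeriv ℝ k (Φ p.1) p.2) S := by
  induction k generalizing W with
  | zero =>
    exact ((continuousMultilinearCurryFin0 ℝ V W).symm.continuous.comp_continuousOn h).congr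
      fun p _ => by simp [iteratedFDeriv_zero_eq_comp]
  | succ k ih =>
    exact ((continuousMultilinearCurryRightEquiv' ℝ k V W).symm.continuous.comp_continuousOn
      (ih h.2.2)).congr fun p _ => by simp [iteratedFDeriv_succ_eq_comp_right]

end DiffFamily

end Families

/-! ### Integrals, contraction series and Hadamard quotients of families -/

section FamilyOperations

variable {X X' : Type*} [TopologicalSpace X] [TopologicalSpace X']
  {V V' W W' W'' : Type} [NormedAddCommGroup V] [NormedSpace ℝ V]
  [NormedAddCommGroup V'] [NormedSpace ℝ V'] [NormedAddCommGroup W] [NormedSpace ℝ W]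
  [NormedAddCommGroup W'] [NormedSpace ℝ W'] [NormedAddCommGroup W''] [NormedSpace ℝ W'']

theorem continuousOn_intervalIntegral_family {Y : Type*} [TopologicalSpace Y] {a b : ℝ}
    (hab : a ≤ b) {F : Y → ℝ → W} {U : Set Y}
    (hF : ContinuousOn (Function.uncurry F) (U ×ˢ Icc a b)) :
    ContinuousOn (fun y => ∫ s in a..b, F y s) U := by
  have hint : ∀ y ∈ U, IntervalIntegrable (F y) MeasureTheory.volume a b := by
    intro y hy
    refine ContinuousOn.intervalIntegrable ?_
    rw [uIcc_of_le hab]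
    exact hF.comp (Continuous.prodMk_right y).continuousOn fun s hs => ⟨hy, hs⟩
  intro y hy
  rw [ContinuousWithinAt, Metric.tendsto_nhds]
  intro ε hε
  -- Compactness of [a, b] makes the integrands close uniformly in s. The added 1 in the denominator
  -- covers a = b.
  obtain ⟨v, hv, hv'⟩ := isCompact_Icc.mem_uniformity_of_prod hF hy
    (Metric.dist_mem_uniformity (show 0 < ε / (b - a + 1) by have := sub_nonneg.2 hab; positivity))
  filter_upwards [hv, self_mem_nhdsWithin] with y' hy' hy'U
  rw [dist_eq_norm, ← intervalIntegral.integral_sub (hint y' hy'U) (hint y hy)]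
  have h1 := intervalIntegral.norm_integral_le_of_norm_le_const (a := a) (b := b)
    (f := fun s => F y' s - F y s) (C := ε / (b - a + 1)) (by
      intro s hs
      rw [uIoc_of_le hab] at hs
      have := hv' y' hy' s ⟨hs.1.le, hs.2⟩
      rw [← dist_eq_norm]
      exact le_of_lt this)
  refine h1.trans_lt ?_
  rw [abs_of_nonneg (sub_nonneg.2 hab), div_mul_eq_mul_div, div_lt_iff₀ (by linarith)]
  nlinarith

/-- Differentiation under the integral sign. The integration variable is treated as a part of the
parameter, so the derivative is again an integral of a family. -/
theorem DiffFamily.intervalIntegral {k : ℕ} {a b : ℝ} (hab : a ≤ b) {Ψ : X × ℝ → V → W}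
    {S : Set ((X × ℝ) × V)} (h : DiffFamily k Ψ S) {U : Set (X × V)} (hU : IsOpen U)
    (hUS : ∀ p ∈ U, ∀ s ∈ Icc a b, ((p.1, s), p.2) ∈ S) :
    DiffFamily k (fun ξ v => ∫ s in a..b, Ψ (ξ, s) v) U := by
  have hj : ∀ {W : Type} [NormedAddCommGroup W] [NormedSpace ℝ W] {k : ℕ} {Ψ : X × ℝ → V → W},
      DiffFamily k Ψ S → ContinuousOn (Function.uncurry fun (p : X × V) (s : ℝ) => Ψ (p.1, s) p.2)
        (U ×ˢ Icc a b) := by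
    intro W _ _ k Ψ h
    refine h.continuousOn.comp (f := fun q : (X × V) × ℝ => ((q.1.1, q.2), q.1.2))
      (by fun_prop) fun q hq => hUS q.1 hq.1 q.2 hq.2
  induction k generalizing W with
  | zero => exact continuousOn_intervalIntegral_family hab (hj h)
  | succ k ih =>
    refine succ_of_hasFDerivAt (Φ' := fun ξ v => ∫ s in a..b, fderiv ℝ (Ψ (ξ, s)) v) hU
      (continuousOn_intervalIntegral_family hab (hj h)) (fun p hp => ?_) (ih h.2.2)
    have hc : ∀ {W : Type} [NormedAddCommGroup W] [NormedSpace ℝ W] {k : ℕ} {Ψ : X × ℝ → V → W},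
        DiffFamily k Ψ S → ∀ q ∈ U, ContinuousOn (fun s => Ψ (q.1, s) q.2) (Icc a b) :=
      fun h q hq => (hj h).comp (Continuous.prodMk_right q).continuousOn fun s hs => ⟨hq, hs⟩
    -- On a neighbourhood of p the derivative stays within distance 1 of its value at p, for all s
    -- at once; C + 1 is the resulting dominating constant.
    obtain ⟨N, hN, hN'⟩ := isCompact_Icc.mem_uniformity_of_prod (hj h.2.2) hp
      (Metric.dist_mem_uniformity one_pos)
    rw [hU.nhdsWithin_eq hp] at hN
    obtain ⟨C, hC⟩ := (isCompact_Icc.image_of_continuousOn (hc h.2.2 p hp)).isBounded.exists_norm_le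
    have hs : {v : V | (p.1, v) ∈ N ∩ U} ∈ 𝓝 p.2 :=
      (Continuous.prodMk_right p.1).continuousAt (inter_mem hN (hU.mem_nhds hp))
    have hsub : uIoc a b ⊆ Icc a b := by rw [uIoc_of_le hab]; exact Ioc_subset_Icc_self
    refine intervalIntegral.hasFDerivAt_integral_of_dominated_of_fderiv_le
      (F := fun v s => Ψ (p.1, s) v) (F' := fun v s => fderiv ℝ (Ψ (p.1, s)) v)
      (bound := fun _ => C + 1) hs ?_ ?_ ?_ ?_ ?_ ?_
    · filter_upwards [hs] with v hv
      exact ((hc h (p.1, v) hv.2).mono hsub).aestronglyMeasurable measurableSet_uIoc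
    · refine ContinuousOn.intervalIntegrable ?_
      rw [uIcc_of_le hab]
      exact hc h p hp
    · exact ((hc h.2.2 p hp).mono hsub).aestronglyMeasurable measurableSet_uIoc
    · refine Eventually.of_forall fun s hs' v hv => ?_
      have h1 : dist (fderiv ℝ (Ψ (p.1, s)) v) (fderiv ℝ (Ψ (p.1, s)) p.2) < 1 :=
        hN' (p.1, v) hv.1 s (hsub hs')
      have h2 := hC _ (mem_image_of_mem _ (hsub hs'))
      rw [dist_eq_norm] at h1
      have h3 := norm_le_insert' (fderiv ℝ (Ψ (p.1, s)) v) (fderiv ℝ (Ψ (p.1, s)) p.2)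
      linarith
    · exact intervalIntegrable_const
    · refine Eventually.of_forall fun s hs' v hv => ?_
      exact h.hasFDerivAt (p := ((p.1, s), v)) (hUS (p.1, v) hv.2 s (hsub hs'))

-- The iterates lʲ v of a contraction all lie on the segment from 0 to v, which is compact; one
-- bound therefore serves all terms of a series over j.
omit [NormedSpace ℝ W] in
theorem exists_nhds_bound_segment {B : X → V → W}
    (hB : Continuous fun p : X × V => B p.1 p.2) (p : X × V) :
    ∃ N ∈ 𝓝 p, ∃ C : ℝ, ∀ q ∈ N, ∀ σ ∈ Icc (0 : ℝ) 1, ‖B q.1 (σ • q.2)‖ ≤ C := by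
  have hc : Continuous (Function.uncurry fun (q : X × V) (σ : ℝ) => B q.1 (σ • q.2)) :=
    hB.comp (f := fun q : (X × V) × ℝ => (q.1.1, q.2 • q.1.2)) (by fun_prop)
  obtain ⟨N, hN, hN'⟩ := (isCompact_Icc (a := (0 : ℝ)) (b := 1)).mem_uniformity_of_prod
    (s := univ) (q := p) hc.continuousOn (mem_univ p) (Metric.dist_mem_uniformity one_pos)
  obtain ⟨C, hC⟩ := ((isCompact_Icc (a := (0 : ℝ)) (b := 1)).image
    (hc.comp (Continuous.prodMk_right p))).isBounded.exists_norm_le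
  rw [nhdsWithin_univ] at hN
  refine ⟨N, hN, C + 1, fun q hq σ hσ => ?_⟩
  have h1 : dist (B q.1 (σ • q.2)) (B p.1 (σ • p.2)) < 1 := hN' q hq σ hσ
  have h2 := hC _ (mem_image_of_mem _ hσ)
  rw [dist_eq_norm] at h1
  have h3 := norm_le_insert' (B q.1 (σ • q.2)) (B p.1 (σ • p.2))
  simp only [Function.comp, Function.uncurry] at h2
  linarith

/-- Series of a smooth family over the iterates of a contraction. -/
theorem DiffFamily.tsum_contraction [CompleteSpace W] {k : ℕ} {l : ℝ} (hl : l ∈ Ioo (0 : ℝ) 1)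
    {μ : ℕ → ℝ} (hμ : ∀ j, |μ j| ≤ l ^ j) {B : X → V → W} (hB : DiffFamily k B univ) :
    DiffFamily k (fun ξ v => ∑' j, μ j • B ξ (l ^ j • v)) univ := by
  have hpow : ∀ j : ℕ, l ^ j ∈ Icc (0 : ℝ) 1 :=
    fun j => ⟨pow_nonneg hl.1.le j, pow_le_one₀ hl.1.le hl.2.le⟩
  have hsum : ∀ C : ℝ, Summable fun j : ℕ => l ^ j * C :=
    fun C => (summable_geometric_of_lt_one hl.1.le hl.2).mul_right C
  have hbd : ∀ {W : Type} [NormedAddCommGroup W] [NormedSpace ℝ W] {B : X → V → W} {μ : ℕ → ℝ},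
      (∀ j, |μ j| ≤ l ^ j) → Continuous (fun p : X × V => B p.1 p.2) → ∀ p : X × V,
      ∃ N ∈ 𝓝 p, ∃ C : ℝ, ∀ j : ℕ, ∀ q ∈ N, ‖μ j • B q.1 (l ^ j • q.2)‖ ≤ l ^ j * C := by
    intro W _ _ B μ hμ hB p
    obtain ⟨N, hN, C, hC⟩ := exists_nhds_bound_segment hB p
    refine ⟨N, hN, C, fun j q hq => ?_⟩
    rw [norm_smul]
    exact mul_le_mul (hμ j) (hC q hq _ (hpow j)) (norm_nonneg _) (hpow j).1
  have hc : ∀ {W : Type} [NormedAddCommGroup W] [NormedSpace ℝ W] [CompleteSpace W]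
      {B : X → V → W} {μ : ℕ → ℝ}, (∀ j, |μ j| ≤ l ^ j) →
      Continuous (fun p : X × V => B p.1 p.2) →
      Continuous fun p : X × V => ∑' j, μ j • B p.1 (l ^ j • p.2) := by
    intro W _ _ _ B μ hμ hB
    refine continuous_iff_continuousAt.2 fun p => ?_
    obtain ⟨N, hN, C, hC⟩ := hbd hμ hB p
    refine (continuousOn_tsum (fun j => ?_) (hsum C) hC).continuousAt hN
    exact ((hB.comp (f := fun q : X × V => (q.1, l ^ j • q.2)) (by fun_prop)).const_smul
      (μ j)).continuousOn
  induction k generalizing W μ with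
  | zero => exact (hc hμ (continuousOn_univ.1 hB)).continuousOn
  | succ k ih =>
    have hB0 := continuousOn_univ.1 hB.1
    have hB1 := continuousOn_univ.1 hB.2.2.continuousOn
    -- Differentiating v ↦ lʲ v only brings out a factor lʲ ≤ 1, so the series of derivatives
    -- satisfies the same hypothesis on its coefficients.
    have hμ' : ∀ j, |μ j * l ^ j| ≤ l ^ j := by
      intro j
      rw [abs_mul, abs_of_nonneg (hpow j).1]
      exact (mul_le_mul_of_nonneg_left (hpow j).2 (abs_nonneg _)).trans ((mul_one _).le.trans (hμ j))
    refine succ_of_hasFDerivAt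
      (Φ' := fun ξ v => ∑' j, (μ j * l ^ j) • fderiv ℝ (B ξ) (l ^ j • v)) isOpen_univ
      (hc hμ hB0).continuousOn (fun p _ => ?_) (ih hμ' hB.2.2)
    obtain ⟨N, hN, C, hC⟩ := hbd (B := fun ξ v => fderiv ℝ (B ξ) v) hμ' hB1 p
    obtain ⟨N', hN', C', hC'⟩ := hbd hμ hB0 p
    obtain ⟨ε, hε, hball⟩ := Metric.mem_nhds_iff.1
      ((Continuous.prodMk_right p.1).continuousAt (x := p.2) hN)
    refine hasFDerivAt_tsum_of_isPreconnected (f' := fun j v => (μ j * l ^ j) •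
      fderiv ℝ (B p.1) (l ^ j • v)) (hsum C) Metric.isOpen_ball
      (convex_ball p.2 ε).isPreconnected (fun j v hv => ?_) (fun j v hv => hC j (p.1, v) (hball hv))
      (Metric.mem_ball_self hε) ?_ (Metric.mem_ball_self hε)
    · have h1 : HasFDerivAt (fun v : V => l ^ j • v) (l ^ j • ContinuousLinearMap.id ℝ V) v :=
        (hasFDerivAt_id v).const_smul _
      have h2 := ((hB.hasFDerivAt (p := (p.1, l ^ j • v)) (mem_univ _)).comp v h1).const_smul (μ j)
      refine h2.congr_fderiv ?_
      ext w
      simp [mul_smul]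
    · exact Summable.of_norm_bounded (hsum C') fun j => hC' j p (mem_of_mem_nhds hN')

/-! ### Calculus of smooth families and Hadamard's lemma -/

namespace SmoothFamily

variable {Φ : X → V → W} {S : Set (X × V)}

theorem fderiv (h : SmoothFamily Φ S) : SmoothFamily (fun ξ v => fderiv ℝ (Φ ξ) v) S :=
  fun k => (h (k + 1)).2.2

theorem continuousOn (h : SmoothFamily Φ S) : ContinuousOn (fun p : X × V => Φ p.1 p.2) S := h 0

theorem congr {Φ' : X → V → W} (h : SmoothFamily Φ S) (hS : IsOpen S)
    (heq : ∀ q ∈ S, Φ' q.1 q.2 = Φ q.1 q.2) : SmoothFamily Φ' S := fun k => (h k).congr hS heq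

theorem mono {S' : Set (X × V)} (h : SmoothFamily Φ S) (hS : S' ⊆ S) : SmoothFamily Φ S' :=
  fun k => (h k).mono hS

theorem of_locally (h : ∀ p ∈ S, ∃ S' : Set (X × V), IsOpen S' ∧ p ∈ S' ∧ ∃ Φ' : X → V → W,
      SmoothFamily Φ' S' ∧ ∀ q ∈ S', Φ q.1 q.2 = Φ' q.1 q.2) : SmoothFamily Φ S := by
  intro k
  refine DiffFamily.of_locally fun p hp => ?_
  obtain ⟨S', h1, h2, Φ', h3, h4⟩ := h p hp
  exact ⟨S', h1, h2, Φ', h3 k, h4⟩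

theorem clm_apply (h : SmoothFamily Φ S) (hS : IsOpen S) (L : W →L[ℝ] W') :
    SmoothFamily (fun ξ v => L (Φ ξ v)) S := fun k => (h k).clm_apply hS L

theorem add {Ψ : X → V → W} (h : SmoothFamily Φ S) (hS : IsOpen S) (h' : SmoothFamily Ψ S) :
    SmoothFamily (fun ξ v => Φ ξ v + Ψ ξ v) S := fun k => (h k).add hS (h' k)

theorem neg (h : SmoothFamily Φ S) (hS : IsOpen S) : SmoothFamily (fun ξ v => -Φ ξ v) S :=
  h.clm_apply hS (-ContinuousLinearMap.id ℝ W)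

theorem sub {Ψ : X → V → W} (h : SmoothFamily Φ S) (hS : IsOpen S) (h' : SmoothFamily Ψ S) :
    SmoothFamily (fun ξ v => Φ ξ v - Ψ ξ v) S :=
  (h.add hS (h'.neg hS)).congr hS fun _ _ => sub_eq_add_neg _ _

theorem bilinear {Ψ : X → V → W'} (h : SmoothFamily Φ S) (hS : IsOpen S) (h' : SmoothFamily Ψ S)
    (B : W →L[ℝ] W' →L[ℝ] W'') : SmoothFamily (fun ξ v => B (Φ ξ v) (Ψ ξ v)) S :=
  fun k => (h k).bilinear hS (h' k) B

theorem mul {Φ Ψ : X → V → ℂ} (h : SmoothFamily Φ S) (hS : IsOpen S) (h' : SmoothFamily Ψ S) :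
    SmoothFamily (fun ξ v => Φ ξ v * Ψ ξ v) S := h.bilinear hS h' (ContinuousLinearMap.mul ℝ ℂ)

theorem smul {Φ : X → V → ℝ} {Ψ : X → V → W} (h : SmoothFamily Φ S) (hS : IsOpen S)
    (h' : SmoothFamily Ψ S) : SmoothFamily (fun ξ v => Φ ξ v • Ψ ξ v) S :=
  h.bilinear hS h' (ContinuousLinearMap.lsmul ℝ ℝ)

theorem of_param {a : X → W} (hS : IsOpen S) (ha : Continuous a) :
    SmoothFamily (fun ξ (_ : V) => a ξ) S :=
  fun _ => DiffFamily.of_param hS (ha.comp continuous_fst).continuousOn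

theorem of_contDiffOn {f : V → W} {U : Set V} (hU : IsOpen U) (hf : ContDiffOn ℝ ∞ f U)
    (hSU : ∀ p ∈ S, p.2 ∈ U) : SmoothFamily (fun (_ : X) => f) S :=
  fun _ => DiffFamily.of_contDiffOn hU hf hSU

theorem comp (h : SmoothFamily Φ S) {a : X' → X} {φ : X' → V' → V} {S' : Set (X' × V')}
    (hS' : IsOpen S') (ha : Continuous a) (hφ : SmoothFamily φ S')
    (hmem : ∀ p ∈ S', (a p.1, φ p.1 p.2) ∈ S) : SmoothFamily (fun ξ v => Φ (a ξ) (φ ξ v)) S' :=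
  fun k => (h k).comp hS' ha (hφ k) hmem

theorem contDiffAt (h : SmoothFamily Φ S) (hS : IsOpen S) {p : X × V} (hp : p ∈ S) :
    ContDiffAt ℝ ∞ (Φ p.1) p.2 :=
  contDiffAt_infty.2 fun k => (h k).contDiffAt hS hp

theorem intervalIntegral {a b : ℝ} (hab : a ≤ b) {Ψ : X × ℝ → V → W} {S : Set ((X × ℝ) × V)}
    (h : SmoothFamily Ψ S) {U : Set (X × V)} (hU : IsOpen U)
    (hUS : ∀ p ∈ U, ∀ s ∈ Icc a b, ((p.1, s), p.2) ∈ S) :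
    SmoothFamily (fun ξ v => ∫ s in a..b, Ψ (ξ, s) v) U :=
  fun k => (h k).intervalIntegral hab hU hUS

/-- The coefficient `∫₀¹ DΦ(σ v) dσ` of Hadamard's lemma. -/
def hadamard (Φ : X → V → W) (ξ : X) (v : V) : V →L[ℝ] W :=
  ∫ σ in (0 : ℝ)..1, _root_.fderiv ℝ (Φ ξ) (σ • v)

theorem hadamard_family (h : SmoothFamily Φ univ) : SmoothFamily (hadamard Φ) univ := by
  have h1 : SmoothFamily (fun (p : X × ℝ) (v : V) => p.2 • v) univ :=
    (of_param isOpen_univ continuous_snd).smul isOpen_univ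
      (of_contDiffOn isOpen_univ contDiff_id.contDiffOn fun _ _ => mem_univ _)
  exact (h.fderiv.comp isOpen_univ (continuous_fst (X := X) (Y := ℝ)) h1 fun _ _ =>
    mem_univ _).intervalIntegral zero_le_one isOpen_univ fun _ _ _ _ => mem_univ _

/-- The fundamental theorem of calculus for σ ↦ Φ ξ (σ v) on [0, 1]. -/
theorem hadamard_apply [CompleteSpace W] (h : SmoothFamily Φ univ) (ξ : X) (v : V) :
    hadamard Φ ξ v v = Φ ξ v - Φ ξ 0 := by
  have hc : Continuous fun σ : ℝ => _root_.fderiv ℝ (Φ ξ) (σ • v) :=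
    (continuousOn_univ.1 h.fderiv.continuousOn).comp (f := fun σ : ℝ => (ξ, σ • v)) (by fun_prop)
  rw [hadamard, ContinuousLinearMap.intervalIntegral_apply (hc.intervalIntegrable _ _)]
  have hd : ∀ σ : ℝ, HasDerivAt (fun σ : ℝ => Φ ξ (σ • v)) (_root_.fderiv ℝ (Φ ξ) (σ • v) v) σ := by
    intro σ
    have h1 : HasDerivAt (fun σ : ℝ => σ • v) v σ := by
      simpa using (hasDerivAt_id σ).smul_const v
    exact ((h 1).hasFDerivAt (p := (ξ, σ • v)) (mem_univ _)).comp_hasDerivAt σ h1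
  rw [intervalIntegral.integral_eq_sub_of_hasDerivAt (fun σ _ => hd σ)
    ((hc.clm_apply continuous_const).intervalIntegrable _ _)]
  simp

/-- The sum of `Φ (lʲ v) - Φ 0` over `j`. -/
theorem tsum_sub [CompleteSpace W] (h : SmoothFamily Φ univ) {l : ℝ} (hl : l ∈ Ioo (0 : ℝ) 1) :
    SmoothFamily (fun ξ v => ∑' j : ℕ, (Φ ξ (l ^ j • v) - Φ ξ 0)) univ ∧
      ∀ ξ v, Summable fun j : ℕ => Φ ξ (l ^ j • v) - Φ ξ 0 := by
  -- By Hadamard's lemma the j-th term is lʲ times a coefficient evaluated at lʲ v, applied to v.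
  -- The factor lʲ is the decay that the contraction lemma asks for.
  have hb : SmoothFamily (fun ξ v => ∑' j : ℕ, l ^ j • hadamard Φ ξ (l ^ j • v)) univ := fun k =>
    (h.hadamard_family k).tsum_contraction hl fun j => (abs_of_nonneg (pow_nonneg hl.1.le j)).le
  have hs : ∀ ξ v, Summable fun j : ℕ => l ^ j • hadamard Φ ξ (l ^ j • v) := by
    intro ξ v
    obtain ⟨N, hN, C, hC⟩ := exists_nhds_bound_segment
      (continuousOn_univ.1 h.hadamard_family.continuousOn) (ξ, v)
    refine Summable.of_norm_bounded
      ((summable_geometric_of_lt_one hl.1.le hl.2).mul_right C) fun j => ?_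
    rw [norm_smul, Real.norm_of_nonneg (pow_nonneg hl.1.le j)]
    exact mul_le_mul_of_nonneg_left (hC _ (mem_of_mem_nhds hN) _
      ⟨pow_nonneg hl.1.le j, pow_le_one₀ hl.1.le hl.2.le⟩) (pow_nonneg hl.1.le j)
  have heq : ∀ ξ v (j : ℕ), (l ^ j • hadamard Φ ξ (l ^ j • v)) v = Φ ξ (l ^ j • v) - Φ ξ 0 := by
    intro ξ v j
    rw [← hadamard_apply h, map_smul, _root_.smul_apply]
  constructor
  · refine (hb.bilinear isOpen_univ (of_contDiffOn isOpen_univ contDiff_id.contDiffOn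
      fun _ _ => mem_univ _) (ContinuousLinearMap.id ℝ (V →L[ℝ] W))).congr isOpen_univ ?_
    rintro ⟨ξ, v⟩ -
    simp only [ContinuousLinearMap.id_apply, id]
    rw [← ContinuousLinearMap.apply_apply (𝕜 := ℝ) v (∑' j : ℕ, _), ContinuousLinearMap.map_tsum _ (hs ξ v)]
    simp only [ContinuousLinearMap.apply_apply, heq]
  · intro ξ v
    have := (hs ξ v).mapL (ContinuousLinearMap.apply ℝ W v)
    simpa only [ContinuousLinearMap.apply_apply, heq] using this

end SmoothFamily

end FamilyOperations

/-! ### The topology of C^∞(M) in terms of families -/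

namespace Foliated.SmoothFun

variable {X : Type*} [TopologicalSpace X] {E H : Type} [NormedAddCommGroup E] [NormedSpace ℝ E]
  [TopologicalSpace H] {I : ModelWithCorners ℝ E H} {M : Type*} [TopologicalSpace M]
  [ChartedSpace H M]

@[ext]
theorem ext {f g : SmoothFun I M} (h : ∀ p, f p = g p) : f = g := Subtype.ext (funext h)

@[simp] theorem add_apply (f g : SmoothFun I M) (p : M) : (f + g) p = f p + g p := rfl
@[simp] theorem sub_apply (f g : SmoothFun I M) (p : M) : (f - g) p = f p - g p := rfl
@[simp] theorem mul_apply (f g : SmoothFun I M) (p : M) : (f * g) p = f p * g p := rfl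
@[simp] theorem smul_apply (c : ℂ) (f : SmoothFun I M) (p : M) : (c • f) p = c * f p := rfl
@[simp] theorem zero_apply (p : M) : (0 : SmoothFun I M) p = 0 := rfl
@[simp] theorem one_apply (p : M) : (1 : SmoothFun I M) p = 1 := rfl

theorem contDiffOn_chart [IsManifold I ∞ M] (f : SmoothFun I M) (x : M) :
    ContDiffOn ℝ ∞ (fun u => f ((extChartAt I x).symm u)) (extChartAt I x).target :=
  contMDiffOn_iff_contDiffOn.1 (ContMDiff.comp_contMDiffOn f.2 (contMDiffOn_extChartAt_symm x))

variable [I.Boundaryless]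

theorem chartDeriv_eq (f : SmoothFun I M) (x : M) (k : ℕ) {u : E}
    (hu : u ∈ (extChartAt I x).target) :
    chartDeriv x k f u = iteratedFDeriv ℝ k (fun u => f ((extChartAt I x).symm u)) u :=
  iteratedFDerivWithin_of_isOpen k (isOpen_extChartAt_target x) hu

theorem isOpen_univ_prod_target (x : M) :
    IsOpen ((univ : Set X) ×ˢ (extChartAt I x).target) :=
  isOpen_univ.prod (isOpen_extChartAt_target x)

variable [IsManifold I ∞ M]

/-- The universal family: the parameter is the function itself. Uniform convergence of derivatives
on a compact neighbourhood of u₀, together with continuity of the derivative of f₀, gives joint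
continuity in (f, u). -/
theorem chart_family [LocallyCompactSpace E] (x : M) :
    SmoothFamily (fun (f : SmoothFun I M) u => f ((extChartAt I x).symm u))
      (univ ×ˢ (extChartAt I x).target) := by
  have hopen := isOpen_extChartAt_target (I := I) x
  have hsm : ∀ (f : SmoothFun I M), ∀ u ∈ (extChartAt I x).target,
      ContDiffAt ℝ ∞ (fun u => f ((extChartAt I x).symm u)) u :=
    fun f u hu => (f.contDiffOn_chart x).contDiffAt (hopen.mem_nhds hu)
  intro k
  refine DiffFamily.of_iteratedFDeriv (fun p hp => hsm p.1 p.2 hp.2) fun j => ?_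
  have hcont : Continuous (fun f : SmoothFun I M =>
      UniformOnFun.ofFun {K : Set E | IsCompact K ∧ K ⊆ (extChartAt I x).target}
        (chartDeriv x j f)) :=
    continuous_iff_le_induced.2 ((iInf_le _ x).trans (iInf_le _ j))
  rintro ⟨f₀, u₀⟩ ⟨-, hu₀⟩
  obtain ⟨K, hK, hu₀K, hKt⟩ := exists_compact_subset hopen hu₀
  have h1 := UniformOnFun.tendsto_iff_tendstoUniformlyOn.1 (hcont.tendsto f₀) K ⟨hK, hKt⟩
  rw [Metric.tendstoUniformlyOn_iff] at h1
  have h2 : ContinuousAt (iteratedFDeriv ℝ j fun u => f₀ ((extChartAt I x).symm u)) u₀ :=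
    (hsm f₀ u₀ hu₀).continuousAt_iteratedFDeriv (by exact_mod_cast le_top)
  refine ContinuousAt.continuousWithinAt (Metric.tendsto_nhds.2 fun ε hε => ?_)
  rw [nhds_prod_eq]
  filter_upwards [prod_mem_prod (h1 (ε / 2) (half_pos hε)) (inter_mem
    (isOpen_interior.mem_nhds hu₀K) (Metric.tendsto_nhds.1 h2 (ε / 2) (half_pos hε)))]
  rintro ⟨f, u⟩ ⟨hf, huK, hu⟩
  have h3 := hf u (interior_subset huK)
  simp only [Function.comp, UniformOnFun.toFun_ofFun] at h3
  rw [chartDeriv_eq _ _ _ (hKt (interior_subset huK)),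
    chartDeriv_eq _ _ _ (hKt (interior_subset huK)), dist_comm] at h3
  calc _ ≤ _ := dist_triangle _ (iteratedFDeriv ℝ j (fun u => f₀ ((extChartAt I x).symm u)) u) _
    _ < ε / 2 + ε / 2 := add_lt_add h3 hu
    _ = ε := add_halves ε

-- The converse of `smooth_chart_family`: joint continuity becomes uniform in u on a compact K.
-- Continuity into C^∞(M) is from here on proved by writing the map as a family.
omit [IsManifold I ∞ M] in
theorem continuous_of_chart_family {L : X → SmoothFun I M}
    (h : ∀ x : M, SmoothFamily (fun ξ u => L ξ ((extChartAt I x).symm u))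
      (univ ×ˢ (extChartAt I x).target)) : Continuous L := by
  refine continuous_iInf_rng.2 fun x => continuous_iInf_rng.2 fun k => continuous_induced_rng.2 ?_
  refine continuous_iff_continuousAt.2 fun ξ₀ => ?_
  refine UniformOnFun.tendsto_iff_tendstoUniformlyOn.2 fun K hK => ?_
  rw [Metric.tendstoUniformlyOn_iff]
  intro ε hε
  have hc := (h x k).continuousOn_iteratedFDeriv
  obtain ⟨N, hN, hN'⟩ := hK.1.mem_uniformity_of_prod (s := univ) (q := ξ₀)
    (f := fun ξ u => iteratedFDeriv ℝ k (fun u => L ξ ((extChartAt I x).symm u)) u)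
    (hc.mono (prod_mono_right hK.2)) (mem_univ _) (Metric.dist_mem_uniformity hε)
  rw [nhdsWithin_univ] at hN
  filter_upwards [hN] with ξ hξ u hu
  have := hN' ξ hξ u hu
  simp only [Function.comp, UniformOnFun.toFun_ofFun, chartDeriv_eq _ _ _ (hK.2 hu)]
  rw [dist_comm]
  exact this

theorem smooth_chart_family [LocallyCompactSpace E] (x : M) {L : X → SmoothFun I M}
    (hL : Continuous L) : SmoothFamily (fun ξ u => L ξ ((extChartAt I x).symm u))
      (univ ×ˢ (extChartAt I x).target) :=
  (chart_family x).comp (isOpen_univ_prod_target x) hL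
    (SmoothFamily.of_contDiffOn isOpen_univ contDiff_id.contDiffOn fun _ _ => mem_univ _)
    fun _ hp => ⟨mem_univ _, hp.2⟩

theorem continuous_mul' [LocallyCompactSpace E] (g : SmoothFun I M) :
    Continuous fun f : SmoothFun I M => f * g :=
  continuous_of_chart_family fun x => (chart_family x).mul (isOpen_univ_prod_target x)
    (smooth_chart_family x continuous_const)

theorem continuous_add' [LocallyCompactSpace E] {L L' : X → SmoothFun I M} (hL : Continuous L)
    (hL' : Continuous L') : Continuous fun ξ => L ξ + L' ξ :=
  continuous_of_chart_family fun x => (smooth_chart_family x hL).add (isOpen_univ_prod_target x)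
    (smooth_chart_family x hL')

theorem continuous_neg' [LocallyCompactSpace E] {L : X → SmoothFun I M} (hL : Continuous L) :
    Continuous fun ξ => -L ξ :=
  continuous_of_chart_family fun x => (smooth_chart_family x hL).neg (isOpen_univ_prod_target x)

theorem continuous_smul_const {c : X → ℂ} (hc : Continuous c) (g : SmoothFun I M) :
    Continuous fun ξ => c ξ • g :=
  continuous_of_chart_family fun x => (SmoothFamily.of_param (isOpen_univ_prod_target x) hc).mul
    (isOpen_univ_prod_target x) (SmoothFamily.of_contDiffOn (isOpen_extChartAt_target x)
      (g.contDiffOn_chart x) fun _ hp => hp.2)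

theorem continuous_eval [LocallyCompactSpace E] (p : M) :
    Continuous fun f : SmoothFun I M => f p := by
  have h : Continuous fun f : SmoothFun I M => f ((extChartAt I p).symm (extChartAt I p p)) := by
    rw [← continuousOn_univ]
    exact (chart_family (I := I) p).continuousOn.comp
      (f := fun f : SmoothFun I M => (f, extChartAt I p p)) (by fun_prop)
      fun f _ => ⟨mem_univ _, mem_extChartAt_target p⟩
  simpa using h

variable {E' H' : Type} [NormedAddCommGroup E'] [NormedSpace ℝ E'] [TopologicalSpace H']
  {I' : ModelWithCorners ℝ E' H'} {N : Type*} [TopologicalSpace N] [ChartedSpace H' N]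

omit [IsManifold I ∞ M] [I.Boundaryless] in
/-- The pullback of functions by a smooth map. -/
def pullback (φ : N → M) (hφ : ContMDiff I' I ∞ φ) : SmoothFun I M →ₗ[ℂ] SmoothFun I' N where
  toFun f := ⟨f ∘ φ, ContMDiff.comp f.2 hφ⟩
  map_add' _ _ := rfl
  map_smul' _ _ := rfl

theorem continuous_pullback [LocallyCompactSpace E] [IsManifold I' ∞ N] [I'.Boundaryless]
    (φ : N → M) (hφ : ContMDiff I' I ∞ φ) : Continuous (pullback φ hφ) := by
  refine continuous_of_chart_family fun y => SmoothFamily.of_locally ?_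
  rintro ⟨f₀, u₀⟩ ⟨-, hu₀⟩
  set x := φ ((extChartAt I' y).symm u₀) with hx
  have h1 : ContMDiffOn 𝓘(ℝ, E') I ∞ (fun u => φ ((extChartAt I' y).symm u))
      (extChartAt I' y).target := hφ.comp_contMDiffOn (contMDiffOn_extChartAt_symm y)
  -- The part of the chart at y that φ sends into the chart at x; on it the pullback is the
  -- universal family composed with a smooth map of model spaces.
  set U : Set E' := (extChartAt I' y).target ∩
    (fun u => φ ((extChartAt I' y).symm u)) ⁻¹' (extChartAt I x).source with hU
  have hUo : IsOpen U := h1.continuousOn.isOpen_inter_preimage (isOpen_extChartAt_target y)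
    (isOpen_extChartAt_source x)
  have h2 : ContDiffOn ℝ ∞ (fun u => extChartAt I x (φ ((extChartAt I' y).symm u))) U :=
    contMDiffOn_iff_contDiffOn.1 (contMDiffOn_extChartAt.comp (h1.mono inter_subset_left)
      fun u hu => by simpa using hu.2)
  refine ⟨univ ×ˢ U, isOpen_univ.prod hUo, ⟨mem_univ _, hu₀, mem_extChartAt_source x⟩, _,
    (chart_family x).comp (S' := univ ×ˢ U) (isOpen_univ.prod hUo) continuous_id
      (SmoothFamily.of_contDiffOn hUo h2 fun p hp => hp.2) fun p hp =>
      ⟨mem_univ _, (extChartAt I x).map_source hp.2.2⟩, ?_⟩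
  rintro ⟨f, u⟩ ⟨-, hu⟩
  exact congrArg f ((extChartAt I x).left_inv hu.2).symm

end Foliated.SmoothFun

/-! ### Quotients by kernels -/

section Quotients

/-- A linear quotient map induces an isomorphism of the quotient by its kernel. -/
theorem exists_quotient_equiv {A C : Type*} [AddCommGroup A] [Module ℂ A] [TopologicalSpace A]
    [AddCommGroup C] [Module ℂ C] [TopologicalSpace C] (π : A →ₗ[ℂ] C)
    (hπ : IsQuotientMap π) (p : Submodule ℂ A) (hp : LinearMap.ker π = p) :
    ∃ e : (A ⧸ p) ≃L[ℂ] C, ∀ a, e (Submodule.Quotient.mk a) = π a := by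
  subst hp
  refine ⟨{ π.quotKerEquivOfSurjective hπ.surjective with
    continuous_toFun := ?_
    continuous_invFun := ?_ }, fun a => rfl⟩
  · exact (isQuotientMap_quot_mk (r := fun a b => (Submodule.quotientRel _).r a b)).continuous_iff.2
      hπ.continuous
  -- Continuity of the inverse is tested after composition with the quotient map π, where it becomes
  -- the projection modulo the kernel.
  · refine hπ.continuous_iff.2 ?_
    have : (π.quotKerEquivOfSurjective hπ.surjective).symm ∘ π =
        (Submodule.Quotient.mk : A → A ⧸ LinearMap.ker π) := by
      funext a
      exact (LinearEquiv.symm_apply_eq _).2 rfl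
    exact (congrArg Continuous this).mpr continuous_quot_mk

end Quotients

/-! ### Functions on a Hopf manifold as invariant functions on V \ {0} -/

namespace Hopf

variable {V : Type} [NormedAddCommGroup V] [NormedSpace ℝ V] {lam : Set.Ioo (0 : ℝ) 1}
  {X : Type*} [TopologicalSpace X]

theorem contMDiffOn_chart (x : punctured V) :
    ContMDiffOn 𝓘(ℝ, V) 𝓘(ℝ, V) ∞ (chart lam x) (chart lam x).source :=
  contMDiffOn_of_mem_maximalAtlas (IsManifold.subset_maximalAtlas
    (show chart lam x ∈ atlas V (HopfManifold V lam) from ⟨x, rfl⟩))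

/-- Charts are local inverses of the projection, so φ is locally F composed with a chart. -/
theorem contMDiff_of_lift {E' H' : Type*} [NormedAddCommGroup E'] [NormedSpace ℝ E']
    [TopologicalSpace H'] {I' : ModelWithCorners ℝ E' H'} {N : Type*} [TopologicalSpace N]
    [ChartedSpace H' N] {φ : HopfManifold V lam → N} {F : V → N}
    (hF : ContMDiffOn 𝓘(ℝ, V) I' ∞ F {0}ᶜ) (h : ∀ x : punctured V, φ (proj lam x) = F x) :
    ContMDiff 𝓘(ℝ, V) I' ∞ φ := by
  intro p
  obtain ⟨y, rfl⟩ := proj_surjective p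
  have h0 := chart_proj (lam := lam) y (mem_annulus y)
  have hs := (chart lam y).open_source.mem_nhds h0.1
  have h1 : ContMDiffAt 𝓘(ℝ, V) I' ∞ F (chart lam y (proj lam y)) := by
    rw [h0.2]
    exact hF.contMDiffAt (isOpen_compl_singleton.mem_nhds y.2)
  refine (h1.comp _ ((contMDiffOn_chart y).contMDiffAt hs)).congr_of_eventuallyEq ?_
  filter_upwards [hs] with q hq
  obtain ⟨y', -, h2, rfl⟩ := proj_chart y hq
  rw [Function.comp_apply, h2, h]

open Classical in
/-- A function on the Hopf manifold, as an invariant function on `V \ {0}`. -/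
def lift (f : SmoothFun 𝓘(ℝ, V) (HopfManifold V lam)) (v : V) : ℂ :=
  if h : v ≠ 0 then f (proj lam ⟨v, h⟩) else 0

theorem lift_coe (f : SmoothFun 𝓘(ℝ, V) (HopfManifold V lam)) (x : punctured V) :
    lift f x = f (proj lam x) := dif_pos x.2

theorem lift_of_ne (f : SmoothFun 𝓘(ℝ, V) (HopfManifold V lam)) {v : V} (hv : v ≠ 0) :
    lift f v = f (proj lam ⟨v, hv⟩) := dif_pos hv

theorem lift_one {v : V} (hv : v ≠ 0) :
    lift (1 : SmoothFun 𝓘(ℝ, V) (HopfManifold V lam)) v = 1 := by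
  rw [lift_of_ne _ hv]
  rfl

theorem lift_at_zero (f : SmoothFun 𝓘(ℝ, V) (HopfManifold V lam)) : lift f 0 = 0 := by simp [lift]

theorem ext_lift {f g : SmoothFun 𝓘(ℝ, V) (HopfManifold V lam)}
    (h : ∀ v : V, v ≠ 0 → lift f v = lift g v) : f = g := by
  refine SmoothFun.ext fun p => ?_
  obtain ⟨y, rfl⟩ := proj_surjective p
  rw [← lift_coe, ← lift_coe, h _ y.2]

theorem lift_zpow_smul (f : SmoothFun 𝓘(ℝ, V) (HopfManifold V lam)) (k : ℤ) (v : V) :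
    lift f ((lam : ℝ) ^ k • v) = lift f v := by
  by_cases hv : v = 0
  · simp [hv]
  · have := proj_dilation (lam := lam) k ⟨v, hv⟩
    rw [lift_of_ne f hv, ← this, ← lift_coe]
    rfl

theorem lift_smul (f : SmoothFun 𝓘(ℝ, V) (HopfManifold V lam)) (v : V) :
    lift f ((lam : ℝ) • v) = lift f v := by simpa using lift_zpow_smul f 1 v

theorem lift_pow_smul (f : SmoothFun 𝓘(ℝ, V) (HopfManifold V lam)) (k : ℕ) (v : V) :
    lift f ((lam : ℝ) ^ k • v) = lift f v := by simpa using lift_zpow_smul f k v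

section
variable (f g : SmoothFun 𝓘(ℝ, V) (HopfManifold V lam)) (v : V)

@[simp] theorem lift_add : lift (f + g) v = lift f v + lift g v := by
  by_cases hv : v = 0
  · simp [hv, lift_at_zero]
  · simp [lift_of_ne _ hv]

@[simp] theorem lift_sub : lift (f - g) v = lift f v - lift g v := by
  by_cases hv : v = 0
  · simp [hv, lift_at_zero]
  · simp [lift_of_ne _ hv]

@[simp] theorem lift_mul : lift (f * g) v = lift f v * lift g v := by
  by_cases hv : v = 0
  · simp [hv, lift_at_zero]
  · simp [lift_of_ne _ hv]

@[simp] theorem lift_const_smul (c : ℂ) : lift (c • f) v = c * lift f v := by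
  by_cases hv : v = 0
  · simp [hv, lift_at_zero]
  · simp [lift_of_ne _ hv]

end

/-- The function on the Hopf manifold induced by an invariant function on `V \ {0}`. -/
def descend (F : V → ℂ) (hF : ContDiffOn ℝ ∞ F {0}ᶜ)
    (hinv : ∀ v : V, v ≠ 0 → F ((lam : ℝ) • v) = F v) :
    SmoothFun 𝓘(ℝ, V) (HopfManifold V lam) :=
  ⟨Quotient.lift (fun x : punctured V => F x) (by
    have hpow : ∀ (k : ℕ) (v : V), v ≠ 0 → F ((lam : ℝ) ^ k • v) = F v := by
      intro k v hv
      induction k with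
      | zero => simp
      | succ k ih =>
        rw [pow_succ', mul_smul, hinv _ (smul_ne_zero (pow_ne_zero _ lam.2.1.ne') hv), ih]
    rintro x y ⟨k, hk⟩
    obtain ⟨k, rfl | rfl⟩ := k.eq_nat_or_neg
    · rw [hk, zpow_natCast, hpow k x x.2]
    · have : (x : V) = (lam : ℝ) ^ k • (y : V) := by
        rw [hk, zpow_neg, zpow_natCast, smul_smul,
          mul_inv_cancel₀ (pow_ne_zero _ lam.2.1.ne'), one_smul]
      rw [this, hpow k y y.2]), contMDiff_of_lift (F := F) hF.contMDiffOn fun _ => rfl⟩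

theorem lift_descend {F : V → ℂ} {hF : ContDiffOn ℝ ∞ F {0}ᶜ}
    {hinv : ∀ v : V, v ≠ 0 → F ((lam : ℝ) • v) = F v} {v : V} (hv : v ≠ 0) :
    lift (descend F hF hinv) v = F v := by
  rw [lift_of_ne _ hv]
  rfl

omit [NormedSpace ℝ V] in
theorem isOpen_univ_prod_compl : IsOpen ((univ : Set X) ×ˢ ({0}ᶜ : Set V)) :=
  isOpen_univ.prod isOpen_compl_singleton

theorem exists_chartAt_eq (p : HopfManifold V lam) : ∃ c : punctured V, chartAt V p = chart lam c :=
  ⟨Quotient.out (s := orbitSetoid V lam) p, rfl⟩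

/-- A chart takes values in an annulus of V \ {0}, and a function read in it is literally its lift.
-/
theorem target_family_of_lift_family {L : X → SmoothFun 𝓘(ℝ, V) (HopfManifold V lam)}
    (h : SmoothFamily (fun ξ v => lift (L ξ) v) (univ ×ˢ {0}ᶜ)) (p : HopfManifold V lam) :
    SmoothFamily (fun ξ u => L ξ ((extChartAt 𝓘(ℝ, V) p).symm u))
      (univ ×ˢ (extChartAt 𝓘(ℝ, V) p).target) := by
  obtain ⟨c, hc⟩ := exists_chartAt_eq p
  have ht : (extChartAt 𝓘(ℝ, V) p).target = (chart lam c).target := by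
    simp [← hc]
  have key : ∀ u ∈ (extChartAt 𝓘(ℝ, V) p).target, ∀ f : SmoothFun 𝓘(ℝ, V) (HopfManifold V lam),
      u ≠ 0 ∧ f ((extChartAt 𝓘(ℝ, V) p).symm u) = lift f u := by
    intro u hu f
    obtain ⟨y, -, rfl, hy⟩ := chart_symm _ (ht ▸ hu)
    refine ⟨y.2, ?_⟩
    rw [lift_coe, ← hy]
    simp [hc]
  exact (h.mono (prod_mono_right fun u hu => (key u hu 0).1)).congr
    (isOpen_univ.prod (isOpen_extChartAt_target p)) fun q hq => (key q.2 hq.2 _).2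

theorem continuous_of_lift_family {L : X → SmoothFun 𝓘(ℝ, V) (HopfManifold V lam)}
    (h : SmoothFamily (fun ξ v => lift (L ξ) v) (univ ×ˢ {0}ᶜ)) : Continuous L :=
  SmoothFun.continuous_of_chart_family (target_family_of_lift_family h)

/-- The preferred chart at the image of v₀ may be centred at another point of the orbit. Near v₀ it
therefore reads the projection as v ↦ λᵏ v, with k fixed, and the lift is the chart family composed
with this homothety. -/
theorem lift_family [LocallyCompactSpace V] :
    SmoothFamily (fun (f : SmoothFun 𝓘(ℝ, V) (HopfManifold V lam)) v => lift f v)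
      (univ ×ˢ {0}ᶜ) := by
  refine SmoothFamily.of_locally ?_
  rintro ⟨f₀, v₀⟩ ⟨-, hv₀⟩
  let y : punctured V := ⟨v₀, hv₀⟩
  let p := proj lam y
  obtain ⟨c, hc⟩ := exists_chartAt_eq p
  have hp : p ∈ (chart lam c).source := hc ▸ mem_chart_source V p
  obtain ⟨k, hk⟩ := chart_proj_eventually c y hp
  have hk' : ∀ᶠ v : V in 𝓝 v₀, ∃ h : v ≠ 0, proj lam ⟨v, h⟩ ∈ (chart lam c).source ∧
      chart lam c (proj lam ⟨v, h⟩) = (lam : ℝ) ^ k • v := by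
    have h1 := (punctured V).isOpen.isOpenEmbedding_subtypeVal.map_nhds_eq y
    rw [show v₀ = (y : V) from rfl, ← h1]
    exact eventually_map.2 (hk.mono fun z hz => ⟨z.2, hz⟩)
  obtain ⟨U, hU, hUo, hvU⟩ := eventually_nhds_iff.1 hk'
  have hcd : ContDiffOn ℝ ∞ (fun v : V => (lam : ℝ) ^ k • v) U :=
    (contDiff_id.const_smul _).contDiffOn
  refine ⟨univ ×ˢ U, isOpen_univ.prod hUo, ⟨mem_univ _, hvU⟩, _,
    (SmoothFun.chart_family p).comp (S' := univ ×ˢ U) (isOpen_univ.prod hUo) continuous_id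
      (SmoothFamily.of_contDiffOn hUo hcd fun p hp => hp.2) ?_, ?_⟩
  · rintro ⟨f, v⟩ ⟨-, hv⟩
    obtain ⟨h, h1, h2⟩ := hU v hv
    refine ⟨mem_univ _, ?_⟩
    have := (extChartAt 𝓘(ℝ, V) p).map_source (x := proj lam ⟨v, h⟩) (by simpa [hc] using h1)
    rwa [show extChartAt 𝓘(ℝ, V) p (proj lam ⟨v, h⟩) = (lam : ℝ) ^ k • v by
      simpa [hc] using h2] at this
  · rintro ⟨f, v⟩ ⟨-, hv⟩
    obtain ⟨h, h1, h2⟩ := hU v hv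
    have := (extChartAt 𝓘(ℝ, V) p).left_inv (x := proj lam ⟨v, h⟩) (by simpa [hc] using h1)
    rw [show extChartAt 𝓘(ℝ, V) p (proj lam ⟨v, h⟩) = (lam : ℝ) ^ k • v by
      simpa [hc] using h2] at this
    simp only [id]
    rw [this, lift_of_ne f h]

theorem contDiffOn_lift [LocallyCompactSpace V] (f : SmoothFun 𝓘(ℝ, V) (HopfManifold V lam)) :
    ContDiffOn ℝ ∞ (lift f) {0}ᶜ := fun v hv =>
  (lift_family.contDiffAt isOpen_univ_prod_compl (p := (f, v)) ⟨mem_univ _, hv⟩).contDiffWithinAt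

theorem lift_family_comp [LocallyCompactSpace V]
    {L : X → SmoothFun 𝓘(ℝ, V) (HopfManifold V lam)} (hL : Continuous L) :
    SmoothFamily (fun ξ v => lift (L ξ) v) (univ ×ˢ {0}ᶜ) :=
  lift_family.comp isOpen_univ_prod_compl hL
    (SmoothFamily.of_contDiffOn isOpen_univ contDiff_id.contDiffOn fun _ _ => mem_univ _)
    fun _ hp => ⟨mem_univ _, hp.2⟩

end Hopf

/-! ### Tangent vectors and vector fields on a Hopf manifold -/

namespace Hopf

variable {V : Type} [NormedAddCommGroup V] [NormedSpace ℝ V] {lam : Set.Ioo (0 : ℝ) 1}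

omit [NormedSpace ℝ V] in
theorem eventually_subtype {y : punctured V} {p : V → Prop}
    (h : ∀ᶠ z : punctured V in 𝓝 y, p z) : ∀ᶠ v in 𝓝 (y : V), p v := by
  rw [← (punctured V).isOpen.isOpenEmbedding_subtypeVal.map_nhds_eq y]
  exact eventually_map.2 h

theorem mdifferentiableAt_proj (y : punctured V) :
    MDifferentiableAt 𝓘(ℝ, V) 𝓘(ℝ, V) (proj lam) y := contMDiff_proj.mdifferentiableAt (by simp)

theorem chart_symm_coe (x : punctured V) {y : punctured V} (hy : y ∈ annulus lam x) :
    (chart lam x).symm (y : V) = proj lam y := by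
  have h := chart_proj (lam := lam) x hy
  rw [← h.2, (chart lam x).left_inv h.1]

theorem coe_mem_target (x : punctured V) {y : punctured V} (hy : y ∈ annulus lam x) :
    (y : V) ∈ (chart lam x).target := by
  have h := chart_proj (lam := lam) x hy
  rw [← h.2]
  exact (chart lam x).map_source h.1

/-- The chart inverse agrees with the projection near x. It is a map on V and not on the subtype
`punctured V`, so it composes directly with homotheties of V. -/
theorem hasMFDerivAt_chart_symm (x : punctured V) :
    HasMFDerivAt 𝓘(ℝ, V) 𝓘(ℝ, V) (chart lam x).symm (x : V)
      (mfderiv 𝓘(ℝ, V) 𝓘(ℝ, V) (proj lam) x : V →L[ℝ] V) := by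
  have hx := mem_annulus (lam := lam) x
  have h1 : MDifferentiableAt 𝓘(ℝ, V) 𝓘(ℝ, V) (chart lam x).symm (x : V) :=
    ((contMDiffOn_symm_of_mem_maximalAtlas (n := ∞) (IsManifold.subset_maximalAtlas
      (show chart lam x ∈ atlas V (HopfManifold V lam) from ⟨x, rfl⟩))).contMDiffAt
      ((chart lam x).open_target.mem_nhds (coe_mem_target x hx))).mdifferentiableAt (by simp)
  have h2 := (h1.hasMFDerivAt.comp x (hasMFDerivAt_val x)).congr_of_eventuallyEq
    (f₁ := proj lam) (by
      filter_upwards [(isOpen_annulus x).mem_nhds hx] with z hz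
      exact (chart_symm_coe x hz).symm)
  have h3 := hasMFDerivAt_unique h2 (mdifferentiableAt_proj x).hasMFDerivAt
  have h4 := h1.hasMFDerivAt
  exact h3 ▸ h4

/-- The chain rule for proj ∘ γᵏ = proj, carried out with the chart inverses at x and γᵏ x. -/
theorem mfderiv_proj_dilation (k : ℤ) (x : punctured V) (w : V) :
    (mfderiv 𝓘(ℝ, V) 𝓘(ℝ, V) (proj lam) (dilation lam k x) ((lam : ℝ) ^ k • w) : V) =
      mfderiv 𝓘(ℝ, V) 𝓘(ℝ, V) (proj lam) x w := by
  set x' := dilation lam k x with hx'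
  have h4 : HasMFDerivAt 𝓘(ℝ, V) 𝓘(ℝ, V) (fun v : V => (lam : ℝ) ^ k • v) (x : V)
      ((lam : ℝ) ^ k • ContinuousLinearMap.id ℝ V) :=
    ((lam : ℝ) ^ k • ContinuousLinearMap.id ℝ V).hasMFDerivAt
  have h5 := (HasMFDerivAt.comp (x : V) (hasMFDerivAt_chart_symm (lam := lam) x') h4)
  have h6 : (chart lam x).symm =ᶠ[𝓝 (x : V)]
      (chart lam x').symm ∘ fun v : V => (lam : ℝ) ^ k • v := by
    refine eventually_subtype ?_
    filter_upwards [(isOpen_annulus x).mem_nhds (mem_annulus x),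
      ((isOpen_annulus x').preimage (continuous_dilation k)).mem_nhds (mem_annulus x')] with z hz hz'
    rw [chart_symm_coe x hz, ← proj_dilation k z, ← chart_symm_coe x' hz']
    rfl
  have h7 := hasMFDerivAt_unique (h5.congr_of_eventuallyEq h6) (hasMFDerivAt_chart_symm x)
  exact congrArg (fun L : V →L[ℝ] V => L w) h7

theorem mfderiv_chart_mfderiv_proj (x : punctured V) {y : punctured V} (hy : y ∈ annulus lam x)
    (w : V) : (mfderiv 𝓘(ℝ, V) 𝓘(ℝ, V) (chart lam x) (proj lam y)
      (mfderiv 𝓘(ℝ, V) 𝓘(ℝ, V) (proj lam) y w) : V) = w := by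
  have h1 : MDifferentiableAt 𝓘(ℝ, V) 𝓘(ℝ, V) (chart lam x) (proj lam y) :=
    mdifferentiableAt_atlas (show chart lam x ∈ atlas V (HopfManifold V lam) from ⟨x, rfl⟩)
      (chart_proj x hy).1
  have h3 := h1.hasMFDerivAt.comp y (mdifferentiableAt_proj y).hasMFDerivAt
  have h5 := (hasMFDerivAt_val y).congr_of_eventuallyEq (f₁ := chart lam x ∘ proj lam) (by
    filter_upwards [(isOpen_annulus x).mem_nhds hy] with z hz using (chart_proj x hz).2)
  exact congrArg (fun L : V →L[ℝ] V => L w) (hasMFDerivAt_unique h3 h5)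

theorem mfderiv_fun_mfderiv_proj [LocallyCompactSpace V]
    (f : SmoothFun 𝓘(ℝ, V) (HopfManifold V lam)) (y : punctured V)
    (w : V) : (mfderiv 𝓘(ℝ, V) 𝓘(ℝ, ℂ) f (proj lam y)
      (mfderiv 𝓘(ℝ, V) 𝓘(ℝ, V) (proj lam) y w) : ℂ) = fderiv ℝ (lift f) (y : V) w := by
  have h1 := (f.2.mdifferentiableAt (x := proj lam y) (by simp)).hasMFDerivAt.comp y
    (mdifferentiableAt_proj y).hasMFDerivAt
  have h2 := (((contDiffOn_lift f).contDiffAt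
    (isOpen_compl_singleton.mem_nhds y.2)).differentiableAt (by simp)).hasFDerivAt.hasMFDerivAt
  have h3 := (h2.comp y (hasMFDerivAt_val y)).congr_of_eventuallyEq (f₁ := f.1 ∘ proj lam)
    (Eventually.of_forall fun z => (lift_coe f z).symm)
  exact congrArg (fun L : V →L[ℝ] ℂ => L w) (hasMFDerivAt_unique h1 h3)

/-- The vector at `p` induced by a vector field on `V \ {0}`. -/
def pushVec (F : V → V) (p : HopfManifold V lam) : TangentSpace 𝓘(ℝ, V) p :=
  (mfderiv 𝓘(ℝ, V) 𝓘(ℝ, V) (proj lam) (Quotient.out (s := orbitSetoid V lam) p)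
    (F (Quotient.out (s := orbitSetoid V lam) p).1) : V)

theorem zpow_invariant {W : Type*} [AddCommGroup W] [Module ℝ W] {F : V → W}
    (hF : ∀ v : V, v ≠ 0 → F ((lam : ℝ) • v) = (lam : ℝ) • F v) (k : ℤ) {v : V} (hv : v ≠ 0) :
    F ((lam : ℝ) ^ k • v) = (lam : ℝ) ^ k • F v := by
  have hl := lam.2.1.ne'
  have hpow : ∀ (k : ℕ) (v : V), v ≠ 0 → F ((lam : ℝ) ^ k • v) = (lam : ℝ) ^ k • F v := by
    intro k v hv
    induction k with
    | zero => simp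
    | succ k ih =>
      rw [pow_succ', mul_smul, hF _ (smul_ne_zero (pow_ne_zero _ hl) hv), ih, mul_smul]
  obtain ⟨k, rfl | rfl⟩ := k.eq_nat_or_neg
  · rw [zpow_natCast, hpow k v hv]
  · have hk := pow_ne_zero k hl
    have := hpow k (((lam : ℝ) ^ k)⁻¹ • v) (smul_ne_zero (inv_ne_zero hk) hv)
    rw [smul_smul, mul_inv_cancel₀ hk, one_smul] at this
    rw [zpow_neg, zpow_natCast, this, smul_smul, inv_mul_cancel₀ hk, one_smul]

/-- Equivariance of F makes the choice of representative in `pushVec` irrelevant. -/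
theorem pushVec_proj {F : V → V} (hF : ∀ v : V, v ≠ 0 → F ((lam : ℝ) • v) = (lam : ℝ) • F v)
    (y : punctured V) :
    (pushVec F (proj lam y) : V) = mfderiv 𝓘(ℝ, V) 𝓘(ℝ, V) (proj lam) y (F y) := by
  set z := Quotient.out (s := orbitSetoid V lam) (proj lam y) with hz
  have h1 : proj lam y = proj lam z := (Quotient.out_eq (s := orbitSetoid V lam) (proj lam y)).symm
  obtain ⟨k, hk⟩ := proj_eq_iff.1 h1
  have h2 : z = dilation lam k y := Subtype.ext hk
  rw [pushVec, ← hz, h2]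
  have h3 := mfderiv_proj_dilation (lam := lam) k y (F y)
  rw [← h3]
  exact congrArg (fun w : V => (mfderiv 𝓘(ℝ, V) 𝓘(ℝ, V) (proj lam) (dilation lam k y) w : V))
    (zpow_invariant hF k y.2)

open VectorField in
/-- The vector field on the Hopf manifold induced by an invariant vector field on `V \ {0}`. -/
def descendField [CompleteSpace V] (F : V → V) (hFs : ContDiffOn ℝ ∞ F {0}ᶜ)
    (hF : ∀ v : V, v ≠ 0 → F ((lam : ℝ) • v) = (lam : ℝ) • F v) :
    SmoothField V (HopfManifold V lam) :=
  ⟨pushVec F, by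
    intro p
    obtain ⟨y, rfl⟩ := proj_surjective p
    have h0 := chart_proj (lam := lam) y (mem_annulus y)
    have hs := (chart lam y).open_source.mem_nhds h0.1
    have hinv : ∀ q ∈ (chart lam y).source,
        (mfderiv 𝓘(ℝ, V) 𝓘(ℝ, V) (chart lam y) q).IsInvertible := fun q hq =>
      ⟨(mdifferentiable_of_mem_atlas (I := 𝓘(ℝ, V))
        (show chart lam y ∈ atlas V (HopfManifold V lam) from ⟨y, rfl⟩)).mfderiv hq, rfl⟩
    have h1 : ContMDiffAt 𝓘(ℝ, V) 𝓘(ℝ, V).tangent ∞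
        (fun v : V => (⟨v, F v⟩ : TangentBundle 𝓘(ℝ, V) V)) (chart lam y (proj lam y)) := by
      refine contMDiffAt_vectorSpace_iff_contDiffAt.2 ?_
      rw [h0.2]
      exact hFs.contDiffAt (isOpen_compl_singleton.mem_nhds y.2)
    -- Smoothness holds because the field is locally the pullback of F by a chart, a local
    -- diffeomorphism.
    have h2 := ContMDiffAt.mpullback_vectorField_preimage (n := ∞) h1
      ((contMDiffOn_chart y).contMDiffAt hs) (hinv _ h0.1) (by simp)
    refine h2.congr_of_eventuallyEq ?_
    filter_upwards [hs] with q hq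
    obtain ⟨y', hy', h3, rfl⟩ := proj_chart y hq
    have h4 := mfderiv_chart_mfderiv_proj (lam := lam) y hy' (F y')
    have h5 : (mpullback 𝓘(ℝ, V) 𝓘(ℝ, V) (chart lam y) F (proj lam y') : V) =
        pushVec F (proj lam y') := by
      refine ((hinv _ hq).inverse_apply_eq).2 ?_
      rw [pushVec_proj hF]
      refine Eq.trans ?_ h4.symm
      rw [h3]
    exact congrArg (fun w => (⟨proj lam y', w⟩ : TangentBundle 𝓘(ℝ, V) (HopfManifold V lam)))
      h5.symm⟩

theorem lift_fieldDeriv [CompleteSpace V] [LocallyCompactSpace V] {F : V → V}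
    {hFs : ContDiffOn ℝ ∞ F {0}ᶜ}
    {hF : ∀ v : V, v ≠ 0 → F ((lam : ℝ) • v) = (lam : ℝ) • F v}
    (f : SmoothFun 𝓘(ℝ, V) (HopfManifold V lam)) {v : V} (hv : v ≠ 0) :
    lift (fieldDeriv (descendField F hFs hF) f) v = fderiv ℝ (lift f) v (F v) := by
  have h := mfderiv_fun_mfderiv_proj f ⟨v, hv⟩ (F v)
  rw [lift_of_ne _ hv, ← h]
  exact congrArg (fun w : V => (mfderiv 𝓘(ℝ, V) 𝓘(ℝ, ℂ) f (proj lam ⟨v, hv⟩) w : ℂ))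
    (pushVec_proj hF ⟨v, hv⟩)

end Hopf

/-! ### The generating field r ∂/∂t and its dual form -/

namespace Reeb

variable {n : ℕ} {lam : Set.Ioo (0 : ℝ) 1}

/-- The Euclidean norm on `𝔼 × ℝ`. -/
def radius (v : Model n) : ℝ := √(‖v.1‖ ^ 2 + v.2 ^ 2)

theorem sq_add_sq_pos {v : Model n} (hv : v ≠ 0) : 0 < ‖v.1‖ ^ 2 + v.2 ^ 2 := by
  by_contra! h
  have h1 : ‖v.1‖ ^ 2 = 0 := by nlinarith [sq_nonneg ‖v.1‖, sq_nonneg v.2]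
  have h2 : v.2 ^ 2 = 0 := by nlinarith [sq_nonneg ‖v.1‖, sq_nonneg v.2]
  exact hv (Prod.ext (by simpa using h1) (by simpa using h2))

theorem radius_pos {v : Model n} (hv : v ≠ 0) : 0 < radius v := Real.sqrt_pos.2 (sq_add_sq_pos hv)

theorem radius_smul (v : Model n) : radius ((lam : ℝ) • v) = lam * radius v := by
  have h : ‖((lam : ℝ) • v).1‖ ^ 2 + ((lam : ℝ) • v).2 ^ 2 = (lam : ℝ) ^ 2 * (‖v.1‖ ^ 2 + v.2 ^ 2) := by
    simp only [Prod.smul_fst, Prod.smul_snd, norm_smul, Real.norm_of_nonneg lam.2.1.le, smul_eq_mul]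
    ring
  rw [radius, h, Real.sqrt_mul (sq_nonneg _), Real.sqrt_sq lam.2.1.le, radius]

/-- The square root of a positive smooth function. The norm of the product `Model n` is a maximum,
which is not smooth, so it cannot serve as the homogeneous factor. -/
theorem contDiffOn_radius : ContDiffOn ℝ ∞ (radius (n := n)) {0}ᶜ := by
  intro v hv
  refine ContDiffAt.contDiffWithinAt (ContDiffAt.sqrt ?_ (sq_add_sq_pos hv).ne')
  exact ((contDiff_fst.norm_sq ℝ).add (contDiff_snd.pow 2)).contDiffAt

/-- The `log λ`-periodic exponential. -/
def wave (lam : Set.Ioo (0 : ℝ) 1) (s : ℝ) : ℂ :=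
  Complex.exp ((2 * Real.pi / Real.log lam * s : ℝ) * Complex.I)

theorem log_neg : Real.log (lam : ℝ) < 0 := Real.log_neg lam.2.1 lam.2.2

theorem wave_add (s : ℝ) : wave lam (s + Real.log lam) = wave lam s := by
  rw [wave, wave, Complex.exp_eq_exp_iff_exists_int]
  refine ⟨1, ?_⟩
  have h := log_neg (lam := lam).ne
  rw [mul_add, div_mul_cancel₀ _ h]
  push_cast
  ring

theorem wave_ne_zero (s : ℝ) : wave lam s ≠ 0 := Complex.exp_ne_zero _

theorem contDiff_wave : ContDiff ℝ ∞ (wave lam) := by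
  have h : ContDiff ℝ ∞ fun s : ℝ => ((2 * Real.pi / Real.log lam * s : ℝ) : ℂ) :=
    Complex.ofRealCLM.contDiff.comp (contDiff_const.mul contDiff_id)
  exact (h.mul contDiff_const).cexp

theorem hasDerivAt_wave (s : ℝ) :
    HasDerivAt (wave lam) (2 * Real.pi / Real.log lam * Complex.I * wave lam s) s := by
  have h1 : HasDerivAt (fun s : ℝ => 2 * Real.pi / Real.log lam * s)
      (2 * Real.pi / Real.log lam) s := by
    simpa using (hasDerivAt_id s).const_mul (2 * Real.pi / Real.log lam)
  have h2 := ((h1.ofReal_comp).mul_const Complex.I).cexp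
  refine h2.congr_deriv ?_
  rw [wave]
  push_cast
  ring

theorem wave_log_smul {r : ℝ} (hr : 0 < r) :
    wave lam (Real.log (lam * r)) = wave lam (Real.log r) := by
  rw [Real.log_mul lam.2.1.ne' hr.ne', add_comm, wave_add]

theorem contDiffOn_log_radius : ContDiffOn ℝ ∞ (fun v : Model n => Real.log (radius v)) {0}ᶜ :=
  contDiffOn_radius.log fun _ hv => (radius_pos hv).ne'

variable (n lam)

/-- The function `exp (2πi log r / log λ)` on the Hopf manifold. -/
def phase : SmoothFun 𝓘(ℝ, Model n) (HopfManifold (Model n) lam) :=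
  descend (fun v => wave lam (Real.log (radius v)))
    (contDiff_wave.comp_contDiffOn contDiffOn_log_radius)
    fun v hv => by rw [radius_smul, wave_log_smul (radius_pos hv)]

/-- The inverse of `phase`. -/
def phaseInv : SmoothFun 𝓘(ℝ, Model n) (HopfManifold (Model n) lam) :=
  descend (fun v => (wave lam (Real.log (radius v)))⁻¹)
    ((contDiff_wave.comp_contDiffOn contDiffOn_log_radius).inv fun _ _ => wave_ne_zero _)
    fun v hv => by rw [radius_smul, wave_log_smul (radius_pos hv)]

/-- The function `t / r` on the Hopf manifold. -/
def slope : SmoothFun 𝓘(ℝ, Model n) (HopfManifold (Model n) lam) :=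
  descend (fun v => ((v.2 / radius v : ℝ) : ℂ))
    (Complex.ofRealCLM.contDiff.comp_contDiffOn
      (contDiff_snd.contDiffOn.div contDiffOn_radius fun _ hv => (radius_pos hv).ne'))
    fun v hv => by
      rw [radius_smul, Prod.smul_snd, smul_eq_mul, mul_div_mul_left _ _ lam.2.1.ne']

/-- The vector field `r ∂/∂t` on the Hopf manifold. -/
def reebField : SmoothField (Model n) (HopfManifold (Model n) lam) :=
  descendField (fun v => radius v • ((0, 1) : Model n)) (contDiffOn_radius.smul contDiffOn_const)
    fun v _ => by rw [radius_smul, mul_smul]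

variable {n lam}

theorem hasDerivAt_lift (f : SmoothFun 𝓘(ℝ, Model n) (HopfManifold (Model n) lam))
    {z : EuclideanSpace ℝ (Fin n)} {t : ℝ} (hv : ((z, t) : Model n) ≠ 0) :
    HasDerivAt (fun s : ℝ => lift f (z, s)) (fderiv ℝ (lift f) (z, t) (0, 1)) t := by
  have h1 : HasDerivAt (fun s : ℝ => ((z, s) : Model n)) ((0, 1) : Model n) t :=
    (hasDerivAt_const t z).prodMk (hasDerivAt_id t)
  exact ((((contDiffOn_lift f).contDiffAt (isOpen_compl_singleton.mem_nhds hv)).differentiableAt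
    (by simp)).hasFDerivAt (x := ((z, t) : Model n))).comp_hasDerivAt t h1

theorem lift_reebField (f : SmoothFun 𝓘(ℝ, Model n) (HopfManifold (Model n) lam))
    {z : EuclideanSpace ℝ (Fin n)} {t : ℝ} (hv : ((z, t) : Model n) ≠ 0) {d : ℂ}
    (hd : HasDerivAt (fun s : ℝ => lift f (z, s)) d t) :
    lift (fieldDeriv (reebField n lam) f) (z, t) = radius ((z, t) : Model n) * d := by
  rw [reebField, lift_fieldDeriv f hv, map_smul, Complex.real_smul,
    (hasDerivAt_lift f hv).unique hd]

theorem lift_descend_eventuallyEq {F : Model n → ℂ} {hF : ContDiffOn ℝ ∞ F {0}ᶜ}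
    {hinv : ∀ v : Model n, v ≠ 0 → F ((lam : ℝ) • v) = F v}
    {z : EuclideanSpace ℝ (Fin n)} {t : ℝ} (hv : ((z, t) : Model n) ≠ 0) :
    (fun s : ℝ => lift (descend (lam := lam) F hF hinv) (z, s)) =ᶠ[𝓝 t] fun s => F (z, s) := by
  have h : ∀ᶠ s : ℝ in 𝓝 t, ((z, s) : Model n) ≠ 0 :=
    (Continuous.prodMk_right z).continuousAt.eventually (isOpen_compl_singleton.mem_nhds hv)
  filter_upwards [h] with s hs using lift_descend hs

theorem hasDerivAt_radius {z : EuclideanSpace ℝ (Fin n)} {t : ℝ} (hv : ((z, t) : Model n) ≠ 0) :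
    HasDerivAt (fun s : ℝ => radius ((z, s) : Model n)) (t / radius ((z, t) : Model n)) t := by
  have h1 : HasDerivAt (fun s : ℝ => ‖z‖ ^ 2 + s ^ 2) (2 * t) t := by
    simpa using (hasDerivAt_pow 2 t).const_add (‖z‖ ^ 2)
  refine (h1.sqrt (sq_add_sq_pos hv).ne').congr_deriv ?_
  rw [radius, mul_div_mul_left _ _ two_ne_zero]

theorem lift_slope {v : Model n} (hv : v ≠ 0) :
    lift (slope n lam) v = ((v.2 / radius v : ℝ) : ℂ) := lift_descend hv

theorem lift_phase {v : Model n} (hv : v ≠ 0) :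
    lift (phase n lam) v = wave lam (Real.log (radius v)) := lift_descend hv

theorem lift_phaseInv {v : Model n} (hv : v ≠ 0) :
    lift (phaseInv n lam) v = (wave lam (Real.log (radius v)))⁻¹ := lift_descend hv

/-- Since ∂r/∂t = t/r, one has r ∂(t/r)/∂t = 1 - (t/r)². -/
theorem lift_reebField_slope {v : Model n} (hv : v ≠ 0) :
    lift (fieldDeriv (reebField n lam) (slope n lam)) v = 1 - lift (slope n lam) v ^ 2 := by
  obtain ⟨z, t⟩ := v
  have hr := (radius_pos hv).ne'
  have h1 := ((hasDerivAt_id t).div (hasDerivAt_radius hv) hr).ofReal_comp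
  rw [lift_reebField _ hv (h1.congr_of_eventuallyEq (lift_descend_eventuallyEq hv)), lift_slope hv]
  norm_cast
  simp only [id]
  field_simp

/-- Since r ∂(log r)/∂t = t/r, this is the logarithmic derivative of the exponential of a multiple
of log r. The function log r itself does not descend to the quotient, but `phase` does. -/
theorem lift_reebField_phase {v : Model n} (hv : v ≠ 0) :
    lift (fieldDeriv (reebField n lam) (phase n lam)) v =
      2 * Real.pi / Real.log lam * Complex.I * lift (slope n lam) v * lift (phase n lam) v := by
  obtain ⟨z, t⟩ := v
  have hr := (radius_pos hv).ne'
  have h1 := (hasDerivAt_wave (lam := lam) _).scomp t ((hasDerivAt_radius hv).log hr)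
  rw [lift_reebField _ hv (h1.congr_of_eventuallyEq (lift_descend_eventuallyEq hv)), lift_slope hv,
    lift_phase hv, Complex.real_smul]
  have hr' : ((radius ((z, t) : Model n) : ℝ) : ℂ) ≠ 0 := by exact_mod_cast hr
  push_cast
  field_simp

/-- The differential of a function at `p`. -/
def differentialAt (f : SmoothFun 𝓘(ℝ, Model n) (HopfManifold (Model n) lam))
    (p : HopfManifold (Model n) lam) : Model n →L[ℝ] ℂ := mfderiv 𝓘(ℝ, Model n) 𝓘(ℝ, ℂ) f p

/-- The restriction of this 1-form to the leaves is dual to `reebField`. -/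
def dualForm (p : HopfManifold (Model n) lam) : Model n →L[ℝ] ℂ :=
  differentialAt (slope n lam) p +
    ((2 * Real.pi / Real.log lam * Complex.I)⁻¹ * slope n lam p * phaseInv n lam p) •
      differentialAt (phase n lam) p

/-- The value of `dualForm` on a vector field. -/
def coeff (X : SmoothField (Model n) (HopfManifold (Model n) lam)) :
    SmoothFun 𝓘(ℝ, Model n) (HopfManifold (Model n) lam) :=
  fieldDeriv X (slope n lam) + (2 * Real.pi / Real.log lam * Complex.I : ℂ)⁻¹ •
    (slope n lam * phaseInv n lam * fieldDeriv X (phase n lam))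

theorem coeff_apply (X : SmoothField (Model n) (HopfManifold (Model n) lam))
    (p : HopfManifold (Model n) lam) : coeff X p = dualForm p (X p) := by
  rw [coeff]
  simp only [SmoothFun.add_apply, SmoothFun.smul_apply, SmoothFun.mul_apply]
  rw [← mul_assoc, ← mul_assoc]
  rfl

/-- The term from `slope` contributes 1 - (t/r)², and the one from `phase`, which represents (t/r) d
log r, contributes (t/r)². -/
theorem coeff_reebField : coeff (reebField n lam) = 1 := by
  refine ext_lift fun v hv => ?_
  have h1 : lift (1 : SmoothFun 𝓘(ℝ, Model n) (HopfManifold (Model n) lam)) v = 1 := by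
    rw [lift_of_ne _ hv]; rfl
  have h2 : lift (phaseInv n lam) v * lift (phase n lam) v = 1 := by
    rw [lift_phaseInv hv, lift_phase hv, inv_mul_cancel₀ (wave_ne_zero _)]
  have h3 : (2 * Real.pi / Real.log lam * Complex.I : ℂ) ≠ 0 := by
    have := log_neg (lam := lam).ne
    have := Real.pi_ne_zero
    simp [*]
  rw [h1, coeff]
  simp only [lift_add, lift_const_smul, lift_mul, lift_reebField_slope hv, lift_reebField_phase hv]
  linear_combination lift (slope n lam) v ^ 2 * h2 + (lift (slope n lam) v ^ 2 *
    lift (phaseInv n lam) v * lift (phase n lam) v) * (inv_mul_cancel₀ h3)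

theorem dualForm_reebField (p : HopfManifold (Model n) lam) :
    dualForm p (reebField n lam p) = 1 := by
  rw [← coeff_apply, coeff_reebField]
  rfl

theorem reebField_ne_zero (p : HopfManifold (Model n) lam) : reebField n lam p ≠ 0 := by
  intro h
  have h1 := dualForm_reebField p
  rw [h] at h1
  exact zero_ne_one ((map_zero (dualForm p)).symm.trans h1)

theorem reebField_proj (y : punctured (Model n)) :
    reebField n lam (proj lam y) = radius (y : Model n) •
      mfderiv 𝓘(ℝ, Model n) 𝓘(ℝ, Model n) (proj lam) y ((0, 1) : Model n) :=
  (pushVec_proj (F := fun v => radius v • ((0, 1) : Model n))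
    (fun v _ => by rw [radius_smul, mul_smul]) y).trans
      ((mfderiv 𝓘(ℝ, Model n) 𝓘(ℝ, Model n) (proj lam) y).map_smul _ ((0, 1) : Model n))

theorem reebField_mem (p : HopfManifold (Model n) lam) :
    reebField n lam p ∈ (affineFlow n lam).tangent p := by
  obtain ⟨y, rfl⟩ := proj_surjective p
  rw [reebField_proj]
  exact Submodule.smul_mem _ _ (Submodule.subset_span ⟨y, rfl, rfl⟩)

theorem exists_smul_reebField {p : HopfManifold (Model n) lam}
    {v : TangentSpace 𝓘(ℝ, Model n) p} (hv : v ∈ (affineFlow n lam).tangent p) :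
    ∃ c : ℝ, v = c • reebField n lam p := by
  suffices h : (affineFlow n lam).tangent p ≤ Submodule.span ℝ {reebField n lam p} by
    obtain ⟨c, hc⟩ := Submodule.mem_span_singleton.1 (h hv)
    exact ⟨c, hc.symm⟩
  refine Submodule.span_le.2 ?_
  -- Each representative y of p gives its own spanning vector, and each is r(y)⁻¹ times the same
  -- vector T p.
  rintro w ⟨y, rfl, hw⟩
  refine Submodule.mem_span_singleton.2 ⟨(radius (y : Model n))⁻¹, ?_⟩
  rw [reebField_proj]
  refine (inv_smul_smul₀ (radius_pos y.2).ne' _).trans hw.symm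

end Reeb

/-! ### Leafwise forms and their cohomology in terms of r ∂/∂t -/

namespace Reeb

variable {n : ℕ} {lam : Set.Ioo (0 : ℝ) 1}

variable (n lam) in
/-- The vector field `r ∂/∂t`, as a vector field tangent to the foliation. -/
def reebTangent : (affineFlow n lam).fields := ⟨reebField n lam, reebField_mem⟩

theorem coeff_of_eq_smul {X : (affineFlow n lam).fields} {p : HopfManifold (Model n) lam} {c : ℝ}
    (h : X.1 p = c • reebField n lam p) : coeff X.1 p = c := by
  rw [coeff_apply, h]
  refine ((dualForm p).map_smul c (reebField n lam p)).trans ?_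
  rw [dualForm_reebField]
  simp

/-- The tangent line is spanned by T, and the dual form reads off the coefficient. The coefficient
is a smooth complex-valued function that happens to be real, which is why its real part appears. -/
theorem eq_coeff_smul (X : (affineFlow n lam).fields) (p : HopfManifold (Model n) lam) :
    X.1 p = (coeff X.1 p).re • reebField n lam p := by
  obtain ⟨c, hc⟩ := exists_smul_reebField (X.2 p)
  rw [coeff_of_eq_smul hc, Complex.ofReal_re, hc]

theorem coeff_re (X : (affineFlow n lam).fields) (p : HopfManifold (Model n) lam) :
    ((coeff X.1 p).re : ℂ) = coeff X.1 p := (coeff_of_eq_smul (eq_coeff_smul X p)).symm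

theorem coeff_ne_zero {X : (affineFlow n lam).fields} (hX : ∀ p, X.1 p ≠ 0)
    (p : HopfManifold (Model n) lam) : coeff X.1 p ≠ 0 := by
  intro h
  refine hX p ?_
  rw [eq_coeff_smul X p, h, Complex.zero_re, zero_smul]

theorem fieldAt_eq (X : (affineFlow n lam).fields) (p : HopfManifold (Model n) lam) :
    (affineFlow n lam).fieldAt X p =
      (coeff X.1 p).re • (affineFlow n lam).fieldAt (reebTangent n lam) p :=
  Subtype.ext (eq_coeff_smul X p)

theorem fieldDeriv_eq (X : (affineFlow n lam).fields)
    (f : SmoothFun 𝓘(ℝ, Model n) (HopfManifold (Model n) lam)) :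
    fieldDeriv X.1 f = coeff X.1 * fieldDeriv (reebField n lam) f := by
  refine SmoothFun.ext fun p => ?_
  have h : fieldDeriv X.1 f p = differentialAt f p (X.1 p) := rfl
  rw [h, eq_coeff_smul X p]
  refine ((differentialAt f p).map_smul _ (reebField n lam p)).trans ?_
  rw [Complex.real_smul, coeff_re]
  rfl

theorem fieldDeriv_mul (X : SmoothField (Model n) (HopfManifold (Model n) lam))
    (f g : SmoothFun 𝓘(ℝ, Model n) (HopfManifold (Model n) lam)) :
    fieldDeriv X (f * g) = f * fieldDeriv X g + g * fieldDeriv X f := by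
  refine SmoothFun.ext fun p => ?_
  have hf := (f.2.mdifferentiableAt (x := p) (by simp)).hasMFDerivAt
  have hg := (g.2.mdifferentiableAt (x := p) (by simp)).hasMFDerivAt
  have h := (hf.mul hg).mfderiv
  exact congrArg (fun L : Model n →L[ℝ] ℂ => L (X p)) h

theorem exists_eq_smul_fieldAt {p : HopfManifold (Model n) lam}
    (v : (affineFlow n lam).tangent p) :
    ∃ c : ℝ, v = c • (affineFlow n lam).fieldAt (reebTangent n lam) p := by
  obtain ⟨c, hc⟩ := exists_smul_reebField v.2
  exact ⟨c, Subtype.ext hc⟩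

/-- The arguments are all multiples of one vector, and an alternating form vanishes on repeated
arguments. -/
theorem eval_eq_zero_of_two_le {l : ℕ} (hl : 2 ≤ l) (α : (affineFlow n lam).LeafForm l) : α = 0 := by
  refine Subtype.ext (funext fun p => AlternatingMap.ext fun v => ?_)
  choose c hc using fun i => exists_eq_smul_fieldAt (v i)
  rw [funext hc, AlternatingMap.map_smul_univ]
  rw [(α.1 p).map_eq_zero_of_eq (i := ⟨0, by omega⟩) (j := ⟨1, by omega⟩) _ rfl (by simp),
    smul_zero]
  rfl

theorem eval_one_eq (X : Fin 1 → (affineFlow n lam).fields) (α : (affineFlow n lam).LeafForm 1) :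
    (affineFlow n lam).eval X α =
      coeff (X 0).1 * (affineFlow n lam).eval ![reebTangent n lam] α := by
  refine SmoothFun.ext fun p => ?_
  change α.1 p (fun i => (affineFlow n lam).fieldAt (X i) p) = coeff (X 0).1 p * α.1 p (fun i =>
    (affineFlow n lam).fieldAt (![reebTangent n lam] i) p)
  have h : (fun i => (affineFlow n lam).fieldAt (X i) p) = fun i => (coeff (X i).1 p).re •
      (affineFlow n lam).fieldAt (![reebTangent n lam] i) p := by
    funext i
    rw [Subsingleton.elim i 0, fieldAt_eq]
    rfl
  rw [h, AlternatingMap.map_smul_univ, Fin.prod_univ_one, Complex.real_smul, coeff_re]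

/-- The foliated form with value `g` on `reebField`. -/
def reebForm (g : SmoothFun 𝓘(ℝ, Model n) (HopfManifold (Model n) lam)) :
    (affineFlow n lam).LeafForm 1 :=
  ⟨fun p => AlternatingMap.ofSubsingleton ℝ ((affineFlow n lam).tangent p) ℂ 0
    (((g p • dualForm p : Model n →L[ℝ] ℂ) : Model n →ₗ[ℝ] ℂ) ∘ₗ
      ((affineFlow n lam).tangent p).subtype), fun X => by
    have h := (g * coeff (X 0).1).2
    have h2 : (g * coeff (X 0).1).1 = fun p => g p * dualForm p ((X 0).1 p) :=
      funext fun p => congrArg (g p * ·) (coeff_apply (X 0).1 p)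
    rw [h2] at h
    exact h⟩

theorem eval_reebForm (X : Fin 1 → (affineFlow n lam).fields)
    (g : SmoothFun 𝓘(ℝ, Model n) (HopfManifold (Model n) lam)) :
    (affineFlow n lam).eval X (reebForm g) = coeff (X 0).1 * g := by
  refine SmoothFun.ext fun p => ?_
  rw [SmoothFun.mul_apply, coeff_apply, mul_comm]
  rfl

theorem continuous_eval_form {l : ℕ} (X : Fin l → (affineFlow n lam).fields) :
    Continuous ((affineFlow n lam).eval X) := continuous_iff_le_induced.2 (iInf_le _ X)

theorem continuous_reebForm :
    Continuous (reebForm : SmoothFun 𝓘(ℝ, Model n) (HopfManifold (Model n) lam) → _) := by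
  refine continuous_iInf_rng.2 fun X => continuous_induced_rng.2 ?_
  have h : (affineFlow n lam).eval X ∘ reebForm = fun g => g * coeff (X 0).1 :=
    funext fun g => (eval_reebForm X g).trans (mul_comm _ _)
  rw [h]
  exact SmoothFun.continuous_mul' _

/-- The linear algebra left after expanding [fT, gT] by the Leibniz rules, with [T, T] = 0 as the
zero term; d and d' are the differentials of f and g. It is stated in a plain normed space to free
it from tangent bundles. -/
theorem bracket_smul_smul {W : Type*} [NormedAddCommGroup W] [NormedSpace ℝ W] (t : W) (f g : ℝ)
    (d d' : W →L[ℝ] ℝ) :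
    -(d (g • t)) • t + f • (d' t • t + g • (0 : W)) = (f * d' t - g * d t) • t := by
  simp only [map_smul, smul_eq_mul]
  module

-- The identity [aT, bT] = (a Tb - b Ta) T.
open VectorField in
theorem coeff_bracket (X Y : (affineFlow n lam).fields) :
    coeff ((affineFlow n lam).bracket X Y).1 =
      coeff X.1 * fieldDeriv (reebField n lam) (coeff Y.1) -
        coeff Y.1 * fieldDeriv (reebField n lam) (coeff X.1) := by
  set T := reebField n lam with hT
  -- Leibniz rules for brackets need real scalars, so each coefficient is replaced by its real part;
  -- being real, it has the same derivative along T.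
  have hre : ∀ Z : (affineFlow n lam).fields, ∀ p, ∃ d : Model n →L[ℝ] ℝ,
      HasMFDerivAt 𝓘(ℝ, Model n) 𝓘(ℝ, ℝ) (fun p => (coeff Z.1 p).re) p d ∧
      fieldDeriv T (coeff Z.1) p = d (T p) := by
    intro Z p
    have h1 := ((coeff Z.1).2.mdifferentiableAt (x := p) (by simp)).hasMFDerivAt
    have h2 := (Complex.reCLM.hasFDerivAt (x := coeff Z.1 p)).hasMFDerivAt.comp p h1
    refine ⟨_, h2, ?_⟩
    have h3 := (Complex.ofRealCLM.hasFDerivAt (x := (coeff Z.1 p).re)).hasMFDerivAt.comp p h2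
    have h4 := h3.congr_of_eventuallyEq (f₁ := (coeff Z.1 : _ → ℂ))
      (Eventually.of_forall fun q => (coeff_re Z q).symm)
    exact congrArg (fun L : Model n →L[ℝ] ℂ => L (T p)) (hasMFDerivAt_unique h1 h4)
  refine SmoothFun.ext fun p => ?_
  obtain ⟨d, hd, hd'⟩ := hre X p
  obtain ⟨d', hd₂, hd₂'⟩ := hre Y p
  rw [SmoothFun.sub_apply, SmoothFun.mul_apply, SmoothFun.mul_apply, hd', hd₂', ← coeff_re X,
    ← coeff_re Y]
  have hTd : MDifferentiableAt 𝓘(ℝ, Model n) 𝓘(ℝ, Model n).tangent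
      (fun q => (⟨q, T q⟩ : TangentBundle 𝓘(ℝ, Model n) (HopfManifold (Model n) lam))) p :=
    T.contMDiff.mdifferentiableAt (by simp)
  have hXe : (X.1 : ∀ q, TangentSpace 𝓘(ℝ, Model n) q) = (fun q => (coeff X.1 q).re) • ⇑T :=
    funext fun q => eq_coeff_smul X q
  have hYe : (Y.1 : ∀ q, TangentSpace 𝓘(ℝ, Model n) q) = (fun q => (coeff Y.1 q).re) • ⇑T :=
    funext fun q => eq_coeff_smul Y q
  have : IsManifold 𝓘(ℝ, Model n) (minSmoothness ℝ 2) (HopfManifold (Model n) lam) := by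
    rw [minSmoothness_of_isRCLikeNormedField]; infer_instance
  have hb : mlieBracket 𝓘(ℝ, Model n) X.1 Y.1 p =
      ((coeff X.1 p).re * d' (T p) - (coeff Y.1 p).re * d (T p)) • T p := by
    rw [hXe, hYe, mlieBracket_smul_left hd.mdifferentiableAt hTd,
      mlieBracket_smul_right hd₂.mdifferentiableAt hTd, mlieBracket_self]
    have e1 : (mvfderiv 𝓘(ℝ, Model n) (fun q => (coeff Y.1 q).re) p : Model n →L[ℝ] ℝ) = d' :=
      hd₂.mfderiv
    have e2 : (mvfderiv 𝓘(ℝ, Model n) (fun q => (coeff X.1 q).re) p : Model n →L[ℝ] ℝ) = d :=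
      hd.mfderiv
    subst e1 e2
    exact bracket_smul_smul (W := Model n) (T p) _ _ _ _
  have := coeff_of_eq_smul (X := (affineFlow n lam).bracket X Y) hb
  rw [this]
  push_cast
  ring

/-- With X_i = c_i T and a = α(T), the differential is c₀ T(c₁ a) - c₁ T(c₀ a) - (c₀ Tc₁ - c₁ Tc₀)
a, which is 0 by the product rule. -/
theorem cocycles_one_eq_top : (affineFlow n lam).cocycles 1 = ⊤ := by
  refine eq_top_iff.2 fun α _ => ?_
  simp only [Foliation.cocycles, Submodule.mem_iInf, LinearMap.mem_ker]
  intro X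
  set a := (affineFlow n lam).eval ![reebTangent n lam] α with ha
  set T := reebField n lam with hT
  have h1 : (affineFlow n lam).leafD X α =
      fieldDeriv (X 0).1 (coeff (X 1).1 * a) - fieldDeriv (X 1).1 (coeff (X 0).1 * a) -
        coeff ((affineFlow n lam).bracket (X 0) (X 1)).1 * a := by
    have e0 := eval_one_eq (fun k : Fin 1 => X ((0 : Fin 2).succAbove k)) α
    have e1 := eval_one_eq (fun k : Fin 1 => X ((1 : Fin 2).succAbove k)) α
    have e2 := eval_one_eq (Fin.cons ((affineFlow n lam).bracket (X 0) (X 1))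
      fun k : Fin 0 => X ((1 : Fin 2).succAbove ((0 : Fin 1).succAbove k))) α
    have h0 : ¬ ((0 : Fin 1).castSucc < (0 : Fin 2)) := by decide
    have h1 : (0 : Fin 1).castSucc < (1 : Fin 2) := by decide
    change ((∑ i : Fin 2, (-1 : ℂ) ^ (i : ℕ) • (fieldDeriv (X i).1 ∘ₗ
        (affineFlow n lam).eval fun k : Fin 1 => X (i.succAbove k))) +
      ∑ j : Fin 2, ∑ i : Fin 1, if i.castSucc < j then (-1 : ℂ) ^ ((i : ℕ) + (j : ℕ)) •
        (affineFlow n lam).eval (Fin.cons ((affineFlow n lam).bracket (X i.castSucc) (X j))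
          fun k : Fin 0 => X (j.succAbove (i.succAbove k))) else 0) α = _
    -- In the bracket sum only the pair i = 0 < j = 1 remains, with sign -1.
    rw [Fin.sum_univ_two, Fin.sum_univ_two, Fin.sum_univ_one, Fin.sum_univ_one, if_neg h0, if_pos h1]
    simp only [LinearMap.add_apply, LinearMap.smul_apply, LinearMap.comp_apply]
    rw [e0, e1]
    refine (congrArg (fun f => _ + (_ + (-1 : ℂ) ^ 1 • f)) e2).trans ?_
    simp only [Fin.cons_zero, Fin.val_zero, Fin.val_one, pow_zero, pow_one, one_smul, neg_smul,
      LinearMap.zero_apply, zero_add, ← ha]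
    rw [← sub_eq_add_neg, ← sub_eq_add_neg]
    rfl
  rw [h1, coeff_bracket, fieldDeriv_eq (X 0), fieldDeriv_eq (X 1), fieldDeriv_mul, fieldDeriv_mul]
  ring

/-- A function, as a foliated form of degree 0. -/
def functionForm (f : SmoothFun 𝓘(ℝ, Model n) (HopfManifold (Model n) lam)) :
    (affineFlow n lam).LeafForm 0 :=
  ⟨fun p => AlternatingMap.constOfIsEmpty ℝ ((affineFlow n lam).tangent p) (Fin 0) (f p),
    fun _ => f.2⟩

theorem leafD_zero (X : Fin 1 → (affineFlow n lam).fields) (α : (affineFlow n lam).LeafForm 0) :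
    (affineFlow n lam).leafD X α = fieldDeriv (X 0).1 ((affineFlow n lam).eval ![] α) := by
  change ((∑ i : Fin 1, (-1 : ℂ) ^ (i : ℕ) • (fieldDeriv (X i).1 ∘ₗ
        (affineFlow n lam).eval fun k : Fin 0 => X (i.succAbove k))) + 0) α = _
  rw [Fin.sum_univ_one, add_zero]
  simp only [Fin.val_zero, pow_zero, one_smul, LinearMap.comp_apply]
  exact congrArg (fun Y => fieldDeriv (X 0).1 ((affineFlow n lam).eval Y α)) (Subsingleton.elim _ _)

theorem mem_coboundaries_one {β : (affineFlow n lam).LeafForm 1} :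
    β ∈ (affineFlow n lam).coboundaries 1 ↔
      (affineFlow n lam).eval ![reebTangent n lam] β ∈
        LinearMap.range (fieldDeriv (reebField n lam)) := by
  constructor
  · rintro ⟨α, hα⟩
    exact ⟨(affineFlow n lam).eval ![] α, ((hα ![reebTangent n lam]).trans (leafD_zero _ α)).symm⟩
  · rintro ⟨f, hf⟩
    refine ⟨functionForm f, fun X => ?_⟩
    rw [leafD_zero, fieldDeriv_eq, eval_one_eq, ← hf]
    rfl

/-- A continuous right inverse sends g to the form with value g / `coeff X` on T; the coefficient is
invertible because X has no zeros. -/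
theorem isQuotientMap_eval (X : (affineFlow n lam).fields) (hX : ∀ p, X.1 p ≠ 0) :
    IsQuotientMap ((affineFlow n lam).eval ![X] ∘ₗ ((affineFlow n lam).cocycles 1).subtype) := by
  let u : SmoothFun 𝓘(ℝ, Model n) (HopfManifold (Model n) lam) :=
    ⟨fun p => (coeff X.1 p)⁻¹, fun p =>
      ((contDiffAt_inv ℝ (coeff_ne_zero hX p)).contMDiffAt).comp p ((coeff X.1).2 p)⟩
  have hu : coeff X.1 * u = 1 := SmoothFun.ext fun p => mul_inv_cancel₀ (coeff_ne_zero hX p)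
  have h1 : Continuous fun g : SmoothFun 𝓘(ℝ, Model n) (HopfManifold (Model n) lam) =>
      (⟨reebForm (g * u), by rw [cocycles_one_eq_top]; trivial⟩ : (affineFlow n lam).cocycles 1) :=
    (continuous_reebForm.comp (SmoothFun.continuous_mul' u)).subtype_mk _
  refine IsQuotientMap.of_inverse h1 ((continuous_eval_form _).comp continuous_subtype_val)
    fun g => ?_
  refine (eval_reebForm _ _).trans ?_
  change coeff X.1 * (g * u) = g
  linear_combination g * hu

theorem range_fieldDeriv {X : (affineFlow n lam).fields} {g u} (hu : coeff X.1 * u = 1) :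
    coeff X.1 * g ∈ LinearMap.range (fieldDeriv X.1) ↔
      g ∈ LinearMap.range (fieldDeriv (reebField n lam)) := by
  simp only [LinearMap.mem_range, fieldDeriv_eq]
  refine exists_congr fun f => ⟨fun h => ?_, fun h => by rw [h]⟩
  linear_combination u * h + (g - fieldDeriv (reebField n lam) f) * hu

/-- The first cohomology, as the space of obstructions to solving `r ∂f/∂t = g`. -/
theorem exists_cohomology_one_equiv {C : Type*} [AddCommGroup C] [Module ℂ C] [TopologicalSpace C]
    (π : SmoothFun 𝓘(ℝ, Model n) (HopfManifold (Model n) lam) →ₗ[ℂ] C) (hπ : IsQuotientMap π)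
    (hker : LinearMap.ker π = LinearMap.range (fieldDeriv (reebField n lam))) :
    Nonempty ((affineFlow n lam).Cohomology 1 ≃L[ℂ] C) := by
  refine ⟨(exists_quotient_equiv (π ∘ₗ (affineFlow n lam).eval ![reebTangent n lam] ∘ₗ
    ((affineFlow n lam).cocycles 1).subtype)
    (hπ.comp (isQuotientMap_eval (reebTangent n lam) reebField_ne_zero)) _ ?_).choose⟩
  ext α
  rw [LinearMap.mem_ker, Submodule.submoduleOf, Submodule.mem_comap, Submodule.subtype_apply, mem_coboundaries_one, ← hker]
  rfl

/-- Since X is an invertible multiple c of T, α(X) = c α(T) lies in the image of X exactly when α(T)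
lies in the image of T, that is, when α is a coboundary. -/
theorem exists_cohomology_one_equiv_obstructions (X : (affineFlow n lam).fields)
    (hX : ∀ p, X.1 p ≠ 0) :
    ∃ e : (affineFlow n lam).Cohomology 1 ≃L[ℂ]
        (SmoothFun 𝓘(ℝ, Model n) (HopfManifold (Model n) lam) ⧸ LinearMap.range (fieldDeriv X.1)),
      ∀ α : (affineFlow n lam).cocycles 1, e ((affineFlow n lam).cohClass α) =
        Submodule.Quotient.mk ((affineFlow n lam).eval ![X] α.1) := by
  have hq : IsQuotientMap (LinearMap.range (fieldDeriv X.1)).mkQ := isQuotientMap_quot_mk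
  refine exists_quotient_equiv ((LinearMap.range (fieldDeriv X.1)).mkQ ∘ₗ
    (affineFlow n lam).eval ![X] ∘ₗ ((affineFlow n lam).cocycles 1).subtype)
    (hq.comp (isQuotientMap_eval X hX)) _ ?_
  let u : SmoothFun 𝓘(ℝ, Model n) (HopfManifold (Model n) lam) :=
    ⟨fun p => (coeff X.1 p)⁻¹, fun p =>
      ((contDiffAt_inv ℝ (coeff_ne_zero hX p)).contMDiffAt).comp p ((coeff X.1).2 p)⟩
  have hu : coeff X.1 * u = 1 := SmoothFun.ext fun p => mul_inv_cancel₀ (coeff_ne_zero hX p)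
  ext α
  rw [LinearMap.mem_ker, Submodule.submoduleOf, Submodule.mem_comap, Submodule.subtype_apply, mem_coboundaries_one, ← range_fieldDeriv hu]
  refine (Submodule.Quotient.mk_eq_zero _).trans ?_
  have := eval_one_eq ![X] α.1
  rw [LinearMap.comp_apply, Submodule.subtype_apply, this]
  rfl

theorem subsingleton_cohomology {l : ℕ} (hl : 2 ≤ l) :
    Subsingleton ((affineFlow n lam).Cohomology l) := by
  refine ⟨fun a b => ?_⟩
  obtain ⟨a, rfl⟩ := Submodule.Quotient.mk_surjective _ a
  obtain ⟨b, rfl⟩ := Submodule.Quotient.mk_surjective _ b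
  exact congrArg _ (Subtype.ext ((eval_eq_zero_of_two_le hl a.1).trans
    (eval_eq_zero_of_two_le hl b.1).symm))

/-! ### Degree 0: functions constant along the leaves -/

theorem tendsto_lift (f : SmoothFun 𝓘(ℝ, Model n) (HopfManifold (Model n) lam))
    (z : EuclideanSpace ℝ (Fin n)) {t : ℝ} (ht : t ≠ 0) :
    Tendsto (fun k : ℕ => lift f ((lam : ℝ) ^ k • z, t)) atTop (𝓝 (lift f (0, t))) := by
  have hne : ((0, t) : Model n) ≠ 0 := fun h => ht (congrArg Prod.snd h)
  have h1 : Tendsto (fun k : ℕ => (((lam : ℝ) ^ k • z, t) : Model n)) atTop (𝓝 (0, t)) := by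
    have h2 := (tendsto_pow_atTop_nhds_zero_of_lt_one lam.2.1.le lam.2.2).smul_const z
    rw [zero_smul] at h2
    exact h2.prodMk_nhds tendsto_const_nhds
  exact ((contDiffOn_lift f).continuousOn.continuousAt
    (isOpen_compl_singleton.mem_nhds hne)).tendsto.comp h1

theorem lift_smul_fst (f : SmoothFun 𝓘(ℝ, Model n) (HopfManifold (Model n) lam)) (k : ℕ)
    (z : EuclideanSpace ℝ (Fin n)) (t : ℝ) :
    lift f ((lam : ℝ) ^ k • z, (lam : ℝ) ^ k * t) = lift f (z, t) :=
  lift_pow_smul f k (z, t)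

/-- A smooth function which is constant along the leaves is constant. -/
theorem eq_of_fieldDeriv_eq_zero {f : SmoothFun 𝓘(ℝ, Model n) (HopfManifold (Model n) lam)}
    (hf : fieldDeriv (reebField n lam) f = 0) {z₀ : EuclideanSpace ℝ (Fin n)} (hz₀ : z₀ ≠ 0)
    {v : Model n} (hv : v ≠ 0) : lift f v = lift f (0, 1) := by
  have hne : ∀ {z : EuclideanSpace ℝ (Fin n)}, z ≠ 0 → ∀ t : ℝ, ((z, t) : Model n) ≠ 0 :=
    fun hz t h => hz (congrArg Prod.fst h)
  have h1 : ∀ z : EuclideanSpace ℝ (Fin n), z ≠ 0 → ∀ s t, lift f (z, s) = lift f (z, t) := by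
    intro z hz s t
    refine is_const_of_deriv_eq_zero (f := fun s => lift f (z, s))
      (fun s => (hasDerivAt_lift f (hne hz s)).differentiableAt) (fun s => ?_) s t
    have h := lift_reebField f (hne hz s) (hasDerivAt_lift f (hne hz s))
    rw [hf, lift_of_ne _ (hne hz s), SmoothFun.zero_apply, eq_comm, mul_eq_zero] at h
    rw [(hasDerivAt_lift f (hne hz s)).deriv]
    exact h.resolve_left (by exact_mod_cast (radius_pos (hne hz s)).ne')
  have hl : ∀ k : ℕ, (lam : ℝ) ^ k ≠ 0 := fun k => pow_ne_zero _ lam.2.1.ne'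
  have h2 : ∀ z : EuclideanSpace ℝ (Fin n), z ≠ 0 → ∀ t, lift f (z, t) = lift f (0, 1) := by
    intro z hz t
    -- By invariance and constancy along lines, f(z, t) = f(λᵏz, λᵏt) = f(λᵏz, 1) for every k: a
    -- constant sequence with limit f(0, 1).
    refine tendsto_nhds_unique ?_ (tendsto_lift f z one_ne_zero)
    refine tendsto_const_nhds.congr fun k => ?_
    rw [← lift_smul_fst f k, h1 _ (smul_ne_zero (hl k) hz)]
  obtain ⟨z, t⟩ := v
  by_cases hz : z = 0
  · subst hz
    have ht : t ≠ 0 := fun h => hv (by rw [h]; rfl)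
    -- Points on the axis are reached as limits of points λᵏ z₀ off the axis; this is where a
    -- nonzero z₀ is needed.
    refine tendsto_nhds_unique (tendsto_lift f z₀ ht) ?_
    exact tendsto_const_nhds.congr fun k => (h2 _ (smul_ne_zero (hl k) hz₀) t).symm
  · exact h2 z hz t

/-- Evaluation at one point, with the constants as a continuous right inverse. Its kernel is 0
because cocycles are constant, and 0 is the space of coboundaries in degree 0. -/
theorem exists_cohomology_zero_equiv {z₀ : EuclideanSpace ℝ (Fin n)} (hz₀ : z₀ ≠ 0) :
    ∃ e : (affineFlow n lam).Cohomology 0 ≃L[ℂ] ℂ,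
      ∀ (f : (affineFlow n lam).cocycles 0) (p : HopfManifold (Model n) lam),
        (affineFlow n lam).eval ![] f.1 p = e ((affineFlow n lam).cohClass f) := by
  have hne : ((0, 1) : Model n) ≠ 0 := by simp
  let p₀ : HopfManifold (Model n) lam := proj lam ⟨(0, 1), hne⟩
  let π : (affineFlow n lam).cocycles 0 →ₗ[ℂ] ℂ :=
    { toFun := fun f => (affineFlow n lam).eval ![] f.1 p₀
      map_add' := fun _ _ => rfl
      map_smul' := fun _ _ => rfl }
  have hconst : ∀ (f : (affineFlow n lam).cocycles 0) (p : HopfManifold (Model n) lam),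
      (affineFlow n lam).eval ![] f.1 p = π f := by
    intro f p
    have h1 := f.2
    simp only [Foliation.cocycles, Submodule.mem_iInf, LinearMap.mem_ker] at h1
    have h2 := h1 ![reebTangent n lam]
    rw [leafD_zero] at h2
    obtain ⟨y, rfl⟩ := proj_surjective p
    have h3 := eq_of_fieldDeriv_eq_zero h2 hz₀ y.2
    rw [lift_coe, lift_of_ne _ hne] at h3
    exact h3
  have hcoc : ∀ c : ℂ, functionForm (c • 1) ∈ (affineFlow n lam).cocycles 0 := by
    intro c
    simp only [Foliation.cocycles, Submodule.mem_iInf, LinearMap.mem_ker]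
    intro X
    rw [leafD_zero]
    refine SmoothFun.ext fun p => ?_
    have h := (hasMFDerivAt_const (I := 𝓘(ℝ, Model n)) (I' := 𝓘(ℝ, ℂ)) (c * 1) p).mfderiv
    exact congrArg (fun L : Model n →L[ℝ] ℂ => L ((X 0).1 p)) h
  have hq : IsQuotientMap π := by
    refine IsQuotientMap.of_inverse (f := fun c : ℂ =>
      (⟨functionForm (c • 1), hcoc c⟩ : (affineFlow n lam).cocycles 0)) ?_ ?_ fun c => ?_
    · refine Continuous.subtype_mk (continuous_iInf_rng.2 fun X => continuous_induced_rng.2 ?_) _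
      exact SmoothFun.continuous_smul_const continuous_id 1
    · exact (SmoothFun.continuous_eval p₀).comp ((continuous_eval_form _).comp continuous_subtype_val)
    · exact mul_one c
  obtain ⟨e, he⟩ := exists_quotient_equiv π hq
    (((affineFlow n lam).coboundaries 0).submoduleOf ((affineFlow n lam).cocycles 0)) (by
      ext f
      rw [LinearMap.mem_ker, Submodule.submoduleOf, Submodule.mem_comap, Submodule.subtype_apply]
      constructor
      · intro h
        refine (Submodule.mem_bot ℂ).2 (Subtype.ext (funext fun p => AlternatingMap.ext fun v => ?_))
        have h1 := hconst f p
        rw [h] at h1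
        rw [Subsingleton.elim v fun i => (affineFlow n lam).fieldAt (![] i) p]
        exact h1
      · intro h
        have h0 : f.1 = 0 := (Submodule.mem_bot ℂ).1 h
        change (affineFlow n lam).eval ![] f.1 p₀ = 0
        rw [h0, map_zero]
        rfl)
  exact ⟨e, fun f p => (hconst f p).trans (he f).symm⟩

end Reeb

/-! ### Invariant primitives along the leaves: periods, correction series, jump -/

namespace Reeb

variable {n : ℕ} {lam : Set.Ioo (0 : ℝ) 1} {X : Type*} [TopologicalSpace X]

/-- The substitution s = α + (β - α) σ replaces the variable endpoints by [0, 1]. The hypothesis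
`hne` keeps the whole segment away from the origin. -/
theorem SmoothFamily.integral_segment {V' : Type} [NormedAddCommGroup V'] [NormedSpace ℝ V']
    {Φ : X → Model n → ℂ} (hΦ : SmoothFamily Φ (univ ×ˢ {0}ᶜ))
    {ζ : V' → EuclideanSpace ℝ (Fin n)} {α β : V' → ℝ} (hζ : ContDiff ℝ ∞ ζ) (hα : ContDiff ℝ ∞ α)
    (hβ : ContDiff ℝ ∞ β) {U : Set V'} (hU : IsOpen U)
    (hne : ∀ v ∈ U, ∀ σ ∈ Icc (0 : ℝ) 1, ((ζ v, α v + (β v - α v) * σ) : Model n) ≠ 0) :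
    SmoothFamily (fun ξ v => ∫ s in α v..β v, Φ ξ (ζ v, s)) (univ ×ˢ U) := by
  let S : Set ((X × ℝ) × V') := {q | ((ζ q.2, α q.2 + (β q.2 - α q.2) * q.1.2) : Model n) ≠ 0}
  have hS : IsOpen S := by
    refine isOpen_compl_singleton.preimage (X := (X × ℝ) × V')
      (f := fun q => ((ζ q.2, α q.2 + (β q.2 - α q.2) * q.1.2) : Model n)) ?_
    have h1 := hζ.continuous
    have h2 := hα.continuous
    have h3 := hβ.continuous
    fun_prop
  have hcd : ∀ {W : Type} [NormedAddCommGroup W] [NormedSpace ℝ W] {f : V' → W},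
      ContDiff ℝ ∞ f → SmoothFamily (fun (_ : X × ℝ) => f) S := fun hf =>
    SmoothFamily.of_contDiffOn isOpen_univ hf.contDiffOn fun _ _ => mem_univ _
  have h1 : SmoothFamily (fun (p : X × ℝ) (v : V') => α v + p.2 • (β v - α v)) S :=
    (hcd hα).add hS ((SmoothFamily.of_param hS continuous_snd).smul hS (hcd (hβ.sub hα)))
  have h2 : SmoothFamily (fun (p : X × ℝ) (v : V') =>
      ((ζ v, α v + (β v - α v) * p.2) : Model n)) S := by
    refine (((hcd hζ).clm_apply hS (ContinuousLinearMap.inl ℝ _ ℝ)).add hS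
      (h1.clm_apply hS (ContinuousLinearMap.inr ℝ _ ℝ))).congr hS fun q _ => ?_
    simp [mul_comm]
  have h3 := (hΦ.comp hS (continuous_fst (X := X) (Y := ℝ)) h2 fun q hq =>
    ⟨mem_univ _, hq⟩).intervalIntegral zero_le_one (isOpen_univ.prod hU)
      fun p hp s hs => hne p.2 hp.2 s hs
  have hUo : IsOpen ((univ : Set X) ×ˢ U) := isOpen_univ.prod hU
  have h4 : SmoothFamily (fun (_ : X) v => β v - α v) (univ ×ˢ U) :=
    SmoothFamily.of_contDiffOn isOpen_univ (hβ.sub hα).contDiffOn fun _ _ => mem_univ _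
  refine (h4.smul hUo h3).congr hUo fun q _ => ?_
  rw [intervalIntegral.smul_integral_comp_add_mul (fun s => Φ q.1 (ζ q.2, s))]
  simp

/-- The function `h` on `V \ {0}` such that `∂f/∂t = h` is equivalent to `r ∂f/∂t = g`. -/
def density (g : SmoothFun 𝓘(ℝ, Model n) (HopfManifold (Model n) lam)) (v : Model n) : ℂ :=
  ((radius v)⁻¹ : ℝ) * lift g v

theorem radius_mul_density (g : SmoothFun 𝓘(ℝ, Model n) (HopfManifold (Model n) lam)) {v : Model n}
    (hv : v ≠ 0) : radius v * density g v = lift g v := by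
  have : (radius v : ℂ) ≠ 0 := by exact_mod_cast (radius_pos hv).ne'
  rw [density, Complex.ofReal_inv, mul_inv_cancel_left₀ this]

/-- A function invariant under γ, divided by r, has degree -1. -/
theorem density_smul (g : SmoothFun 𝓘(ℝ, Model n) (HopfManifold (Model n) lam)) (v : Model n) :
    lam * density g ((lam : ℝ) • v) = density g v := by
  have : (lam : ℂ) ≠ 0 := by exact_mod_cast lam.2.1.ne'
  rw [density, density, lift_smul, radius_smul, mul_inv]
  push_cast
  field_simp

theorem density_family {L : X → SmoothFun 𝓘(ℝ, Model n) (HopfManifold (Model n) lam)}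
    (hL : Continuous L) : SmoothFamily (fun ξ v => density (L ξ) v) (univ ×ˢ {0}ᶜ) := by
  have h : ContDiffOn ℝ ∞ (fun v : Model n => (((radius v)⁻¹ : ℝ) : ℂ)) {0}ᶜ :=
    Complex.ofRealCLM.contDiff.comp_contDiffOn
      (contDiffOn_radius.inv fun v hv => (radius_pos hv).ne')
  exact (SmoothFamily.of_contDiffOn isOpen_compl_singleton h fun _ hp => hp.2).mul
    isOpen_univ_prod_compl (lift_family_comp hL)

theorem continuousOn_density (g : SmoothFun 𝓘(ℝ, Model n) (HopfManifold (Model n) lam)) :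
    ContinuousOn (density g) {0}ᶜ := by
  refine ContinuousOn.mul ?_ (contDiffOn_lift g).continuousOn
  exact Complex.continuous_ofReal.comp_continuousOn
    (contDiffOn_radius.continuousOn.inv₀ fun v hv => (radius_pos hv).ne')

theorem intervalIntegrable_density (g : SmoothFun 𝓘(ℝ, Model n) (HopfManifold (Model n) lam))
    {z : EuclideanSpace ℝ (Fin n)} {a b : ℝ} (h : ∀ s ∈ uIcc a b, ((z, s) : Model n) ≠ 0) :
    IntervalIntegrable (fun s => density g (z, s)) MeasureTheory.volume a b :=
  ((continuousOn_density g).comp (Continuous.prodMk_right z).continuousOn h).intervalIntegrable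

theorem integral_density_eq_sub (g : SmoothFun 𝓘(ℝ, Model n) (HopfManifold (Model n) lam))
    {z : EuclideanSpace ℝ (Fin n)} {a b : ℝ} (h : ∀ s ∈ uIcc a b, ((z, s) : Model n) ≠ 0)
    {F : ℝ → ℂ} (hF : ∀ s ∈ uIcc a b, HasDerivAt F (density g (z, s)) s) :
    ∫ s in a..b, density g (z, s) = F b - F a :=
  intervalIntegral.integral_eq_sub_of_hasDerivAt hF (intervalIntegrable_density g h)

/-- Degree -1 makes the form h ds invariant under γ, so rescaling z and the endpoints changes
nothing. -/
theorem integral_density_smul (g : SmoothFun 𝓘(ℝ, Model n) (HopfManifold (Model n) lam))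
    (z : EuclideanSpace ℝ (Fin n)) (a b : ℝ) :
    ∫ s in (lam : ℝ) * a..lam * b, density g ((lam : ℝ) • z, s) = ∫ s in a..b, density g (z, s) := by
  have h := intervalIntegral.smul_integral_comp_mul_left
    (fun s => density g ((lam : ℝ) • z, s)) (a := a) (b := b) (lam : ℝ)
  rw [← h, ← intervalIntegral.integral_smul]
  refine intervalIntegral.integral_congr fun s _ => ?_
  rw [← density_smul g (z, s), Complex.real_smul]
  rfl

theorem ne_of_mem_uIcc {z : EuclideanSpace ℝ (Fin n)} {a b : ℝ} (h : 0 < a * b) :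
    ∀ s ∈ uIcc a b, ((z, s) : Model n) ≠ 0 := by
  intro s hs h0
  have hs0 : s = 0 := congrArg Prod.snd h0
  rw [hs0, mem_uIcc] at hs
  rcases hs with hs | hs
  · nlinarith
  · nlinarith

theorem pair_ne_zero {z : EuclideanSpace ℝ (Fin n)} (hz : z ≠ 0) (t : ℝ) : ((z, t) : Model n) ≠ 0 :=
  fun h => hz (congrArg Prod.fst h)

/-- The integral of the density over a period of the flow near the closed leaf through `(0, a)`. -/
def loop (a : ℝ) (g : SmoothFun 𝓘(ℝ, Model n) (HopfManifold (Model n) lam))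
    (z : EuclideanSpace ℝ (Fin n)) : ℂ := ∫ s in a..a / lam, density g (z, s)

theorem mul_div_lam_pos {a : ℝ} (ha : a ≠ 0) : 0 < a * (a / lam) := by
  have := lam.2.1
  rw [mul_div_assoc', ← sq]
  positivity

/-- The segment from a to a/λ stays on one side of 0, so the integral is smooth even across z = 0.
Hadamard's lemma is applied at that point. -/
theorem loop_family {a : ℝ} (ha : a ≠ 0)
    {L : X → SmoothFun 𝓘(ℝ, Model n) (HopfManifold (Model n) lam)} (hL : Continuous L) :
    SmoothFamily (fun ξ z => loop a (L ξ) z) univ := by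
  refine (SmoothFamily.integral_segment (density_family hL) contDiff_id contDiff_const
    contDiff_const isOpen_univ fun z _ σ hσ => ?_).mono fun p _ => ⟨mem_univ _, mem_univ _⟩
  refine fun h => ha ?_
  have h1 : a + (a / lam - a) * σ = 0 := congrArg Prod.snd h
  have h2 : 0 < 1 / (lam : ℝ) - 1 := by
    rw [sub_pos, lt_div_iff₀ lam.2.1]; linarith [lam.2.2]
  -- The point of the segment is a times a number at least 1, since 1/λ > 1.
  have h3 : a * (1 + (1 / lam - 1) * σ) = 0 := Eq.trans (by ring) h1
  have h4 : 0 < 1 + (1 / (lam : ℝ) - 1) * σ := by have := mul_nonneg h2.le hσ.1; linarith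
  exact (mul_eq_zero.1 h3).resolve_right h4.ne'

theorem continuous_loop {a : ℝ} (ha : a ≠ 0) (z : EuclideanSpace ℝ (Fin n)) :
    Continuous fun g : SmoothFun 𝓘(ℝ, Model n) (HopfManifold (Model n) lam) => loop a g z := by
  have h := continuousOn_univ.1 (loop_family (n := n) (lam := lam) ha continuous_id).continuousOn
  exact h.comp (f := fun g : SmoothFun 𝓘(ℝ, Model n) (HopfManifold (Model n) lam) => (g, z))
    (continuous_id.prodMk continuous_const)

/-- The correction term which makes the primitive from `a` invariant. -/
def loopSum (a : ℝ) (g : SmoothFun 𝓘(ℝ, Model n) (HopfManifold (Model n) lam))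
    (z : EuclideanSpace ℝ (Fin n)) : ℂ := ∑' k : ℕ, (loop a g ((lam : ℝ) ^ k • z) - loop a g 0)

theorem summable_loop {a : ℝ} (ha : a ≠ 0)
    (g : SmoothFun 𝓘(ℝ, Model n) (HopfManifold (Model n) lam)) (z : EuclideanSpace ℝ (Fin n)) :
    Summable fun k : ℕ => loop a g ((lam : ℝ) ^ k • z) - loop a g 0 :=
  ((loop_family ha continuous_id).tsum_sub lam.2).2 g z

theorem loopSum_family {a : ℝ} (ha : a ≠ 0)
    {L : X → SmoothFun 𝓘(ℝ, Model n) (HopfManifold (Model n) lam)} (hL : Continuous L) :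
    SmoothFamily (fun ξ z => loopSum a (L ξ) z) univ := ((loop_family ha hL).tsum_sub lam.2).1

/-- Splitting off the first term: when the period vanishes, the series solves u(z) - u(λz) = `loop a
g z`. -/
theorem loopSum_eq {a : ℝ} (ha : a ≠ 0)
    {g : SmoothFun 𝓘(ℝ, Model n) (HopfManifold (Model n) lam)} (hg : loop a g 0 = 0)
    (z : EuclideanSpace ℝ (Fin n)) : loopSum a g z = loop a g z + loopSum a g ((lam : ℝ) • z) := by
  rw [loopSum, (summable_loop ha g z).tsum_eq_zero_add, loopSum, pow_zero, one_smul, hg, sub_zero]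
  simp only [pow_succ, mul_smul]

/-- The primitive of the density from `t = a`, with the correction that makes it invariant. -/
def primitive (a : ℝ) (g : SmoothFun 𝓘(ℝ, Model n) (HopfManifold (Model n) lam))
    (v : Model n) : ℂ := (∫ s in a..v.2, density g (v.1, s)) - loopSum a g v.1

/-- The condition on (z, t) under which integration from (z, a) avoids the origin. It excludes only
the points of the axis with a t ≤ 0, so the domains for a = 1 and a = -1 cover everything except the
origin. -/
theorem segment_ne {a t : ℝ} {z : EuclideanSpace ℝ (Fin n)} (h : z ≠ 0 ∨ 0 < a * t) :
    ∀ s ∈ uIcc a t, ((z, s) : Model n) ≠ 0 := by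
  rcases h with h | h
  · exact fun s _ => pair_ne_zero h s
  · exact ne_of_mem_uIcc h

theorem isOpen_primitive_domain (a : ℝ) : IsOpen {v : Model n | v.1 ≠ 0 ∨ 0 < a * v.2} :=
  (isOpen_compl_singleton.preimage continuous_fst).union
    (isOpen_lt continuous_const (continuous_const.mul continuous_snd))

theorem primitive_contDiffOn {a : ℝ} (ha : a ≠ 0)
    (g : SmoothFun 𝓘(ℝ, Model n) (HopfManifold (Model n) lam)) :
    ContDiffOn ℝ ∞ (primitive a g) {v : Model n | v.1 ≠ 0 ∨ 0 < a * v.2} := by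
  have hU := isOpen_primitive_domain (n := n) a
  have h1 := SmoothFamily.integral_segment (X := Unit) (density_family (L := fun _ => g)
    continuous_const) (ζ := fun v : Model n => v.1) (α := fun _ => a) (β := fun v => v.2)
    contDiff_fst contDiff_const contDiff_snd hU fun v hv σ hσ => by
      refine segment_ne hv _ ?_
      rw [← segment_eq_uIcc]
      exact ⟨1 - σ, σ, by linarith [hσ.2], hσ.1, by ring, by simp only [smul_eq_mul]; ring⟩
  have h2 : SmoothFamily (fun (_ : Unit) (v : Model n) => loopSum a g v.1)
      (univ ×ˢ {v : Model n | v.1 ≠ 0 ∨ 0 < a * v.2}) :=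
    (loopSum_family ha (continuous_const (y := g))).comp (isOpen_univ.prod hU) continuous_id
      (SmoothFamily.of_contDiffOn isOpen_univ contDiff_fst.contDiffOn fun _ _ => mem_univ _)
      fun _ _ => mem_univ _
  intro v hv
  exact ((h1.sub (isOpen_univ.prod hU) h2).contDiffAt (isOpen_univ.prod hU) (p := ((), v))
    ⟨mem_univ _, hv⟩).contDiffWithinAt

theorem hasDerivAt_primitive {a : ℝ}
    (g : SmoothFun 𝓘(ℝ, Model n) (HopfManifold (Model n) lam))
    {z : EuclideanSpace ℝ (Fin n)} {t : ℝ} (h : z ≠ 0 ∨ 0 < a * t) :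
    HasDerivAt (fun s => primitive a g (z, s)) (density g (z, t)) t := by
  have hc : ∀ᶠ s in 𝓝 t, ContinuousAt (fun s => density g (z, s)) s := by
    have h1 : ∀ᶠ s in 𝓝 t, ((z, s) : Model n) ≠ 0 :=
      (Continuous.prodMk_right z).continuousAt.eventually
        (isOpen_compl_singleton.mem_nhds (segment_ne h t right_mem_uIcc))
    filter_upwards [h1] with s hs
    exact ((continuousOn_density g).continuousAt (isOpen_compl_singleton.mem_nhds hs)).comp
      (Continuous.prodMk_right z).continuousAt
  obtain ⟨U, hU, hUo, htU⟩ := eventually_nhds_iff.1 hc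
  have hm : StronglyMeasurableAtFilter (fun s => density g (z, s)) (𝓝 t) MeasureTheory.volume :=
    ContinuousOn.stronglyMeasurableAtFilter hUo
      (fun s hs => (hU s hs).continuousWithinAt) t htU
  exact (intervalIntegral.integral_hasDerivAt_right
    (intervalIntegrable_density g (segment_ne h)) hm hc.self_of_nhds).sub_const (loopSum a g z)

/-- Applying γ moves the lower endpoint from a to a/λ, which costs `loop a g z`; `loopSum_eq` says
that the correction changes by the same amount. -/
theorem primitive_smul {a : ℝ} (ha : a ≠ 0)
    {g : SmoothFun 𝓘(ℝ, Model n) (HopfManifold (Model n) lam)} (hg : loop a g 0 = 0)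
    {v : Model n} (hv : v.1 ≠ 0 ∨ 0 < a * v.2) :
    primitive a g ((lam : ℝ) • v) = primitive a g v := by
  have hl := lam.2.1
  have h1 : ∫ s in a..lam * v.2, density g ((lam : ℝ) • v.1, s) =
      (∫ s in a..v.2, density g (v.1, s)) - loop a g v.1 := by
    have h2 := integral_density_smul g v.1 (a / lam) v.2
    rw [mul_div_cancel₀ _ hl.ne'] at h2
    rw [h2, loop, ← intervalIntegral.integral_interval_sub_left (a := a)]
    · exact intervalIntegrable_density g (segment_ne hv)
    · exact intervalIntegrable_density g (ne_of_mem_uIcc (mul_div_lam_pos ha))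
  simp only [primitive, Prod.smul_fst, Prod.smul_snd, smul_eq_mul]
  rw [h1, loopSum_eq ha hg v.1]
  ring

/-- The difference of the two primitives. -/
def jump (g : SmoothFun 𝓘(ℝ, Model n) (HopfManifold (Model n) lam))
    (z : EuclideanSpace ℝ (Fin n)) : ℂ :=
  (∫ s in (-1 : ℝ)..1, density g (z, s)) - loopSum (-1) g z + loopSum 1 g z

/-- Both primitives have the same derivative in t, so their difference depends on z alone; the
definition of `jump` is this difference with t eliminated. -/
theorem jump_eq (g : SmoothFun 𝓘(ℝ, Model n) (HopfManifold (Model n) lam))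
    {z : EuclideanSpace ℝ (Fin n)} (hz : z ≠ 0) (t : ℝ) :
    jump g z = primitive (-1) g (z, t) - primitive 1 g (z, t) := by
  have hi : ∀ a b : ℝ, IntervalIntegrable (fun s => density g (z, s)) MeasureTheory.volume a b :=
    fun a b => intervalIntegrable_density g fun s _ => pair_ne_zero hz s
  have h := intervalIntegral.integral_add_adjacent_intervals (hi (-1) 1) (hi 1 t)
  simp only [primitive, jump]
  rw [← h]
  ring

theorem jump_smul {g : SmoothFun 𝓘(ℝ, Model n) (HopfManifold (Model n) lam)}
    (h1 : loop 1 g 0 = 0) (h2 : loop (-1) g 0 = 0) {z : EuclideanSpace ℝ (Fin n)} (hz : z ≠ 0) :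
    jump g ((lam : ℝ) • z) = jump g z := by
  rw [jump_eq g (smul_ne_zero lam.2.1.ne' hz) ((lam : ℝ) * 1), jump_eq g hz 1]
  exact congrArg₂ (· - ·) (primitive_smul (v := (z, 1)) (by norm_num) h2 (Or.inl hz))
    (primitive_smul (v := (z, 1)) (by norm_num) h1 (Or.inl hz))

theorem jump_family {L : X → SmoothFun 𝓘(ℝ, Model n) (HopfManifold (Model n) lam)}
    (hL : Continuous L) : SmoothFamily (fun ξ z => jump (L ξ) z) (univ ×ˢ {0}ᶜ) := by
  have hU := isOpen_univ_prod_compl (X := X) (V := EuclideanSpace ℝ (Fin n))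
  have h1 := SmoothFamily.integral_segment (density_family hL)
    (ζ := fun z : EuclideanSpace ℝ (Fin n) => z) (α := fun _ => -1) (β := fun _ => 1) contDiff_id
    contDiff_const contDiff_const isOpen_compl_singleton fun z hz σ _ => pair_ne_zero hz _
  exact (h1.sub hU ((loopSum_family (by norm_num) hL).mono (subset_univ _))).add hU
    ((loopSum_family (by norm_num) hL).mono (subset_univ _))

/-- For an invariant primitive F off the axis, F(λᵏz, a/λ) = F(λᵏ⁺¹z, a), so the series telescopes.
F need not extend to the axis: only the limit along the orbit of this z is used. -/
theorem loopSum_eq_of_hasDerivAt {a : ℝ} (ha : a ≠ 0)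
    {g : SmoothFun 𝓘(ℝ, Model n) (HopfManifold (Model n) lam)} (hg : loop a g 0 = 0)
    {F : EuclideanSpace ℝ (Fin n) → ℝ → ℂ}
    (hF : ∀ z, z ≠ 0 → ∀ s, HasDerivAt (F z) (density g (z, s)) s)
    (hinv : ∀ z, z ≠ 0 → ∀ s, F ((lam : ℝ) • z) (lam * s) = F z s)
    {z : EuclideanSpace ℝ (Fin n)} (hz : z ≠ 0) {c : ℂ}
    (hc : Tendsto (fun k : ℕ => F ((lam : ℝ) ^ k • z) a) atTop (𝓝 c)) :
    loopSum a g z = c - F z a := by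
  have hl := lam.2.1.ne'
  have h1 : ∀ k : ℕ, loop a g ((lam : ℝ) ^ k • z) - loop a g 0 =
      F ((lam : ℝ) ^ (k + 1) • z) a - F ((lam : ℝ) ^ k • z) a := by
    intro k
    have hk : (lam : ℝ) ^ k • z ≠ 0 := smul_ne_zero (pow_ne_zero _ hl) hz
    rw [hg, sub_zero, loop, integral_density_eq_sub g (fun s _ => pair_ne_zero hk s)
      (fun s _ => hF _ hk s), ← hinv _ hk (a / lam), mul_div_cancel₀ _ hl, smul_smul, ← pow_succ']
  have h2 := (summable_loop ha g z).hasSum.tendsto_sum_nat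
  refine tendsto_nhds_unique h2 ?_
  simp only [h1, Finset.sum_range_sub (fun k => F ((lam : ℝ) ^ k • z) a), pow_zero, one_smul]
  exact hc.sub_const _

/-- The jump is the difference of the limits of an invariant primitive at the two closed leaves,
taken along λᵏ z; the values F(z, 1) and F(z, -1) cancel. All explicit jumps are computed this way.
-/
theorem jump_eq_of_hasDerivAt {g : SmoothFun 𝓘(ℝ, Model n) (HopfManifold (Model n) lam)}
    (h1 : loop 1 g 0 = 0) (h2 : loop (-1) g 0 = 0) {F : EuclideanSpace ℝ (Fin n) → ℝ → ℂ}
    (hF : ∀ z, z ≠ 0 → ∀ s, HasDerivAt (F z) (density g (z, s)) s)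
    (hinv : ∀ z, z ≠ 0 → ∀ s, F ((lam : ℝ) • z) (lam * s) = F z s)
    {z : EuclideanSpace ℝ (Fin n)} (hz : z ≠ 0) {c c' : ℂ}
    (hc : Tendsto (fun k : ℕ => F ((lam : ℝ) ^ k • z) 1) atTop (𝓝 c))
    (hc' : Tendsto (fun k : ℕ => F ((lam : ℝ) ^ k • z) (-1)) atTop (𝓝 c')) :
    jump g z = c - c' := by
  rw [jump, loopSum_eq_of_hasDerivAt (by norm_num) h1 hF hinv hz hc,
    loopSum_eq_of_hasDerivAt (by norm_num) h2 hF hinv hz hc',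
    integral_density_eq_sub g (fun s _ => pair_ne_zero hz s) (fun s _ => hF z hz s)]
  ring

/-- Solution of `r ∂f/∂t = g` if the periods of `g` vanish and its jump is constant. -/
theorem exists_fieldDeriv_eq {g : SmoothFun 𝓘(ℝ, Model n) (HopfManifold (Model n) lam)}
    (h1 : loop 1 g 0 = 0) (h2 : loop (-1) g 0 = 0) {c : ℂ} (hc : ∀ z, z ≠ 0 → jump g z = c) :
    ∃ f, fieldDeriv (reebField n lam) f = g := by
  classical
  have hm1 : (-1 : ℝ) ≠ 0 := by norm_num
  have hU := isOpen_primitive_domain (n := n)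
  -- The two primitives are glued along z ≠ 0, where they differ by the constant c.
  set F : Model n → ℂ := fun v =>
    if v.1 ≠ 0 ∨ 0 < (-1) * v.2 then primitive (-1) g v else primitive 1 g v + c with hF
  have hF1 : ∀ v ∈ {v : Model n | v.1 ≠ 0 ∨ 0 < (-1) * v.2}, F v = primitive (-1) g v :=
    fun v hv => if_pos hv
  have hF2 : ∀ v ∈ {v : Model n | v.1 ≠ 0 ∨ 0 < 1 * v.2}, F v = primitive 1 g v + c := by
    rintro ⟨z, t⟩ hv
    by_cases hz : z = 0
    · subst hz
      have ht : 0 < 1 * t := hv.resolve_left fun h => h rfl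
      refine if_neg ?_
      rintro (h | h)
      · exact h rfl
      · simp only at h
        linarith
    · rw [hF1 _ (Or.inl hz), ← hc z hz, jump_eq g hz t]
      ring
  have hcover : ∀ v : Model n, v ≠ 0 → (v.1 ≠ 0 ∨ 0 < (-1) * v.2) ∨ (v.1 ≠ 0 ∨ 0 < 1 * v.2) := by
    rintro ⟨z, t⟩ hv
    by_cases hz : z = 0
    · have ht : t ≠ 0 := fun h => hv (by rw [hz, h]; rfl)
      rcases lt_or_gt_of_ne ht with h | h
      · exact Or.inl (Or.inr (by simpa using h))
      · exact Or.inr (Or.inr (by simpa using h))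
    · exact Or.inl (Or.inl hz)
  have hsm : ContDiffOn ℝ ∞ F {0}ᶜ := by
    intro v hv
    refine ContDiffAt.contDiffWithinAt ?_
    rcases hcover v hv with h | h
    · refine ((primitive_contDiffOn hm1 g).contDiffAt ((hU (-1)).mem_nhds h)).congr_of_eventuallyEq ?_
      filter_upwards [(hU (-1)).mem_nhds h] with w hw using hF1 w hw
    · refine (((primitive_contDiffOn one_ne_zero g).contDiffAt ((hU 1).mem_nhds h)).add
        contDiffAt_const).congr_of_eventuallyEq (f := fun v => primitive 1 g v + c) ?_
      filter_upwards [(hU 1).mem_nhds h] with w hw using hF2 w hw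
  have hdom : ∀ (a : ℝ) (v : Model n), (v.1 ≠ 0 ∨ 0 < a * v.2) →
      (((lam : ℝ) • v).1 ≠ 0 ∨ 0 < a * ((lam : ℝ) • v).2) := by
    rintro a v (h | h)
    · exact Or.inl (smul_ne_zero lam.2.1.ne' h)
    · refine Or.inr ?_
      rw [Prod.smul_snd, smul_eq_mul, mul_left_comm]
      exact mul_pos lam.2.1 h
  have hinv : ∀ v : Model n, v ≠ 0 → F ((lam : ℝ) • v) = F v := by
    intro v hv
    rcases hcover v hv with h | h
    · rw [hF1 _ (hdom _ v h), hF1 v h, primitive_smul hm1 h2 h]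
    · rw [hF2 _ (hdom _ v h), hF2 v h, primitive_smul one_ne_zero h1 h]
  refine ⟨descend F hsm hinv, ext_lift ?_⟩
  rintro ⟨z, t⟩ hv
  have hd : HasDerivAt (fun s => F (z, s)) (density g (z, t)) t := by
    have hcs : Continuous fun s : ℝ => ((z, s) : Model n) := Continuous.prodMk_right z
    rcases hcover _ hv with h | h
    · refine (hasDerivAt_primitive g h).congr_of_eventuallyEq ?_
      filter_upwards [hcs.continuousAt ((hU (-1)).mem_nhds h)] with s hs using hF1 _ hs
    · refine ((hasDerivAt_primitive g h).add_const c).congr_of_eventuallyEq ?_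
      filter_upwards [hcs.continuousAt ((hU 1).mem_nhds h)] with s hs using hF2 _ hs
  rw [lift_reebField _ hv (hd.congr_of_eventuallyEq (lift_descend_eventuallyEq hv)),
    radius_mul_density g hv]

end Reeb

/-! ### The obstruction map: continuity, right inverse and kernel -/

namespace Reeb

variable {n : ℕ} {lam : Set.Ioo (0 : ℝ) 1} {X : Type*} [TopologicalSpace X]

theorem density_add (g g' : SmoothFun 𝓘(ℝ, Model n) (HopfManifold (Model n) lam)) (v : Model n) :
    density (g + g') v = density g v + density g' v := by
  rw [density, density, density, lift_add, mul_add]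

theorem density_const_smul (c : ℂ) (g : SmoothFun 𝓘(ℝ, Model n) (HopfManifold (Model n) lam))
    (v : Model n) : density (c • g) v = c * density g v := by
  rw [density, density, lift_const_smul, mul_left_comm]

/-- The periods of the closed leaves depend linearly on the function. -/
def loopLinear {a : ℝ} (ha : a ≠ 0) (z : EuclideanSpace ℝ (Fin n)) :
    SmoothFun 𝓘(ℝ, Model n) (HopfManifold (Model n) lam) →ₗ[ℂ] ℂ where
  toFun g := loop a g z
  map_add' g g' := by
    simp only [loop, density_add]
    exact intervalIntegral.integral_add
      (intervalIntegrable_density g (ne_of_mem_uIcc (mul_div_lam_pos ha)))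
      (intervalIntegrable_density g' (ne_of_mem_uIcc (mul_div_lam_pos ha)))
  map_smul' c g := by
    simp only [loop, density_const_smul]
    exact intervalIntegral.integral_const_mul c _

theorem loopSum_add {a : ℝ} (ha : a ≠ 0)
    (g g' : SmoothFun 𝓘(ℝ, Model n) (HopfManifold (Model n) lam)) (z : EuclideanSpace ℝ (Fin n)) :
    loopSum a (g + g') z = loopSum a g z + loopSum a g' z := by
  rw [loopSum, loopSum, loopSum, ← (summable_loop ha g z).tsum_add (summable_loop ha g' z)]
  refine tsum_congr fun k => ?_
  have h := fun y => (loopLinear (lam := lam) ha y).map_add g g'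
  simp only [loopLinear, LinearMap.coe_mk, AddHom.coe_mk] at h
  rw [h, h]
  ring

theorem loopSum_const_smul {a : ℝ} (ha : a ≠ 0) (c : ℂ)
    (g : SmoothFun 𝓘(ℝ, Model n) (HopfManifold (Model n) lam)) (z : EuclideanSpace ℝ (Fin n)) :
    loopSum a (c • g) z = c * loopSum a g z := by
  rw [loopSum, loopSum, ← tsum_mul_left]
  refine tsum_congr fun k => ?_
  have h := fun y => (loopLinear (lam := lam) ha y).map_smul c g
  simp only [loopLinear, LinearMap.coe_mk, AddHom.coe_mk, smul_eq_mul] at h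
  rw [h, h]
  ring

theorem jump_add (g g' : SmoothFun 𝓘(ℝ, Model n) (HopfManifold (Model n) lam))
    {z : EuclideanSpace ℝ (Fin n)} (hz : z ≠ 0) : jump (g + g') z = jump g z + jump g' z := by
  have hi : ∀ g : SmoothFun 𝓘(ℝ, Model n) (HopfManifold (Model n) lam),
      IntervalIntegrable (fun s => density g (z, s)) MeasureTheory.volume (-1) 1 :=
    fun g => intervalIntegrable_density g fun s _ => pair_ne_zero hz s
  simp only [jump, density_add]
  rw [intervalIntegral.integral_add (hi g) (hi g'), loopSum_add (by norm_num),
    loopSum_add (by norm_num)]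
  ring

theorem jump_const_smul (c : ℂ) (g : SmoothFun 𝓘(ℝ, Model n) (HopfManifold (Model n) lam))
    (z : EuclideanSpace ℝ (Fin n)) : jump (c • g) z = c * jump g z := by
  simp only [jump, density_const_smul]
  rw [intervalIntegral.integral_const_mul, loopSum_const_smul (by norm_num),
    loopSum_const_smul (by norm_num)]
  ring

variable (n lam) in
/-- A function with period 1 at the closed leaf through `(0, a)` and period 0 at the other closed
leaf, for `a = 1` and `a = -1`. -/
def unitPeriod (a : ℝ) : SmoothFun 𝓘(ℝ, Model n) (HopfManifold (Model n) lam) :=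
  (-a / (2 * Real.log lam) : ℂ) • (1 + (a : ℂ) • slope n lam)

/-- On the half-axis of sign b, t/r = b and r = b s, so 1 + a t/r is 2 or 0 and the density is a
multiple of 1/s. Its integral from b to b/λ is -log λ, which explains the factor -a/(2 log λ). -/
theorem loop_unitPeriod {a b : ℝ} (ha : a = 1 ∨ a = -1) (hb : b = 1 ∨ b = -1) :
    loop b (unitPeriod n lam a) 0 = if a = b then 1 else 0 := by
  have hl := lam.2.1
  have hlog := log_neg (lam := lam).ne
  have hb0 : b ≠ 0 := by rcases hb with rfl | rfl <;> norm_num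
  have hbb : b * b = 1 := by rcases hb with rfl | rfl <;> norm_num
  have hmem : (0 : ℝ) ∉ uIcc b (b / lam) := fun h =>
    ne_of_mem_uIcc (n := n) (z := 0) (mul_div_lam_pos hb0) 0 h rfl
  have h1 : ∀ s ∈ uIcc b (b / lam), density (unitPeriod n lam a) (0, s) =
      (-a / (2 * Real.log lam) * (1 + a * b) * b : ℂ) * ((s⁻¹ : ℝ) : ℂ) := by
    intro s hs
    have hne := ne_of_mem_uIcc (n := n) (z := 0) (mul_div_lam_pos hb0) s hs
    have hs0 : s ≠ 0 := fun h => hmem (h ▸ hs)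
    have hbs : 0 ≤ b * s := by
      have h2 := mul_div_lam_pos (lam := lam) hb0
      rw [mem_uIcc] at hs
      have h3 : 0 < 1 / (lam : ℝ) := by positivity
      rcases hb with rfl | rfl
      · rcases hs with hs | hs
        · linarith
        · linarith
      · rw [neg_div] at hs
        rcases hs with hs | hs
        · linarith
        · linarith
    have hr : radius ((0, s) : Model n) = b * s := by
      rw [radius]
      simp only [norm_zero]
      rw [show (0 : ℝ) ^ 2 + s ^ 2 = (b * s) ^ 2 by linear_combination -(s ^ 2) * hbb,
        Real.sqrt_sq hbs]
    rw [density, unitPeriod, lift_const_smul, lift_add, lift_const_smul, lift_one hne,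
      lift_slope hne, hr]
    have h4 : ((s / (b * s) : ℝ)) = b := by
      field_simp
      linear_combination -hbb
    have h5 : ((b * s)⁻¹ : ℝ) = b * s⁻¹ := by
      field_simp
      linear_combination -hbb
    simp only [h4, h5]
    push_cast
    ring
  rw [loop, intervalIntegral.integral_congr h1, intervalIntegral.integral_const_mul,
    intervalIntegral.integral_ofReal, integral_inv hmem]
  have h2 : Real.log (b / lam / b) = -Real.log lam := by
    rw [div_right_comm, div_self hb0, one_div, Real.log_inv]
  rw [h2]
  have hlog' : ((Real.log lam : ℝ) : ℂ) ≠ 0 := by exact_mod_cast hlog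
  rcases ha with rfl | rfl <;> rcases hb with rfl | rfl <;> norm_num <;> field_simp

/-- The projection onto the functions whose periods vanish. -/
def normalize : SmoothFun 𝓘(ℝ, Model n) (HopfManifold (Model n) lam) →ₗ[ℂ]
    SmoothFun 𝓘(ℝ, Model n) (HopfManifold (Model n) lam) where
  toFun g := g - (loopLinear one_ne_zero 0 g • unitPeriod n lam 1 +
    loopLinear (neg_ne_zero.2 one_ne_zero) 0 g • unitPeriod n lam (-1))
  map_add' g g' := by
    rw [map_add, map_add, add_smul, add_smul]
    abel
  map_smul' c g := by
    rw [map_smul, map_smul, smul_assoc, smul_assoc, ← smul_add, ← smul_sub]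
    rfl

theorem normalize_of_loop_eq_zero {g : SmoothFun 𝓘(ℝ, Model n) (HopfManifold (Model n) lam)}
    (h1 : loop 1 g 0 = 0) (h2 : loop (-1) g 0 = 0) : normalize g = g := by
  change g - (loop 1 g 0 • unitPeriod n lam 1 + loop (-1) g 0 • unitPeriod n lam (-1)) = g
  rw [h1, h2, zero_smul, zero_smul, add_zero, sub_zero]

theorem normalize_unitPeriod {a : ℝ} (ha : a = 1 ∨ a = -1) :
    normalize (unitPeriod n lam a) = 0 := by
  change unitPeriod n lam a - (loop 1 (unitPeriod n lam a) 0 • unitPeriod n lam 1 +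
    loop (-1) (unitPeriod n lam a) 0 • unitPeriod n lam (-1)) = 0
  rw [loop_unitPeriod ha (Or.inl rfl), loop_unitPeriod ha (Or.inr rfl)]
  rcases ha with rfl | rfl <;> norm_num

theorem loop_normalize {b : ℝ} (hb : b = 1 ∨ b = -1)
    (g : SmoothFun 𝓘(ℝ, Model n) (HopfManifold (Model n) lam)) : loop b (normalize g) 0 = 0 := by
  have hb0 : b ≠ 0 := by rcases hb with rfl | rfl <;> norm_num
  change loopLinear hb0 0 (g - (loop 1 g 0 • unitPeriod n lam 1 +
    loop (-1) g 0 • unitPeriod n lam (-1))) = 0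
  rw [map_sub, map_add, map_smul, map_smul]
  change loop b g 0 - (loop 1 g 0 • loop b (unitPeriod n lam 1) 0 +
    loop (-1) g 0 • loop b (unitPeriod n lam (-1)) 0) = 0
  rw [loop_unitPeriod (Or.inl rfl) hb, loop_unitPeriod (Or.inr rfl) hb]
  rcases hb with rfl | rfl <;> norm_num

theorem continuous_normalize : Continuous (normalize (n := n) (lam := lam)) := by
  have h := SmoothFun.continuous_add'
    (SmoothFun.continuous_smul_const (continuous_loop (n := n) (lam := lam) one_ne_zero 0)
      (unitPeriod n lam 1))
    (SmoothFun.continuous_smul_const (continuous_loop (n := n) (lam := lam)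
      (neg_ne_zero.2 one_ne_zero) 0) (unitPeriod n lam (-1)))
  refine (SmoothFun.continuous_add' continuous_id (SmoothFun.continuous_neg' h)).congr fun g => ?_
  exact (sub_eq_add_neg _ _).symm

theorem contDiffOn_jump (g : SmoothFun 𝓘(ℝ, Model n) (HopfManifold (Model n) lam)) :
    ContDiffOn ℝ ∞ (jump g) {0}ᶜ := fun z hz =>
  ((jump_family continuous_id).contDiffAt isOpen_univ_prod_compl (p := (g, z))
    ⟨mem_univ _, hz⟩).contDiffWithinAt

/-- The jump of the normalization of a function, as a function on the Hopf manifold. -/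
def jumpDescend (g : SmoothFun 𝓘(ℝ, Model n) (HopfManifold (Model n) lam)) :
    SmoothFun 𝓘(ℝ, EuclideanSpace ℝ (Fin n)) (HopfManifold (EuclideanSpace ℝ (Fin n)) lam) :=
  descend (jump (normalize g)) (contDiffOn_jump _)
    fun _ hz => jump_smul (loop_normalize (Or.inl rfl) g) (loop_normalize (Or.inr rfl) g) hz

theorem lift_jumpDescend (g : SmoothFun 𝓘(ℝ, Model n) (HopfManifold (Model n) lam))
    {z : EuclideanSpace ℝ (Fin n)} (hz : z ≠ 0) : lift (jumpDescend g) z = jump (normalize g) z :=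
  lift_descend hz

/-- `jumpDescend` as a linear map. -/
def jumpFun : SmoothFun 𝓘(ℝ, Model n) (HopfManifold (Model n) lam) →ₗ[ℂ]
    SmoothFun 𝓘(ℝ, EuclideanSpace ℝ (Fin n)) (HopfManifold (EuclideanSpace ℝ (Fin n)) lam) where
  toFun := jumpDescend
  map_add' g g' := ext_lift fun z hz => by
    rw [lift_add, lift_jumpDescend _ hz, lift_jumpDescend _ hz, lift_jumpDescend _ hz, map_add,
      jump_add _ _ hz]
  map_smul' c g := ext_lift fun z hz => by
    rw [RingHom.id_apply, lift_const_smul, lift_jumpDescend _ hz, lift_jumpDescend _ hz, map_smul,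
      jump_const_smul]

theorem lift_jumpFun (g : SmoothFun 𝓘(ℝ, Model n) (HopfManifold (Model n) lam))
    {z : EuclideanSpace ℝ (Fin n)} (hz : z ≠ 0) : lift (jumpFun g) z = jump (normalize g) z :=
  lift_jumpDescend g hz

theorem continuous_jumpFun : Continuous (jumpFun (n := n) (lam := lam)) :=
  continuous_of_lift_family ((jump_family continuous_normalize).congr isOpen_univ_prod_compl
    fun q hq => lift_jumpFun q.1 hq.2)

variable (n lam) in
/-- A function which is 1 near one closed leaf and 0 near the other one. -/
def cutoff : SmoothFun 𝓘(ℝ, Model n) (HopfManifold (Model n) lam) :=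
  descend (fun v => ((Real.smoothTransition (v.2 / radius v + 1 / 2) : ℝ) : ℂ))
    (Complex.ofRealCLM.contDiff.comp_contDiffOn (Real.smoothTransition.contDiff.comp_contDiffOn
      ((contDiff_snd.contDiffOn.div contDiffOn_radius fun _ hv => (radius_pos hv).ne').add
        contDiffOn_const)))
    fun v hv => by
      rw [radius_smul, Prod.smul_snd, smul_eq_mul, mul_div_mul_left _ _ lam.2.1.ne']

theorem lift_cutoff {v : Model n} (hv : v ≠ 0) : lift (cutoff n lam) v =
    ((Real.smoothTransition (v.2 / radius v + 1 / 2) : ℝ) : ℂ) := lift_descend hv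

theorem radius_zero_fst (t : ℝ) : radius ((0, t) : Model n) = |t| := by
  rw [radius]
  simp [Real.sqrt_sq_eq_abs]

/-- The cutoff is 0 where t/r ≤ -1/2 and 1 where t/r ≥ 1/2, so it is locally constant near both
closed leaves. Its derivative may thus be multiplied by functions of z that are singular at z = 0.
-/
theorem eventually_lift_reebField_cutoff {t : ℝ} (ht : t ≠ 0) :
    ∀ᶠ v : Model n in 𝓝 (0, t), lift (fieldDeriv (reebField n lam) (cutoff n lam)) v = 0 := by
  have hne : ((0, t) : Model n) ≠ 0 := fun h => ht (congrArg Prod.snd h)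
  have hcont : ContinuousAt (fun v : Model n => v.2 / radius v) (0, t) :=
    continuous_snd.continuousAt.div (contDiffOn_radius.continuousOn.continuousAt
      (isOpen_compl_singleton.mem_nhds hne)) (radius_pos hne).ne'
  have hloc : ∃ c : ℂ, ∀ᶠ v : Model n in 𝓝 (0, t), lift (cutoff n lam) v = c := by
    rcases lt_or_gt_of_ne ht with h | h
    · have h1 : ((0, t) : Model n).2 / radius ((0, t) : Model n) < -(1 / 2) := by
        rw [radius_zero_fst, abs_of_neg h, div_neg, div_self ht]; norm_num
      refine ⟨0, ?_⟩
      filter_upwards [hcont.eventually (gt_mem_nhds h1), isOpen_compl_singleton.mem_nhds hne]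
        with v hv hv0
      rw [lift_cutoff hv0, Real.smoothTransition.zero_of_nonpos (by linarith), Complex.ofReal_zero]
    · have h1 : 1 / 2 < ((0, t) : Model n).2 / radius ((0, t) : Model n) := by
        rw [radius_zero_fst, abs_of_pos h, div_self ht]; norm_num
      refine ⟨1, ?_⟩
      filter_upwards [hcont.eventually (lt_mem_nhds h1), isOpen_compl_singleton.mem_nhds hne]
        with v hv hv0
      rw [lift_cutoff hv0, Real.smoothTransition.one_of_one_le (by linarith), Complex.ofReal_one]
  obtain ⟨c, hc⟩ := hloc
  filter_upwards [hc.eventually_nhds, isOpen_compl_singleton.mem_nhds hne]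
  rintro ⟨z, s⟩ hv hv0
  have h2 : (fun s => lift (cutoff n lam) (z, s)) =ᶠ[𝓝 s] fun _ => c :=
    (Continuous.prodMk_right z).continuousAt.eventually hv
  rw [lift_reebField _ hv0 ((hasDerivAt_const s c).congr_of_eventuallyEq h2), mul_zero]

/-- Near the axis the first factor is zero; elsewhere z ≠ 0 and both factors are smooth. -/
theorem jumpSection_family : SmoothFamily (fun (ψ : SmoothFun 𝓘(ℝ, EuclideanSpace ℝ (Fin n))
      (HopfManifold (EuclideanSpace ℝ (Fin n)) lam)) (v : Model n) =>
      lift (fieldDeriv (reebField n lam) (cutoff n lam)) v * lift ψ v.1) (univ ×ˢ {0}ᶜ) := by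
  refine SmoothFamily.of_locally ?_
  rintro ⟨ψ₀, z₀, t₀⟩ ⟨-, hv₀⟩
  by_cases hz : z₀ = 0
  · subst hz
    have ht : t₀ ≠ 0 := fun h => hv₀ (by simp only [h]; rfl)
    obtain ⟨U, hU, hUo, hvU⟩ := eventually_nhds_iff.1
      (eventually_lift_reebField_cutoff (n := n) (lam := lam) ht)
    refine ⟨univ ×ˢ U, isOpen_univ.prod hUo, ⟨mem_univ _, hvU⟩, fun _ _ => (0 : ℂ),
      SmoothFamily.of_param (isOpen_univ.prod hUo) continuous_const, ?_⟩
    rintro ⟨ψ, v⟩ ⟨-, hv⟩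
    simp only [hU v hv, zero_mul]
  · have hU : IsOpen {v : Model n | v.1 ≠ 0} := isOpen_compl_singleton.preimage continuous_fst
    refine ⟨univ ×ˢ {v : Model n | v.1 ≠ 0}, isOpen_univ.prod hU, ⟨mem_univ _, hz⟩,
      fun ψ v => lift (fieldDeriv (reebField n lam) (cutoff n lam)) v * lift ψ v.1, ?_,
      fun _ _ => rfl⟩
    refine ((SmoothFamily.of_contDiffOn isOpen_compl_singleton (contDiffOn_lift _) ?_).mul
      (isOpen_univ.prod hU) (lift_family.comp (isOpen_univ.prod hU) continuous_id
        (SmoothFamily.of_contDiffOn isOpen_univ contDiff_fst.contDiffOn fun _ _ => mem_univ _) ?_))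
    · rintro ⟨ψ, v⟩ ⟨-, hv⟩ h
      exact hv (congrArg Prod.fst h)
    · exact fun p hp => ⟨mem_univ _, hp.2⟩

/-- A function with given jump and vanishing periods. -/
def jumpSection (ψ : SmoothFun 𝓘(ℝ, EuclideanSpace ℝ (Fin n))
    (HopfManifold (EuclideanSpace ℝ (Fin n)) lam)) :
    SmoothFun 𝓘(ℝ, Model n) (HopfManifold (Model n) lam) :=
  descend (fun v => lift (fieldDeriv (reebField n lam) (cutoff n lam)) v * lift ψ v.1)
    (fun v hv => (jumpSection_family.contDiffAt isOpen_univ_prod_compl (p := (ψ, v))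
        ⟨mem_univ _, hv⟩).contDiffWithinAt)
    fun v _ => by rw [lift_smul, Prod.smul_fst, lift_smul]

theorem lift_jumpSection (ψ : SmoothFun 𝓘(ℝ, EuclideanSpace ℝ (Fin n))
    (HopfManifold (EuclideanSpace ℝ (Fin n)) lam)) {v : Model n} (hv : v ≠ 0) :
    lift (jumpSection ψ) v =
      lift (fieldDeriv (reebField n lam) (cutoff n lam)) v * lift ψ v.1 := lift_descend hv

theorem continuous_jumpSection : Continuous (jumpSection (n := n) (lam := lam)) :=
  continuous_of_lift_family (jumpSection_family.congr isOpen_univ_prod_compl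
    fun q hq => lift_jumpSection q.1 hq.2)

theorem loop_jumpSection {a : ℝ} (ha : a ≠ 0) (ψ : SmoothFun 𝓘(ℝ, EuclideanSpace ℝ (Fin n))
    (HopfManifold (EuclideanSpace ℝ (Fin n)) lam)) : loop a (jumpSection ψ) 0 = 0 := by
  -- The default value 0 of `lift ψ` at z = 0 makes the function zero on the axis.
  have h : ∀ s ∈ uIcc a (a / lam), density (jumpSection ψ) (0, s) = 0 := fun s hs => by
    rw [density, lift_jumpSection ψ (ne_of_mem_uIcc (mul_div_lam_pos ha) s hs), lift_at_zero,
      mul_zero, mul_zero]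
  rw [loop, intervalIntegral.integral_congr h, intervalIntegral.integral_zero]

theorem density_eq_of_fieldDeriv {g : SmoothFun 𝓘(ℝ, Model n) (HopfManifold (Model n) lam)}
    {v : Model n} (hv : v ≠ 0) {d : ℂ} (h : lift g v = radius v * d) : density g v = d := by
  have : (radius v : ℂ) ≠ 0 := by exact_mod_cast (radius_pos hv).ne'
  rw [density, h, Complex.ofReal_inv, inv_mul_cancel_left₀ this]

/-- Off the axis, the cutoff times ψ is an invariant primitive. Along λᵏ z it tends to ψ(z) at t = 1
and to 0 at t = -1, and the jump is the difference. -/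
theorem jumpFun_jumpSection (ψ : SmoothFun 𝓘(ℝ, EuclideanSpace ℝ (Fin n))
    (HopfManifold (EuclideanSpace ℝ (Fin n)) lam)) : jumpFun (jumpSection ψ) = ψ := by
  refine ext_lift fun z hz => ?_
  have h1 := loop_jumpSection (n := n) one_ne_zero ψ
  have h2 := loop_jumpSection (n := n) (neg_ne_zero.2 one_ne_zero) ψ
  rw [lift_jumpFun _ hz, normalize_of_loop_eq_zero h1 h2]
  have hlim : ∀ t : ℝ, t ≠ 0 → Tendsto (fun k : ℕ => lift (cutoff n lam) ((lam : ℝ) ^ k • z, t) *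
      lift ψ ((lam : ℝ) ^ k • z)) atTop (𝓝 (lift (cutoff n lam) (0, t) * lift ψ z)) := by
    intro t ht
    simp only [lift_pow_smul]
    exact (tendsto_lift _ z ht).mul_const _
  have hc1 : lift (cutoff n lam) ((0, 1) : Model n) = 1 := by
    rw [lift_cutoff (by simp), radius_zero_fst, Real.smoothTransition.one_of_one_le (by norm_num),
      Complex.ofReal_one]
  have hc2 : lift (cutoff n lam) ((0, -1) : Model n) = 0 := by
    rw [lift_cutoff (by simp), radius_zero_fst, Real.smoothTransition.zero_of_nonpos (by norm_num),
      Complex.ofReal_zero]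
  rw [jump_eq_of_hasDerivAt h1 h2 (F := fun z s => lift (cutoff n lam) (z, s) * lift ψ z)
    (fun z hz s => ?_) (fun z hz s => ?_) hz (hlim 1 one_ne_zero)
    (hlim (-1) (neg_ne_zero.2 one_ne_zero)), hc1, hc2]
  · ring
  · have hv := pair_ne_zero hz s
    have hd := hasDerivAt_lift (cutoff n lam) hv
    refine (hd.mul_const (lift ψ z)).congr_deriv (density_eq_of_fieldDeriv hv ?_).symm
    rw [lift_jumpSection ψ hv, lift_reebField _ hv hd, mul_assoc]
  · rw [lift_smul]
    exact congrArg (· * lift ψ z) (lift_smul (cutoff n lam) (z, s))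

/-- The period is the change of f once around the closed leaf. -/
theorem loop_fieldDeriv {a : ℝ} (ha : a ≠ 0)
    (f : SmoothFun 𝓘(ℝ, Model n) (HopfManifold (Model n) lam)) :
    loop a (fieldDeriv (reebField n lam) f) 0 = 0 := by
  have hne := ne_of_mem_uIcc (n := n) (z := 0) (mul_div_lam_pos (lam := lam) ha)
  rw [loop, integral_density_eq_sub _ hne (F := fun s => lift f (0, s))
    fun s hs => (hasDerivAt_lift f (hne s hs)).congr_deriv
      (density_eq_of_fieldDeriv (hne s hs) (lift_reebField f (hne s hs)
        (hasDerivAt_lift f (hne s hs)))).symm]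
  have h := lift_smul f ((0, a / lam) : Model n)
  rw [Prod.smul_mk, smul_zero, smul_eq_mul, mul_div_cancel₀ _ lam.2.1.ne'] at h
  rw [h, sub_self]

/-- Here f itself is an invariant primitive, and it is continuous at the closed leaves; so its
limits, and with them the jump, do not depend on z. -/
theorem jump_fieldDeriv (f : SmoothFun 𝓘(ℝ, Model n) (HopfManifold (Model n) lam))
    {z : EuclideanSpace ℝ (Fin n)} (hz : z ≠ 0) :
    jump (fieldDeriv (reebField n lam) f) z = lift f (0, 1) - lift f (0, -1) := by
  refine jump_eq_of_hasDerivAt (loop_fieldDeriv one_ne_zero f)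
    (loop_fieldDeriv (neg_ne_zero.2 one_ne_zero) f) (F := fun z s => lift f (z, s))
    (fun z hz s => ?_) (fun z _ s => lift_smul f (z, s)) hz (tendsto_lift f z one_ne_zero)
    (tendsto_lift f z (neg_ne_zero.2 one_ne_zero))
  have hv := pair_ne_zero hz s
  exact (hasDerivAt_lift f hv).congr_deriv
    (density_eq_of_fieldDeriv hv (lift_reebField f hv (hasDerivAt_lift f hv))).symm

/-- The obstructions to solving `r ∂f/∂t = g`: the jump of `g`, up to a constant, and its two
periods. -/
def obstruction (p₀ : HopfManifold (EuclideanSpace ℝ (Fin n)) lam) :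
    SmoothFun 𝓘(ℝ, Model n) (HopfManifold (Model n) lam) →ₗ[ℂ]
      SmoothFun 𝓘(ℝ, EuclideanSpace ℝ (Fin n)) (HopfManifold (EuclideanSpace ℝ (Fin n)) lam) × ℂ
    where
  toFun g := (jumpFun g + (loopLinear (neg_ne_zero.2 one_ne_zero) 0 g - jumpFun g p₀) • 1,
    loopLinear one_ne_zero 0 g)
  map_add' g g' := by
    refine Prod.ext ?_ (map_add _ g g')
    refine SmoothFun.ext fun p => ?_
    simp only [map_add, SmoothFun.add_apply, SmoothFun.smul_apply, SmoothFun.one_apply,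
      Prod.fst_add]
    ring
  map_smul' c g := by
    refine Prod.ext ?_ (map_smul _ c g)
    refine SmoothFun.ext fun p => ?_
    simp only [map_smul, SmoothFun.add_apply, SmoothFun.smul_apply, SmoothFun.one_apply,
      Prod.smul_fst, smul_eq_mul, RingHom.id_apply]
    ring

theorem continuous_obstruction (p₀ : HopfManifold (EuclideanSpace ℝ (Fin n)) lam) :
    Continuous (obstruction p₀) := by
  refine Continuous.prodMk (SmoothFun.continuous_add' continuous_jumpFun
    (SmoothFun.continuous_smul_const ?_ 1)) (continuous_loop one_ne_zero 0)
  exact (continuous_loop (neg_ne_zero.2 one_ne_zero) 0).sub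
    ((SmoothFun.continuous_eval p₀).comp continuous_jumpFun)

/-- Modulo constants the jump is encoded by its difference from its value at p₀; the freed value at
p₀ stores the period at a = -1. The right inverse realizes the jump by `jumpSection` and the periods
by `unitPeriod`, which do not interfere with each other. -/
theorem isQuotientMap_obstruction (p₀ : HopfManifold (EuclideanSpace ℝ (Fin n)) lam) :
    IsQuotientMap (obstruction p₀) := by
  have hm : (-1 : ℝ) ≠ 0 := neg_ne_zero.2 one_ne_zero
  refine IsQuotientMap.of_inverse (f := fun q => jumpSection q.1 +
    (q.1 p₀ • unitPeriod n lam (-1) + q.2 • unitPeriod n lam 1)) ?_ (continuous_obstruction p₀) ?_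
  · exact SmoothFun.continuous_add' (continuous_jumpSection.comp continuous_fst)
      (SmoothFun.continuous_add' (SmoothFun.continuous_smul_const
        ((SmoothFun.continuous_eval p₀).comp continuous_fst) _)
        (SmoothFun.continuous_smul_const continuous_snd _))
  · rintro ⟨ψ, b⟩
    set g := jumpSection ψ + (ψ p₀ • unitPeriod n lam (-1) + b • unitPeriod n lam 1) with hg
    have h1 : jumpFun g = ψ := by
      have h2 : ∀ a : ℝ, a = 1 ∨ a = -1 → jumpFun (unitPeriod n lam a) = 0 := by
        intro a ha
        refine ext_lift fun z hz => ?_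
        rw [lift_jumpFun _ hz, normalize_unitPeriod ha, lift_of_ne _ hz, SmoothFun.zero_apply]
        simpa using jump_const_smul 0 (0 : SmoothFun 𝓘(ℝ, Model n) (HopfManifold (Model n) lam)) z
      rw [hg, map_add, map_add, map_smul, map_smul, h2 _ (Or.inr rfl), h2 _ (Or.inl rfl),
        jumpFun_jumpSection, smul_zero, smul_zero, add_zero, add_zero]
    have h3 : ∀ (a : ℝ) (ha : a ≠ 0), loopLinear ha 0 g =
        ψ p₀ * loop a (unitPeriod n lam (-1)) 0 + b * loop a (unitPeriod n lam 1) 0 := by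
      intro a ha
      rw [hg, map_add, map_add, map_smul, map_smul]
      change loop a (jumpSection ψ) 0 + _ = _
      rw [loop_jumpSection ha, zero_add]
      rfl
    have h4 : loopLinear hm 0 g = ψ p₀ := by
      rw [h3, loop_unitPeriod (Or.inr rfl) (Or.inr rfl), loop_unitPeriod (Or.inl rfl) (Or.inr rfl)]
      norm_num
    have h5 : loopLinear one_ne_zero 0 g = b := by
      rw [h3, loop_unitPeriod (Or.inr rfl) (Or.inl rfl), loop_unitPeriod (Or.inl rfl) (Or.inl rfl)]
      norm_num
    change (jumpFun g + (loopLinear hm 0 g - jumpFun g p₀) • 1, loopLinear one_ne_zero 0 g) = (ψ, b)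
    rw [h1, h4, h5, sub_self, zero_smul, add_zero]

/-- Evaluating the first component at p₀ gives the period at a = -1. Once that vanishes, the
component says that the jump is constant, and `exists_fieldDeriv_eq` applies. -/
theorem ker_obstruction (p₀ : HopfManifold (EuclideanSpace ℝ (Fin n)) lam) :
    LinearMap.ker (obstruction p₀) = LinearMap.range (fieldDeriv (reebField n lam)) := by
  have hm : (-1 : ℝ) ≠ 0 := neg_ne_zero.2 one_ne_zero
  ext g
  rw [LinearMap.mem_ker, LinearMap.mem_range]
  change (jumpFun g + (loop (-1) g 0 - jumpFun g p₀) • 1, loop 1 g 0) = 0 ↔ _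
  constructor
  · intro h
    have h1 : loop 1 g 0 = 0 := congrArg Prod.snd h
    have h2 : jumpFun g + (loop (-1) g 0 - jumpFun g p₀) • 1 = 0 := congrArg Prod.fst h
    have h3 : ∀ p, jumpFun g p + (loop (-1) g 0 - jumpFun g p₀) * 1 = 0 := fun p =>
      congrArg (fun f : SmoothFun 𝓘(ℝ, EuclideanSpace ℝ (Fin n))
        (HopfManifold (EuclideanSpace ℝ (Fin n)) lam) => f p) h2
    have h4 : loop (-1) g 0 = 0 := by linear_combination h3 p₀
    refine exists_fieldDeriv_eq h1 h4 (c := jumpFun g p₀) fun z hz => ?_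
    have h5 := lift_jumpFun g hz
    rw [normalize_of_loop_eq_zero h1 h4, lift_of_ne _ hz] at h5
    rw [← h5]
    linear_combination h3 (proj lam ⟨z, hz⟩) - h4
  · rintro ⟨f, rfl⟩
    have h1 := loop_fieldDeriv one_ne_zero f
    have h2 := loop_fieldDeriv hm f
    have h3 : ∀ p, jumpFun (fieldDeriv (reebField n lam) f) p =
        lift f (0, 1) - lift f (0, -1) := by
      intro p
      obtain ⟨y, rfl⟩ := proj_surjective p
      rw [← lift_coe, lift_jumpFun _ y.2, normalize_of_loop_eq_zero h1 h2, jump_fieldDeriv f y.2]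
    refine Prod.ext (SmoothFun.ext fun p => ?_) h1
    change jumpFun (fieldDeriv (reebField n lam) f) p + (loop (-1) (fieldDeriv (reebField n lam) f) 0
      - jumpFun (fieldDeriv (reebField n lam) f) p₀) * 1 = 0
    rw [h3, h3, h2]
    ring

end Reeb

/-! ### Absorbing a complex number into a smooth function -/

namespace Reeb

variable {V : Type} [NormedAddCommGroup V] [InnerProductSpace ℝ V]
  {lam : Set.Ioo (0 : ℝ) 1}

theorem wave_eq_one_iff {s : ℝ} : wave lam s = 1 ↔ ∃ k : ℤ, s = k * Real.log lam := by
  have h := log_neg (lam := lam).ne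
  rw [wave, Complex.exp_eq_one_iff]
  refine exists_congr fun k => ?_
  have h2 : ((2 * Real.pi / Real.log lam * s : ℝ) : ℂ) * Complex.I =
      ((s / Real.log lam : ℝ) : ℂ) * (2 * Real.pi * Complex.I) := by
    push_cast
    ring
  rw [h2, mul_left_inj' Complex.two_pi_I_ne_zero, ← Complex.ofReal_intCast, Complex.ofReal_inj,
    div_eq_iff h]

theorem wave_zero : wave lam 0 = 1 := wave_eq_one_iff.2 ⟨0, by simp⟩

theorem wave_sub_int (s : ℝ) (k : ℤ) : wave lam (s - k * Real.log lam) = wave lam s := by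
  rw [wave, wave, Complex.exp_eq_exp_iff_exists_int]
  refine ⟨-k, ?_⟩
  have h := log_neg (lam := lam).ne
  rw [mul_sub, mul_left_comm, div_mul_cancel₀ _ h]
  push_cast
  ring

/-- The zeros of `wave - 1`, the integer multiples of log λ, are simple by periodicity. Hence a
smooth periodic function that vanishes at 0 is divisible by it. -/
theorem deriv_wave_zero_ne_zero : deriv (wave lam) 0 ≠ 0 := by
  rw [(hasDerivAt_wave 0).deriv, wave_zero]
  have h : ((Real.log lam : ℝ) : ℂ) ≠ 0 := by exact_mod_cast log_neg (lam := lam).ne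
  have h' : (Real.pi : ℂ) ≠ 0 := by exact_mod_cast Real.pi_ne_zero
  simp [h, h']

/-- The restriction of `f` to the image of the ray through `x₀`, normalized to vanish at `x₀`. -/
def ray (x₀ : V) (f : SmoothFun 𝓘(ℝ, V) (HopfManifold V lam)) (s : ℝ) : ℂ :=
  lift f (Real.exp s • x₀) - lift f x₀

theorem ray_zero (x₀ : V) (f : SmoothFun 𝓘(ℝ, V) (HopfManifold V lam)) : ray x₀ f 0 = 0 := by
  rw [ray, Real.exp_zero, one_smul, sub_self]

theorem ray_sub_int (x₀ : V) (f : SmoothFun 𝓘(ℝ, V) (HopfManifold V lam)) (s : ℝ) (k : ℤ) :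
    ray x₀ f (s - k * Real.log lam) = ray x₀ f s := by
  have h : Real.exp (s - k * Real.log lam) = (lam : ℝ) ^ (-k) * Real.exp s := by
    rw [sub_eq_neg_add, Real.exp_add, ← neg_mul, mul_comm _ (Real.log lam), Real.exp_mul,
      Real.exp_log lam.2.1, ← Int.cast_neg, Real.rpow_intCast]
  rw [ray, ray, h, mul_smul, lift_zpow_smul]

theorem ray_family [LocallyCompactSpace V] {x₀ : V} (hx₀ : x₀ ≠ 0) :
    SmoothFamily (fun f : SmoothFun 𝓘(ℝ, V) (HopfManifold V lam) => ray x₀ f) univ := by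
  refine SmoothFamily.sub ?_ isOpen_univ (SmoothFamily.of_param isOpen_univ ?_)
  · exact lift_family.comp isOpen_univ continuous_id
      (SmoothFamily.of_contDiffOn isOpen_univ
        (Real.contDiff_exp.smul contDiff_const).contDiffOn fun _ _ => mem_univ _)
      fun p _ => ⟨mem_univ _, smul_ne_zero (Real.exp_pos p.2).ne' hx₀⟩
  · exact (SmoothFun.continuous_eval (proj lam ⟨x₀, hx₀⟩)).congr fun f => (lift_of_ne f hx₀).symm

open Classical in
/-- The quotient of `ray x₀ f` by `wave lam - 1`. -/
def rayQuotient (x₀ : V) (f : SmoothFun 𝓘(ℝ, V) (HopfManifold V lam)) (s : ℝ) : ℂ :=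
  if wave lam s = 1 then deriv (ray x₀ f) 0 / deriv (wave lam) 0
  else ray x₀ f s / (wave lam s - 1)

theorem rayQuotient_sub_int (x₀ : V) (f : SmoothFun 𝓘(ℝ, V) (HopfManifold V lam)) (s : ℝ) (k : ℤ) :
    rayQuotient x₀ f (s - k * Real.log lam) = rayQuotient x₀ f s := by
  rw [rayQuotient, rayQuotient, wave_sub_int, ray_sub_int]

theorem wave_sub_one_mul_rayQuotient (x₀ : V) (f : SmoothFun 𝓘(ℝ, V) (HopfManifold V lam)) (s : ℝ) :
    (wave lam s - 1) * rayQuotient x₀ f s = ray x₀ f s := by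
  by_cases h : wave lam s = 1
  · obtain ⟨k, rfl⟩ := wave_eq_one_iff.1 h
    have := ray_sub_int x₀ f (k * Real.log lam) k
    rw [sub_self, ray_zero] at this
    rw [h, sub_self, zero_mul, this]
  · rw [rayQuotient, if_neg h, mul_div_cancel₀ _ (sub_ne_zero.2 h)]

/-- Uniqueness of the quotient. At 0 the value is forced by differentiating the product, and
periodicity carries this to the other zeros. -/
theorem rayQuotient_eq {x₀ : V} {f : SmoothFun 𝓘(ℝ, V) (HopfManifold V lam)} {K : ℝ → ℂ}
    (hK : DifferentiableAt ℝ K 0) (hper : ∀ (s : ℝ) (k : ℤ), K (s - k * Real.log lam) = K s)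
    (h : ∀ s, ray x₀ f s = (wave lam s - 1) * K s) (s : ℝ) : rayQuotient x₀ f s = K s := by
  by_cases hs : wave lam s = 1
  · rw [rayQuotient, if_pos hs, div_eq_iff deriv_wave_zero_ne_zero, funext h]
    have h1 := ((hasDerivAt_wave (lam := lam) 0).differentiableAt.hasDerivAt.sub_const 1).mul
      hK.hasDerivAt
    rw [wave_zero, sub_self, zero_mul, add_zero] at h1
    obtain ⟨k, rfl⟩ := wave_eq_one_iff.1 hs
    have h2 := hper (k * Real.log lam) k
    rw [sub_self] at h2
    rw [← h2, mul_comm]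
    exact h1.deriv
  · rw [rayQuotient, if_neg hs, h, mul_div_cancel_left₀ _ (sub_ne_zero.2 hs)]

theorem hadamard_zero_one {X : Type*} [TopologicalSpace X] {W : Type} [NormedAddCommGroup W]
    [NormedSpace ℝ W] [CompleteSpace W] (Φ : X → ℝ → W)
    (ξ : X) : SmoothFamily.hadamard Φ ξ 0 1 = deriv (Φ ξ) 0 := by
  have h : ∀ σ : ℝ, σ • (0 : ℝ) = 0 := smul_zero
  simp only [SmoothFamily.hadamard, h]
  rw [intervalIntegral.integral_const, sub_zero, one_smul]
  exact fderiv_apply_one_eq_deriv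

/-- Away from the zeros of `wave - 1` this is ordinary division. Near a zero, translated to 0,
Hadamard's lemma writes numerator and denominator as s e and s d with d(0) ≠ 0, and the quotient e/d
is smooth in s with derivatives continuous in f. -/
theorem rayQuotient_family [LocallyCompactSpace V] {x₀ : V} (hx₀ : x₀ ≠ 0) :
    SmoothFamily (fun f : SmoothFun 𝓘(ℝ, V) (HopfManifold V lam) => rayQuotient x₀ f) univ := by
  have hray := ray_family (lam := lam) hx₀
  have hwave : SmoothFamily (fun _ : SmoothFun 𝓘(ℝ, V) (HopfManifold V lam) => wave lam) univ :=
    SmoothFamily.of_contDiffOn isOpen_univ contDiff_wave.contDiffOn fun _ _ => mem_univ _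
  have hwave' : ContDiff ℝ ∞ fun s => wave lam s - 1 := contDiff_wave.sub contDiff_const
  refine SmoothFamily.of_locally ?_
  rintro ⟨f₀, s₀⟩ -
  by_cases hs : wave lam s₀ = 1
  · obtain ⟨k, rfl⟩ := wave_eq_one_iff.1 hs
    let e : SmoothFun 𝓘(ℝ, V) (HopfManifold V lam) → ℝ → ℂ := fun f s =>
      SmoothFamily.hadamard (fun f => ray x₀ f) f s 1
    let d : ℝ → ℂ := fun s =>
      SmoothFamily.hadamard (fun _ : SmoothFun 𝓘(ℝ, V) (HopfManifold V lam) => wave lam) 0 s 1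
    have he : SmoothFamily e univ :=
      hray.hadamard_family.clm_apply isOpen_univ (ContinuousLinearMap.apply ℝ ℂ 1)
    have hd : ContDiff ℝ ∞ d := contDiff_iff_contDiffAt.2 fun s =>
      (hwave.hadamard_family.clm_apply isOpen_univ
        (ContinuousLinearMap.apply ℝ ℂ 1)).contDiffAt isOpen_univ (p := (0, s)) (mem_univ _)
    have he1 : ∀ f s, s • e f s = ray x₀ f s := fun f s => by
      rw [← map_smul, smul_eq_mul, mul_one, hray.hadamard_apply, ray_zero, sub_zero]
    have hd1 : ∀ s, s • d s = wave lam s - 1 := fun s => by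
      rw [← map_smul, smul_eq_mul, mul_one, hwave.hadamard_apply, wave_zero]
    have hd0 : d 0 ≠ 0 := by
      simp only [d, hadamard_zero_one]
      exact deriv_wave_zero_ne_zero
    have hD : IsOpen {s : ℝ | d s ≠ 0} := isOpen_compl_singleton.preimage hd.continuous
    have hquot : SmoothFamily (fun f s => e f s * (d s)⁻¹) (univ ×ˢ {s : ℝ | d s ≠ 0}) :=
      (he.mono (subset_univ _)).mul (isOpen_univ.prod hD)
        (SmoothFamily.of_contDiffOn hD (hd.contDiffOn.inv fun _ hs => hs) fun _ hp => hp.2)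
    have hτ : ContDiff ℝ ∞ fun s : ℝ => s - k * Real.log lam := contDiff_id.sub contDiff_const
    have hD' := hD.preimage hτ.continuous
    refine ⟨univ ×ˢ ((fun s : ℝ => s - k * Real.log lam) ⁻¹' {s : ℝ | d s ≠ 0}),
      isOpen_univ.prod hD', ⟨mem_univ _, ?_⟩, _,
      hquot.comp (isOpen_univ.prod hD') continuous_id
        (SmoothFamily.of_contDiffOn isOpen_univ hτ.contDiffOn fun _ _ => mem_univ _)
        fun p hp => ⟨mem_univ _, hp.2⟩, ?_⟩
    · simpa using hd0
    · rintro ⟨f, s⟩ ⟨-, hp⟩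
      simp only [id]
      rw [← rayQuotient_sub_int x₀ f s k]
      replace hp : d (s - k * Real.log lam) ≠ 0 := hp
      generalize s - k * Real.log lam = s at hp ⊢
      -- Where d ≠ 0, `wave - 1` = s d vanishes only at s = 0, so the case distinction in
      -- `rayQuotient` reduces to this one.
      rcases eq_or_ne s 0 with rfl | hs0
      · rw [rayQuotient, if_pos wave_zero, div_eq_mul_inv]
        simp only [e, d, hadamard_zero_one]
      · have h1 : wave lam s ≠ 1 := by
          rw [← sub_ne_zero, ← hd1]
          exact smul_ne_zero hs0 hp
        rw [rayQuotient, if_neg h1, ← hd1, ← he1, div_eq_mul_inv, Complex.real_smul,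
          Complex.real_smul, ← div_eq_mul_inv, ← div_eq_mul_inv,
          mul_div_mul_left _ _ (by exact_mod_cast hs0)]
  · have hU : IsOpen {s : ℝ | wave lam s - 1 ≠ 0} :=
      isOpen_compl_singleton.preimage hwave'.continuous
    refine ⟨univ ×ˢ {s : ℝ | wave lam s - 1 ≠ 0}, isOpen_univ.prod hU,
      ⟨mem_univ _, sub_ne_zero.2 hs⟩, fun f s => ray x₀ f s * (wave lam s - 1)⁻¹,
      (hray.mono (subset_univ _)).mul (isOpen_univ.prod hU)
        (SmoothFamily.of_contDiffOn hU (hwave'.contDiffOn.inv fun _ hs => hs) fun _ hp => hp.2), ?_⟩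
    rintro ⟨f, s⟩ ⟨-, hp⟩
    simp only [rayQuotient, if_neg (sub_ne_zero.1 hp), div_eq_mul_inv]

theorem contDiffOn_log_norm : ContDiffOn ℝ ∞ (fun z : V => Real.log ‖z‖) {0}ᶜ := fun _ hz =>
  (((contDiffAt_norm ℝ hz)).log (norm_ne_zero_iff.2 hz)).contDiffWithinAt

theorem contDiffOn_norm_smul (x₀ : V) : ContDiffOn ℝ ∞ (fun z : V => ‖z‖ • x₀) {0}ᶜ := fun _ hz =>
  ((contDiffAt_norm ℝ hz).smul contDiffAt_const).contDiffWithinAt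

theorem norm_lam_smul (z : V) : ‖(lam : ℝ) • z‖ = lam * ‖z‖ := by
  rw [norm_smul, Real.norm_of_nonneg lam.2.1.le]

variable (V lam) in
/-- The function `exp (2πi log ‖z‖ / log λ)`. -/
def winding : SmoothFun 𝓘(ℝ, V) (HopfManifold V lam) :=
  descend (fun z => wave lam (Real.log ‖z‖)) (contDiff_wave.comp_contDiffOn contDiffOn_log_norm)
    fun z hz => by rw [norm_lam_smul, wave_log_smul (norm_pos_iff.2 hz)]

theorem lift_winding {z : V} (hz : z ≠ 0) : lift (winding V lam) z = wave lam (Real.log ‖z‖) :=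
  lift_descend hz

variable [LocallyCompactSpace V]

theorem contDiffOn_restrictRay {x₀ : V} (hx₀ : x₀ ≠ 0)
    (f : SmoothFun 𝓘(ℝ, V) (HopfManifold V lam)) :
    ContDiffOn ℝ ∞ (fun z : V => lift f (‖z‖ • x₀)) {0}ᶜ :=
  (contDiffOn_lift f).comp (contDiffOn_norm_smul x₀)
    fun _ hz => smul_ne_zero (norm_ne_zero_iff.2 hz) hx₀

/-- The function `z ↦ f (‖z‖ x₀)`. -/
def restrictRay {x₀ : V} (hx₀ : x₀ ≠ 0) (f : SmoothFun 𝓘(ℝ, V) (HopfManifold V lam)) :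
    SmoothFun 𝓘(ℝ, V) (HopfManifold V lam) :=
  descend (fun z => lift f (‖z‖ • x₀)) (contDiffOn_restrictRay hx₀ f)
    fun z _ => by rw [norm_lam_smul, mul_smul, lift_smul]

theorem lift_restrictRay {x₀ : V} (hx₀ : x₀ ≠ 0) (f : SmoothFun 𝓘(ℝ, V) (HopfManifold V lam))
    (z : V) : lift (restrictRay hx₀ f) z = lift f (‖z‖ • x₀) := by
  by_cases hz : z = 0
  · rw [hz, norm_zero, zero_smul, lift_at_zero, lift_at_zero]
  · exact lift_descend hz

theorem continuous_restrictRay {x₀ : V} (hx₀ : x₀ ≠ 0) :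
    Continuous (restrictRay (lam := lam) hx₀) :=
  continuous_of_lift_family ((lift_family.comp isOpen_univ_prod_compl continuous_id
    (SmoothFamily.of_contDiffOn isOpen_compl_singleton (contDiffOn_norm_smul x₀) fun _ hp => hp.2)
    fun _ hp => ⟨mem_univ _, smul_ne_zero (norm_ne_zero_iff.2 hp.2) hx₀⟩).congr
      isOpen_univ_prod_compl fun q _ => lift_restrictRay hx₀ q.1 q.2)

theorem rayQuotient_log_family {x₀ : V} (hx₀ : x₀ ≠ 0) :
    SmoothFamily (fun (f : SmoothFun 𝓘(ℝ, V) (HopfManifold V lam)) (z : V) =>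
      rayQuotient x₀ f (Real.log ‖z‖)) (univ ×ˢ {0}ᶜ) :=
  (rayQuotient_family hx₀).comp isOpen_univ_prod_compl continuous_id
    (SmoothFamily.of_contDiffOn isOpen_compl_singleton contDiffOn_log_norm fun _ hp => hp.2)
    fun _ _ => mem_univ _

theorem contDiffOn_rayQuotient_log {x₀ : V} (hx₀ : x₀ ≠ 0)
    (f : SmoothFun 𝓘(ℝ, V) (HopfManifold V lam)) :
    ContDiffOn ℝ ∞ (fun z : V => rayQuotient x₀ f (Real.log ‖z‖)) {0}ᶜ := fun z hz =>
  ((rayQuotient_log_family hx₀).contDiffAt isOpen_univ_prod_compl (p := (f, z))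
    ⟨mem_univ _, hz⟩).contDiffWithinAt

/-- The function `z ↦ (f (‖z‖ x₀) - f x₀) / (winding z - 1)`. -/
def divideRay {x₀ : V} (hx₀ : x₀ ≠ 0) (f : SmoothFun 𝓘(ℝ, V) (HopfManifold V lam)) :
    SmoothFun 𝓘(ℝ, V) (HopfManifold V lam) :=
  descend (fun z => rayQuotient x₀ f (Real.log ‖z‖)) (contDiffOn_rayQuotient_log hx₀ f)
    fun z hz => by
      rw [norm_lam_smul, Real.log_mul lam.2.1.ne' (norm_ne_zero_iff.2 hz),
        ← rayQuotient_sub_int x₀ f _ 1, Int.cast_one, one_mul, add_sub_cancel_left]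

theorem lift_divideRay {x₀ : V} (hx₀ : x₀ ≠ 0) (f : SmoothFun 𝓘(ℝ, V) (HopfManifold V lam))
    {z : V} (hz : z ≠ 0) : lift (divideRay hx₀ f) z = rayQuotient x₀ f (Real.log ‖z‖) :=
  lift_descend hz

theorem continuous_divideRay {x₀ : V} (hx₀ : x₀ ≠ 0) : Continuous (divideRay (lam := lam) hx₀) :=
  continuous_of_lift_family ((rayQuotient_log_family hx₀).congr isOpen_univ_prod_compl
    fun q hq => lift_divideRay hx₀ q.1 hq.2)

/-- The map `(k, b) ↦ k + (winding - 2) k(‖z‖ x₀) + b`, which identifies `C^∞ × ℂ` with `C^∞`. -/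
def absorb {x₀ : V} (hx₀ : x₀ ≠ 0) : SmoothFun 𝓘(ℝ, V) (HopfManifold V lam) × ℂ →ₗ[ℂ]
    SmoothFun 𝓘(ℝ, V) (HopfManifold V lam) where
  toFun q := q.1 + (winding V lam - (2 : ℂ) • 1) * restrictRay hx₀ q.1 + q.2 • 1
  map_add' q q' := ext_lift fun z hz => by
    simp only [lift_add, lift_sub, lift_mul, lift_const_smul, lift_restrictRay, Prod.fst_add,
      Prod.snd_add]
    ring
  map_smul' c q := ext_lift fun z hz => by
    simp only [lift_add, lift_sub, lift_mul, lift_const_smul, lift_restrictRay, Prod.smul_fst,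
      Prod.smul_snd, RingHom.id_apply, smul_eq_mul]
    ring

theorem lift_absorb {x₀ : V} (hx₀ : x₀ ≠ 0) (k : SmoothFun 𝓘(ℝ, V) (HopfManifold V lam)) (b : ℂ)
    {z : V} (hz : z ≠ 0) : lift (absorb hx₀ (k, b)) z =
      lift k z + (wave lam (Real.log ‖z‖) - 2) * lift k (‖z‖ • x₀) + b := by
  change lift (k + (winding V lam - (2 : ℂ) • 1) * restrictRay hx₀ k + b • 1) z = _
  simp only [lift_add, lift_sub, lift_mul, lift_const_smul, lift_restrictRay, lift_winding hz,
    lift_one hz, mul_one]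

theorem continuous_absorb {x₀ : V} (hx₀ : x₀ ≠ 0) : Continuous (absorb (lam := lam) hx₀) := by
  have hmul := (SmoothFun.continuous_mul' (winding V lam - (2 : ℂ) • 1)).comp
    ((continuous_restrictRay hx₀).comp (continuous_fst (Y := ℂ)))
  exact SmoothFun.continuous_add' (SmoothFun.continuous_add' continuous_fst
    (hmul.congr fun _ => mul_comm _ _))
    (SmoothFun.continuous_smul_const continuous_snd 1)

/-- The inverse of `absorb`. -/
def absorbInv {x₀ : V} (hx₀ : x₀ ≠ 0) (g : SmoothFun 𝓘(ℝ, V) (HopfManifold V lam)) :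
    SmoothFun 𝓘(ℝ, V) (HopfManifold V lam) × ℂ :=
  (g + -restrictRay hx₀ g + divideRay hx₀ g, lift g x₀)

theorem continuous_absorbInv {x₀ : V} (hx₀ : x₀ ≠ 0) : Continuous (absorbInv (lam := lam) hx₀) :=
  (SmoothFun.continuous_add' (SmoothFun.continuous_add' continuous_id
    (SmoothFun.continuous_neg' (continuous_restrictRay hx₀))) (continuous_divideRay hx₀)).prodMk
    ((SmoothFun.continuous_eval (proj lam ⟨x₀, hx₀⟩)).congr fun f => (lift_of_ne f hx₀).symm)

theorem lift_absorbInv {x₀ : V} (hx₀ : x₀ ≠ 0) (g : SmoothFun 𝓘(ℝ, V) (HopfManifold V lam))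
    {z : V} (hz : z ≠ 0) : lift (absorbInv hx₀ g).1 z =
      lift g z - lift g (‖z‖ • x₀) + rayQuotient x₀ g (Real.log ‖z‖) := by
  change lift (g + -restrictRay hx₀ g + divideRay hx₀ g) z = _
  have h : -restrictRay hx₀ g = (-1 : ℂ) • restrictRay hx₀ g := by rw [neg_smul, one_smul]
  rw [lift_add, lift_add, h, lift_const_smul, lift_restrictRay, lift_divideRay hx₀ g hz]
  ring

/-- A function splits into its ray part, depending on ‖z‖ alone, and a remainder vanishing on the
ray. The remainder is kept. On ray parts the map is (k, b) ↦ (w - 1) k + b, whose inverse takes the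
value at x₀ and the quotient by w - 1. Subtracting the ray part again turns w - 1 into w - 2. The
condition ‖x₀‖ = 1 gives ‖z‖ x₀ the norm of z. -/
theorem absorb_absorbInv {x₀ : V} (h1 : ‖x₀‖ = 1) (hx₀ : x₀ ≠ 0)
    (g : SmoothFun 𝓘(ℝ, V) (HopfManifold V lam)) : absorb hx₀ (absorbInv hx₀ g) = g := by
  refine ext_lift fun z hz => ?_
  have hn : ‖‖z‖ • x₀‖ = ‖z‖ := by rw [norm_smul, norm_norm, h1, mul_one]
  have h2 := wave_sub_one_mul_rayQuotient x₀ g (Real.log ‖z‖)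
  rw [ray, Real.exp_log (norm_pos_iff.2 hz)] at h2
  have h3 : absorbInv hx₀ g = ((absorbInv hx₀ g).1, lift g x₀) := rfl
  rw [h3, lift_absorb hx₀ _ _ hz, lift_absorbInv hx₀ g hz,
    lift_absorbInv hx₀ g (smul_ne_zero (norm_ne_zero_iff.2 hz) hx₀), hn]
  linear_combination h2

theorem absorbInv_absorb {x₀ : V} (h1 : ‖x₀‖ = 1) (hx₀ : x₀ ≠ 0)
    (q : SmoothFun 𝓘(ℝ, V) (HopfManifold V lam) × ℂ) : absorbInv hx₀ (absorb hx₀ q) = q := by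
  obtain ⟨k, b⟩ := q
  have hray : ∀ s : ℝ, ‖Real.exp s • x₀‖ = Real.exp s := fun s => by
    rw [norm_smul, Real.norm_of_nonneg (Real.exp_pos s).le, h1, mul_one]
  -- On the ray, k and (w - 2) k add up to (w - 1) k; at x₀ this vanishes and leaves b.
  have hval : ∀ s : ℝ, lift (absorb hx₀ (k, b)) (Real.exp s • x₀) =
      (wave lam s - 1) * lift k (Real.exp s • x₀) + b := fun s => by
    rw [lift_absorb hx₀ k b (smul_ne_zero (Real.exp_pos s).ne' hx₀), hray, Real.log_exp]
    ring
  have hb : lift (absorb hx₀ (k, b)) x₀ = b := by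
    have := hval 0
    rwa [Real.exp_zero, one_smul, wave_zero, sub_self, zero_mul, zero_add] at this
  have hdiff : DifferentiableAt ℝ (fun s : ℝ => lift k (Real.exp s • x₀)) 0 := by
    have h2 : ContDiffAt ℝ ∞ (lift k) (Real.exp 0 • x₀) :=
      (contDiffOn_lift k).contDiffAt (isOpen_compl_singleton.mem_nhds
        (smul_ne_zero (Real.exp_pos 0).ne' hx₀))
    exact (h2.differentiableAt (by simp)).comp (0 : ℝ)
      (Real.differentiable_exp.smul_const x₀).differentiableAt
  have hper : ∀ (s : ℝ) (j : ℤ), lift k (Real.exp (s - j * Real.log lam) • x₀) =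
      lift k (Real.exp s • x₀) := fun s j => sub_left_inj.1 (ray_sub_int x₀ k s j)
  refine Prod.ext (ext_lift fun z hz => ?_) hb
  have hn := norm_pos_iff.2 hz
  have h3 := hval (Real.log ‖z‖)
  rw [Real.exp_log hn] at h3
  rw [lift_absorbInv hx₀ _ hz, h3, lift_absorb hx₀ k b hz,
    rayQuotient_eq (K := fun s => lift k (Real.exp s • x₀)) hdiff hper
      (fun s => by rw [ray, hval, hb, add_sub_cancel_right]), Real.exp_log hn]
  ring

end Reeb

/-! ### The Hopf manifold of ℝ^(m+1) is diffeomorphic to S^m × S¹ -/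

namespace Reeb

section Projection

variable {V : Type} [NormedAddCommGroup V] [NormedSpace ℝ V] [Nontrivial V]
  {lam : Set.Ioo (0 : ℝ) 1}

open Classical in
variable (lam) in
/-- The projection `V \ {0} → (V \ {0}) / Γ`, extended by an arbitrary value at 0. -/
def extProj (v : V) : HopfManifold V lam :=
  proj lam (if h : v ≠ 0 then ⟨v, h⟩ else ⟨_, (exists_ne (0 : V)).choose_spec⟩)

theorem extProj_of_ne {v : V} (hv : v ≠ 0) : extProj lam v = proj lam ⟨v, hv⟩ := by
  rw [extProj, dif_pos hv]

theorem extProj_coe (v : punctured V) : extProj lam (v : V) = proj lam v := extProj_of_ne v.2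

theorem extProj_zpow_smul (k : ℤ) {v : V} (hv : v ≠ 0) :
    extProj lam ((lam : ℝ) ^ k • v) = extProj lam v := by
  rw [extProj_of_ne hv, ← proj_dilation k, ← extProj_coe]
  rfl

theorem contMDiffAt_extProj {v : V} (hv : v ≠ 0) :
    ContMDiffAt 𝓘(ℝ, V) 𝓘(ℝ, V) ∞ (extProj lam) v := by
  let y : punctured V := ⟨v, hv⟩
  have h0 := chart_proj (lam := lam) y (mem_annulus y)
  have hmem : v ∈ (chart lam y).target := by
    have := (chart lam y).map_source h0.1
    rwa [h0.2] at this
  have ht := (chart lam y).open_target.mem_nhds hmem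
  refine ContMDiffAt.congr_of_eventuallyEq ((contMDiffOn_symm_of_mem_maximalAtlas
    (IsManifold.subset_maximalAtlas (show chart lam y ∈ atlas V (HopfManifold V lam) from
      ⟨y, rfl⟩))).contMDiffAt ht) ?_
  filter_upwards [ht] with u hu
  obtain ⟨z, -, rfl, h⟩ := chart_symm y hu
  rw [h, extProj_coe]

end Projection

variable {m : ℕ} {lam : Set.Ioo (0 : ℝ) 1}

theorem fact_finrank_euclideanSpace (m : ℕ) :
    Fact (Module.finrank ℝ (EuclideanSpace ℝ (Fin (m + 1))) = m + 1) :=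
  ⟨finrank_euclideanSpace_fin⟩

attribute [local instance] fact_finrank_euclideanSpace

/-- The direction `z / ‖z‖` of a point of the Hopf manifold. -/
def direction (p : HopfManifold (EuclideanSpace ℝ (Fin (m + 1))) lam) :
    EuclideanSpace ℝ (Fin (m + 1)) :=
  Quotient.lift (fun z : punctured (EuclideanSpace ℝ (Fin (m + 1))) =>
    ‖(z : EuclideanSpace ℝ (Fin (m + 1)))‖⁻¹ • (z : EuclideanSpace ℝ (Fin (m + 1)))) (by
    rintro z y ⟨k, hk⟩
    have h := zpow_pos lam.2.1 k
    simp only [hk, norm_smul, Real.norm_of_nonneg h.le, smul_smul, mul_inv]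
    rw [mul_right_comm, inv_mul_cancel₀ h.ne', one_mul]) p

theorem direction_mem (p : HopfManifold (EuclideanSpace ℝ (Fin (m + 1))) lam) :
    direction p ∈ Metric.sphere (0 : EuclideanSpace ℝ (Fin (m + 1))) 1 := by
  obtain ⟨z, rfl⟩ := proj_surjective p
  rw [mem_sphere_zero_iff_norm]
  change ‖‖(z : EuclideanSpace ℝ (Fin (m + 1)))‖⁻¹ • (z : EuclideanSpace ℝ (Fin (m + 1)))‖ = 1
  rw [norm_smul, norm_inv, norm_norm, inv_mul_cancel₀ (norm_ne_zero_iff.2 z.2)]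

theorem contMDiff_direction : ContMDiff 𝓘(ℝ, EuclideanSpace ℝ (Fin (m + 1)))
    𝓘(ℝ, EuclideanSpace ℝ (Fin (m + 1))) ∞ (direction (m := m) (lam := lam)) :=
  contMDiff_of_lift (F := fun z => ‖z‖⁻¹ • z) (ContDiffOn.contMDiffOn fun _ hz =>
    (((contDiffAt_norm ℝ hz).inv (norm_ne_zero_iff.2 hz)).smul contDiffAt_id).contDiffWithinAt)
    fun _ => rfl

/-- The point `exp (2πi log ‖z‖ / log λ)` of the circle. -/
def circlePhase (p : HopfManifold (EuclideanSpace ℝ (Fin (m + 1))) lam) : Circle :=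
  Quotient.lift (fun z : punctured (EuclideanSpace ℝ (Fin (m + 1))) => Circle.exp
    (2 * Real.pi / Real.log lam * Real.log ‖(z : EuclideanSpace ℝ (Fin (m + 1)))‖)) (by
    rintro z y ⟨k, hk⟩
    have h := zpow_pos lam.2.1 k
    refine Circle.exp_eq_exp.2 ⟨-k, ?_⟩
    rw [hk, norm_smul, Real.norm_of_nonneg h.le, Real.log_mul h.ne' (norm_ne_zero_iff.2 z.2),
      Real.log_zpow]
    have := log_neg (lam := lam).ne
    push_cast
    field_simp
    ring) p

theorem contMDiff_circlePhase : ContMDiff 𝓘(ℝ, EuclideanSpace ℝ (Fin (m + 1))) (𝓡 1) ∞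
    (circlePhase (m := m) (lam := lam)) := by
  have h : ContDiffOn ℝ ∞ (fun z : EuclideanSpace ℝ (Fin (m + 1)) =>
      2 * Real.pi / Real.log lam * Real.log ‖z‖) {0}ᶜ := contDiffOn_const.mul contDiffOn_log_norm
  exact contMDiff_of_lift (contMDiff_circleExp.comp_contMDiffOn h.contMDiffOn) fun _ => rfl

/-- The diffeomorphism from the Hopf manifold of `ℝ^(m+1)` to `S^m × S^1`. -/
def toSphereCircle (p : HopfManifold (EuclideanSpace ℝ (Fin (m + 1))) lam) : Sphere m × Circle :=
  (codRestrict direction _ direction_mem p, circlePhase p)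

theorem contMDiff_toSphereCircle : ContMDiff 𝓘(ℝ, EuclideanSpace ℝ (Fin (m + 1)))
    ((𝓡 m).prod (𝓡 1)) ∞ (toSphereCircle (m := m) (lam := lam)) :=
  (contMDiff_direction.codRestrict_sphere direction_mem).prodMk contMDiff_circlePhase

/-- The point of the Hopf manifold with direction `x` and angle `θ`. -/
def ofAngle (lam : Set.Ioo (0 : ℝ) 1) (x : Sphere m) (θ : ℝ) :
    HopfManifold (EuclideanSpace ℝ (Fin (m + 1))) lam :=
  extProj lam (Real.exp (Real.log lam * (θ / (2 * Real.pi))) •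
    (x : EuclideanSpace ℝ (Fin (m + 1))))

theorem exp_smul_sphere_ne_zero (s : ℝ) (x : Sphere m) :
    Real.exp s • (x : EuclideanSpace ℝ (Fin (m + 1))) ≠ 0 :=
  smul_ne_zero (Real.exp_pos s).ne' (ne_zero_of_mem_unit_sphere x)

/-- Adding 2π to the angle multiplies the point by λ, which is trivial in the quotient. -/
theorem ofAngle_eq_of_exp_eq (x : Sphere m) {θ θ' : ℝ} (h : Circle.exp θ = Circle.exp θ') :
    ofAngle lam x θ = ofAngle lam x θ' := by
  obtain ⟨k, rfl⟩ := Circle.exp_eq_exp.1 h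
  have hpi := Real.pi_ne_zero
  have h1 : Real.exp (Real.log lam * ((θ' + k * (2 * Real.pi)) / (2 * Real.pi))) =
      (lam : ℝ) ^ k * Real.exp (Real.log lam * (θ' / (2 * Real.pi))) := by
    rw [show Real.log lam * ((θ' + k * (2 * Real.pi)) / (2 * Real.pi)) =
      Real.log lam * k + Real.log lam * (θ' / (2 * Real.pi)) by field_simp; ring, Real.exp_add,
      Real.exp_mul, Real.exp_log lam.2.1, Real.rpow_intCast]
  rw [ofAngle, ofAngle, h1, mul_smul, extProj_zpow_smul k (exp_smul_sphere_ne_zero _ x)]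

/-- The inverse of `toSphereCircle`. -/
def ofSphereCircle (lam : Set.Ioo (0 : ℝ) 1) (q : Sphere m × Circle) :
    HopfManifold (EuclideanSpace ℝ (Fin (m + 1))) lam :=
  ofAngle lam q.1 (Complex.arg q.2)

theorem toSphereCircle_ofSphereCircle (q : Sphere m × Circle) :
    toSphereCircle (ofSphereCircle lam q) = q := by
  obtain ⟨x, w⟩ := q
  have hx : ‖(x : EuclideanSpace ℝ (Fin (m + 1)))‖ = 1 := mem_sphere_zero_iff_norm.1 x.2
  rw [ofSphereCircle, ofAngle, extProj_of_ne (exp_smul_sphere_ne_zero _ x)]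
  set s := Real.log lam * (Complex.arg w / (2 * Real.pi)) with hs
  have hn : ‖Real.exp s • (x : EuclideanSpace ℝ (Fin (m + 1)))‖ = Real.exp s := by
    rw [norm_smul, Real.norm_of_nonneg (Real.exp_pos s).le, hx, mul_one]
  refine Prod.ext (Subtype.ext ?_) ?_
  · change ‖Real.exp s • (x : EuclideanSpace ℝ (Fin (m + 1)))‖⁻¹ • Real.exp s •
      (x : EuclideanSpace ℝ (Fin (m + 1))) = x
    rw [hn, smul_smul, inv_mul_cancel₀ (Real.exp_pos s).ne', one_smul]
  · change Circle.exp (2 * Real.pi / Real.log lam *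
      Real.log ‖Real.exp s • (x : EuclideanSpace ℝ (Fin (m + 1)))‖) = w
    have h := log_neg (lam := lam).ne
    have hpi := Real.pi_ne_zero
    rw [hn, Real.log_exp, hs, show 2 * Real.pi / Real.log lam *
      (Real.log lam * (Complex.arg w / (2 * Real.pi))) = Complex.arg w by field_simp]
    exact Circle.exp_arg w

theorem ofSphereCircle_toSphereCircle (p : HopfManifold (EuclideanSpace ℝ (Fin (m + 1))) lam) :
    ofSphereCircle lam (toSphereCircle p) = p := by
  obtain ⟨z, rfl⟩ := proj_surjective p
  have hz := norm_pos_iff.2 z.2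
  have h := log_neg (lam := lam).ne
  have hpi := Real.pi_ne_zero
  let x : Sphere m := (toSphereCircle (proj lam z)).1
  change ofAngle lam x (Complex.arg (circlePhase (proj lam z))) = _
  refine (ofAngle_eq_of_exp_eq x (Circle.exp_arg (circlePhase (proj lam z)))).trans ?_
  change extProj lam (Real.exp (Real.log lam * ((2 * Real.pi / Real.log lam *
    Real.log ‖(z : EuclideanSpace ℝ (Fin (m + 1)))‖) / (2 * Real.pi))) •
    ‖(z : EuclideanSpace ℝ (Fin (m + 1)))‖⁻¹ • (z : EuclideanSpace ℝ (Fin (m + 1)))) = _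
  rw [show Real.log lam * ((2 * Real.pi / Real.log lam *
    Real.log ‖(z : EuclideanSpace ℝ (Fin (m + 1)))‖) / (2 * Real.pi)) =
    Real.log ‖(z : EuclideanSpace ℝ (Fin (m + 1)))‖ by field_simp, Real.exp_log hz, smul_smul,
    mul_inv_cancel₀ hz.ne', one_smul, extProj_coe]

/-- The argument jumps on the negative axis, but only its class modulo 2π matters, so any smooth
local choice of angle will do. -/
theorem contMDiff_ofSphereCircle : ContMDiff ((𝓡 m).prod (𝓡 1))
    𝓘(ℝ, EuclideanSpace ℝ (Fin (m + 1))) ∞ (ofSphereCircle (m := m) lam) := by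
  have hcirc : ContMDiff (𝓡 1) 𝓘(ℝ, ℂ) ∞ fun w : Circle => (w : ℂ) := by
    have := finrank_real_complex_fact'
    exact contMDiff_coe_sphere (E := ℂ) (n := 1)
  have hsph : ContMDiff (𝓡 m) 𝓘(ℝ, EuclideanSpace ℝ (Fin (m + 1))) ∞
      fun x : Sphere m => (x : EuclideanSpace ℝ (Fin (m + 1))) := contMDiff_coe_sphere
  have harg : ∀ c ∈ Complex.slitPlane, ContDiffAt ℝ ∞ Complex.arg c := fun c hc =>

    ((Complex.imCLM.contDiff.contDiffAt.comp c
      ((Complex.contDiffAt_log hc).restrict_scalars ℝ)).congr_of_eventuallyEq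
        (Filter.Eventually.of_forall fun c => (Complex.log_im c).symm) : ContDiffAt ℝ ∞ _ c)
  have key : ∀ (q : Sphere m × Circle) (α : ℂ → ℝ), ContDiffAt ℝ ∞ α q.2 →
      (∀ w : Circle, Circle.exp (α w) = w) →
      ContMDiffAt ((𝓡 m).prod (𝓡 1)) 𝓘(ℝ, EuclideanSpace ℝ (Fin (m + 1))) ∞
        (ofSphereCircle (m := m) lam) q := by
    intro q α hα h
    have h1 : ofSphereCircle (m := m) lam = fun q => ofAngle lam q.1 (α q.2) := funext fun q =>
      ofAngle_eq_of_exp_eq _ ((Circle.exp_arg q.2).trans (h q.2).symm)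
    have h2 : ContDiff ℝ ∞ fun θ : ℝ => Real.exp (Real.log lam * (θ / (2 * Real.pi))) :=
      Real.contDiff_exp.comp (contDiff_const.mul (contDiff_id.div_const _))
    have h3 : ContMDiffAt ((𝓡 m).prod (𝓡 1)) 𝓘(ℝ, ℝ) ∞ (fun q : Sphere m × Circle =>
        Real.exp (Real.log lam * (α q.2 / (2 * Real.pi)))) q :=
      (h2.contMDiff.contMDiffAt.comp q.2 (hα.contMDiffAt.comp q.2 hcirc.contMDiffAt)).comp q
        contMDiffAt_snd
    rw [h1]
    exact (contMDiffAt_extProj (exp_smul_sphere_ne_zero _ q.1)).comp q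
      (h3.smul ((hsph.contMDiffAt).comp q contMDiffAt_fst))
  intro q
  by_cases hq : (q.2 : ℂ) ∈ Complex.slitPlane
  · exact key q Complex.arg (harg _ hq) Circle.exp_arg
  · have hq' : -(q.2 : ℂ) ∈ Complex.slitPlane :=
      (Complex.mem_slitPlane_or_neg_mem_slitPlane (Circle.coe_ne_zero q.2)).resolve_left hq
    -- The branch of the angle that is smooth near the negative real axis.
    refine key q (fun c => Complex.arg (-c) + Real.pi)
      (((harg _ hq').comp (q.2 : ℂ) contDiff_neg.contDiffAt).add contDiffAt_const) fun w => ?_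
    rw [Circle.exp_add, ← Circle.coe_neg, Circle.exp_arg]
    refine Circle.ext ?_
    simp [Circle.coe_exp, Complex.exp_pi_mul_I]

end Reeb

/-! ### Assembly -/

namespace Reeb

/-- `obstruction` has the right kernel, while `absorb` and the pullback are bijective with
continuous inverses; so the composite is a quotient map with the same kernel. -/
theorem exists_cohomology_one_sphereCircle (m : ℕ) (lam : Set.Ioo (0 : ℝ) 1) :
    Nonempty ((affineFlow (m + 1) lam).Cohomology 1 ≃L[ℂ] SphereCircleFun m) := by
  obtain ⟨x₀, h1⟩ : ∃ x₀ : EuclideanSpace ℝ (Fin (m + 1)), ‖x₀‖ = 1 := exists_norm_eq _ zero_le_one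
  have hx₀ : x₀ ≠ 0 := fun h => by simp [h] at h1
  let φ : SmoothFun 𝓘(ℝ, EuclideanSpace ℝ (Fin (m + 1)))
      (HopfManifold (EuclideanSpace ℝ (Fin (m + 1))) lam) →ₗ[ℂ] SphereCircleFun m :=
    SmoothFun.pullback (ofSphereCircle lam) contMDiff_ofSphereCircle
  have hφ : ∀ f, SmoothFun.pullback toSphereCircle contMDiff_toSphereCircle (φ f) = f :=
    fun f => SmoothFun.ext fun p => congrArg f (ofSphereCircle_toSphereCircle p)
  have hφ' : IsQuotientMap φ := IsQuotientMap.of_inverse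
    (SmoothFun.continuous_pullback toSphereCircle contMDiff_toSphereCircle)
    (SmoothFun.continuous_pullback _ _)
    fun f => SmoothFun.ext fun q => congrArg f (toSphereCircle_ofSphereCircle q)
  have ha : IsQuotientMap (absorb (lam := lam) hx₀) := IsQuotientMap.of_inverse
    (continuous_absorbInv hx₀) (continuous_absorb hx₀) (absorb_absorbInv h1 hx₀)
  refine exists_cohomology_one_equiv (φ ∘ₗ absorb hx₀ ∘ₗ obstruction (proj lam ⟨x₀, hx₀⟩))
    (hφ'.comp (ha.comp (isQuotientMap_obstruction _))) ?_
  rw [← ker_obstruction (proj lam ⟨x₀, hx₀⟩), LinearMap.ker_comp_of_ker_eq_bot,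
    LinearMap.ker_comp_of_ker_eq_bot]
  · exact LinearMap.ker_eq_bot.2 (Function.LeftInverse.injective (absorbInv_absorb h1 hx₀))
  · exact LinearMap.ker_eq_bot.2 (Function.LeftInverse.injective hφ)

end Reeb

end

end

theorem mainTheorem1 (n : ℕ) (hn : 2 ≤ n) (lam : Set.Ioo (0 : ℝ) 1) :
    (∃ e : (affineFlow n lam).Cohomology 0 ≃L[ℂ] ℂ,
      ∀ (f : (affineFlow n lam).cocycles 0) (p : HopfManifold (Model n) lam),
        (affineFlow n lam).eval ![] f.1 p = e ((affineFlow n lam).cohClass f)) ∧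
    Nonempty ((affineFlow n lam).Cohomology 1 ≃L[ℂ] SphereCircleFun (n - 1)) ∧
    (∀ l : ℕ, 2 ≤ l → Subsingleton ((affineFlow n lam).Cohomology l)) ∧
    (∃ X : (affineFlow n lam).fields, ∀ p, X.1 p ≠ 0) ∧
    (∀ X : (affineFlow n lam).fields, (∀ p, X.1 p ≠ 0) →
      ∃ e : (affineFlow n lam).Cohomology 1 ≃L[ℂ]
          (SmoothFun 𝓘(ℝ, Model n) (HopfManifold (Model n) lam) ⧸
            LinearMap.range (fieldDeriv X.1)),
        ∀ α : (affineFlow n lam).cocycles 1,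
          e ((affineFlow n lam).cohClass α) =
            Submodule.Quotient.mk ((affineFlow n lam).eval ![X] α.1)) := by
  obtain ⟨m, rfl⟩ : ∃ m, n = m + 1 := ⟨n - 1, by omega⟩
  obtain ⟨z₀, hz₀⟩ := exists_ne (0 : EuclideanSpace ℝ (Fin (m + 1)))
  exact ⟨exists_cohomology_zero_equiv hz₀, exists_cohomology_one_sphereCircle m lam,
    fun _ hl => subsingleton_cohomology hl, ⟨reebTangent (m + 1) lam, reebField_ne_zero⟩,
    exists_cohomology_one_equiv_obstructions⟩
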